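/- **Setting.** Let $(\mathcal S,\mathcal A,\mathcal P,r,\gamma)$ be a Markov decision process with cost function $r$, discount factor $\gamma\in[0,1)$ and initial distribution $\rho$. Let $\pi_\theta(a\mid s)$, $\theta\in\mathbb R^d$ with $d\ge 2$, be a parametrized policy: a probability density in $a$ with respect to a fixed $\sigma$-finite measure, twice continuously differentiable in $\theta$, whose set of actions of positive density in a state does not depend on $\theta$. For a trajectory $\tau=(s_0,a_0,\dots,s_{H-1},a_{H-1})$ of length $H$ let $p(\tau;\theta)$ be its density under $\pi_\theta$, $\mathcal R(\tau)=\sum_{h<H}\gamma^h r(s_h,a_h)$, $J(\theta)=\mathbb E_{\tau\sim p(\cdot;\theta)}[\mathcal R(\tau)]$ and $J^*=\inf_\theta J(\theta)$. With $\Psi_h(\tau)=\sum_{i=h}^{H-1}\gamma^i r(s_i,a_i)$ put $$g(\theta;\tau)=\sum_{h<H}\Psi_h(\tau)\nabla\log\pi_\theta(a_h\mid s_h),\qquad H(\theta;\tau)=\nabla g(\theta;\tau)+g(\theta;\tau)\,\nabla\log p(\tau;\theta)^{\mathsf T}.$$ **Assumptions.** There are constants $R,G,L,M>0$ such that 1.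 $|r(s,a)|\le R$ for all $s,a$; 2. for all $\theta$ and all $h<H$, with $\tau\sim p(\cdot;\theta)$: $\mathbb E_\tau\|\nabla\log\pi_\theta(a_h\mid s_h)\|^4\le G^4$ and $\mathbb E_\tau\|\nabla^2\log\pi_\theta(a_h\mid s_h)\|^2\le L^2$; 3. $\|\nabla^2J(\theta_1)-\nabla^2J(\theta_2)\|\le M\|\theta_1-\theta_2\|$ for all $\theta_1,\theta_2$. Matrix norms are spectral norms. Put $$G_g^2=\frac{G^2R^2}{(1-\gamma)^3},\qquad G_H^2=\frac{H^4G^4R^2}{(1-\gamma)^2}+\frac{L^2R^2}{(1-\gamma)^4}.$$ **Algorithm (full-dimension SOPO).** Start at $\theta_0$. In iteration $t=0,\dots,T-1$, draw, given the past, a batch $\mathcal M_g$ and a batch $\mathcal M_H$, each consisting of i.i.d. trajectories from $p(\cdot;\theta_t)$; let $g_t=\frac1{|\mathcal M_g|}\sum_{\tau\in\mathcal M_g}g(\theta_t;\tau)$ and $H_t=\frac1{|\mathcal M_H|}\sum_{\tau\in\mathcal M_H}H(\theta_t;\tau)$; let $d_{t+1}$ be any global minimizer of $J(\theta_t)+g_t^{\mathsf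 T}v+\frac12v^{\mathsf T}H_tv$ over $\{v\in\mathbb R^d:\|v\|\le\Delta\}$; set $\theta_{t+1}=\theta_t+d_{t+1}$. **Theorem.** Let $\epsilon>0$, $\Delta=\frac{2\sqrt\epsilon}{M}$, $\Delta_J\ge J(\theta_0)-J^*$, and let the positive integers $|\mathcal M_g|$, $|\mathcal M_H|$, $T$ satisfy $$|\mathcal M_g|\ge\frac{144M^2G_g^2}{\epsilon^2},\qquad|\mathcal M_H|\ge\frac{22\cdot24^2\,G_H^2\log d}{\epsilon},\qquad T\ge\frac{24M^2\Delta_J}{\epsilon^{3/2}}$$ (for example, the least such integers). Let $\bar t$ be uniform on $\{1,\dots,T\}$ and independent of the iterates. Then $$\mathbb E\|\nabla J(\theta_{\bar t})\|\le\frac3M\epsilon,\qquad\mathbb E\big[\lambda_{\min}(\nabla^2J(\theta_{\bar t}))\big]\ge-2\sqrt\epsilon,$$ and, with probability at least $\frac78$, $\ \|\nabla J(\theta_{\bar t})\|\le\frac{12}M\epsilon$. -/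

import Mathlib

open MeasureTheory ProbabilityTheory

namespace SOPO

noncomputable section

/-- The parameter space `ℝᵈ` with its Euclidean norm. -/
abbrev Param (d : ℕ) : Type := EuclideanSpace ℝ (Fin d)

/-- A trajectory `(s₀, a₀, …, s_{H-1}, a_{H-1})` of length `H`. -/
abbrev Traj (S A : Type*) (H : ℕ) : Type _ := Fin H → S × A

/-- A Markov decision process with state space `S` and action space `A`: transition kernel,
initial distribution, cost function and discount factor. -/
structure MDP (S A : Type*) [MeasurableSpace S] [MeasurableSpace A] where
  /-- the transition kernel `𝒫(· | s, a)` -/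
  trans : Kernel (S × A) S
  isMarkov_trans : IsMarkovKernel trans
  /-- the distribution of the initial state -/
  init : Measure S
  isProb_init : IsProbabilityMeasure init
  /-- the one-step cost `r(s, a)` -/
  cost : S → A → ℝ
  measurable_cost : Measurable (Function.uncurry cost)
  /-- the discount factor `γ` -/
  discount : ℝ
  discount_nonneg : 0 ≤ discount
  discount_lt_one : discount < 1

/-- A policy `π_θ(a | s)` parametrized by `θ ∈ ℝᵈ`: a probability density in `a` with respect to a
fixed σ-finite reference measure on the action space, twice continuously differentiable in `θ`.
Whether an action is admissible in a state (has positive density) does not depend on `θ`. -/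
structure Policy (S A : Type*) [MeasurableSpace S] [MeasurableSpace A] (d : ℕ) where
  /-- the reference measure on actions (counting measure, Lebesgue measure, …) -/
  ref : Measure A
  sigmaFinite_ref : SigmaFinite ref
  /-- the density `π_θ(a | s)` -/
  dens : Param d → S → A → ℝ
  measurable_dens : ∀ θ, Measurable (Function.uncurry (dens θ))
  pos_or_zero : ∀ s a, (∀ θ, 0 < dens θ s a) ∨ (∀ θ, dens θ s a = 0)
  contDiff_dens : ∀ s a, ContDiff ℝ 2 (fun θ => dens θ s a)
  lintegral_dens : ∀ θ s, ∫⁻ a, ENNReal.ofReal (dens θ s a) ∂ref = 1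

variable {S A : Type*} [MeasurableSpace S] [MeasurableSpace A] {d : ℕ}

/-- The measure `∏ₕ ref(daₕ) 𝒫(ds_{h+1} | sₕ, aₕ)` on trajectories of length `n` from a given first
state; the state reached after the last action is integrated out. -/
def baseKernel (m : MDP S A) (ν : Measure A) : (n : ℕ) → Kernel S (Traj S A n)
  | 0 => Kernel.const S (Measure.dirac Fin.elim0)
  | n + 1 =>
      (Kernel.id ×ₖ (Kernel.const S ν ⊗ₖ (baseKernel m ν n ∘ₖ m.trans))).map
        (fun x : S × (A × Traj S A n) => (Fin.cons (x.1, x.2.1) x.2.2 : Traj S A (n + 1)))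

/-- The reference measure `init(ds₀) ∏ₕ ref(daₕ) 𝒫(ds_{h+1} | sₕ, aₕ)` on trajectories, which
does not depend on the parameter. -/
def baseMeasure (m : MDP S A) (π : Policy S A d) (H : ℕ) : Measure (Traj S A H) :=
  m.init.bind (baseKernel m π.ref H)

/-- The density `p(τ; θ)` of a trajectory with respect to `baseMeasure`. The factors coming from the
initial distribution and the transition kernel are part of `baseMeasure`. -/
def density (π : Policy S A d) {H : ℕ} (θ : Param d) (τ : Traj S A H) : ℝ :=
  ∏ h, π.dens θ (τ h).1 (τ h).2

/-- The law of a trajectory of length `H` generated by the policy `π_θ`. -/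
def trajLaw (m : MDP S A) (π : Policy S A d) (H : ℕ) (θ : Param d) : Measure (Traj S A H) :=
  (baseMeasure m π H).withDensity (fun τ => ENNReal.ofReal (density π θ τ))

/-- The accumulated discounted cost `ℛ(τ)`. -/
def totalCost (m : MDP S A) {H : ℕ} (τ : Traj S A H) : ℝ :=
  ∑ h : Fin H, m.discount ^ (h : ℕ) * m.cost (τ h).1 (τ h).2

/-- The objective `J(θ) = ∫ ℛ(τ) p(τ; θ) dτ`. -/
def J (m : MDP S A) (π : Policy S A d) (H : ℕ) (θ : Param d) : ℝ :=
  ∫ τ, totalCost m τ * density π θ τ ∂(baseMeasure m π H)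

/-- The Hessian of a function on `ℝᵈ`, as a linear map. -/
def hess (f : Param d → ℝ) (θ : Param d) : Param d →L[ℝ] Param d :=
  fderiv ℝ (gradient f) θ

/-- The smallest (real) eigenvalue. -/
def lambdaMin (B : Param d →L[ℝ] Param d) : ℝ :=
  sInf {c : ℝ | Module.End.HasEigenvalue (B : Param d →ₗ[ℝ] Param d) c}

/-- The log-density of the action `a` in state `s`, as a function of the parameter. -/
def logDens (π : Policy S A d) (s : S) (a : A) (θ : Param d) : ℝ :=
  Real.log (π.dens θ s a)

/-- The discounted cost-to-go `Ψₕ(τ) = ∑_{i ≥ h} γⁱ r(sᵢ, aᵢ)`. -/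
def costToGo (m : MDP S A) {H : ℕ} (τ : Traj S A H) (h : Fin H) : ℝ :=
  ∑ i ∈ Finset.Ici h, m.discount ^ (i : ℕ) * m.cost (τ i).1 (τ i).2

/-- The single-trajectory gradient estimator `g(θ; τ)`. -/
def gradEst (m : MDP S A) (π : Policy S A d) {H : ℕ} (τ : Traj S A H) (θ : Param d) : Param d :=
  ∑ h, costToGo m τ h • gradient (logDens π (τ h).1 (τ h).2) θ

/-- The single-trajectory Hessian estimator `H(θ; τ) = ∇g(θ; τ) + g(θ; τ) (∇ log p(τ; θ))ᵀ`. -/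
def hessEst (m : MDP S A) (π : Policy S A d) {H : ℕ} (τ : Traj S A H) (θ : Param d) :
    Param d →L[ℝ] Param d :=
  fderiv ℝ (gradEst m π τ) θ +
    (innerSL ℝ (gradient (fun θ' => Real.log (density π θ' τ)) θ)).smulRight (gradEst m π τ θ)

/-- The mini-batch gradient estimator. -/
def batchGrad (m : MDP S A) (π : Policy S A d) {H k : ℕ} (b : Fin k → Traj S A H)
    (θ : Param d) : Param d :=
  (k : ℝ)⁻¹ • ∑ i, gradEst m π (b i) θ

/-- The mini-batch Hessian estimator. -/
def batchHess (m : MDP S A) (π : Policy S A d) {H k : ℕ} (b : Fin k → Traj S A H)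
    (θ : Param d) : Param d →L[ℝ] Param d :=
  (k : ℝ)⁻¹ • ∑ i, hessEst m π (b i) θ

/-- The cost is bounded by `R`. -/
def BoundedCost (m : MDP S A) (R : ℝ) : Prop :=
  ∀ s a, |m.cost s a| ≤ R

/-- Expected Lipschitzness and smoothness of the policy: under the trajectory law of every parameter
`θ`, at every time step, the fourth moment of `∇ log π_θ` is at most `G⁴` and the second moment of
`∇² log π_θ` is at most `L²`. -/
def ExpectedLS (m : MDP S A) (π : Policy S A d) (H : ℕ) (G L : ℝ) : Prop :=
  ∀ (θ : Param d) (h : Fin H),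
    ∫⁻ τ, ‖gradient (logDens π (τ h).1 (τ h).2) θ‖ₑ ^ 4 ∂(trajLaw m π H θ)
        ≤ ENNReal.ofReal (G ^ 4) ∧
    ∫⁻ τ, ‖hess (logDens π (τ h).1 (τ h).2) θ‖ₑ ^ 2 ∂(trajLaw m π H θ)
        ≤ ENNReal.ofReal (L ^ 2)

/-- The Hessian of the objective is `M`-Lipschitz in operator norm. -/
def LipschitzHessian (m : MDP S A) (π : Policy S A d) (H : ℕ) (M : ℝ) : Prop :=
  ∀ θ₁ θ₂ : Param d, ‖hess (J m π H) θ₁ - hess (J m π H) θ₂‖ ≤ M * ‖θ₁ - θ₂‖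

/-- The variance constant `G_g²` of the gradient estimator. -/
def varGrad (γ R G : ℝ) : ℝ := G ^ 2 * R ^ 2 / (1 - γ) ^ 3

/-- The variance constant `G_H²` of the Hessian estimator. -/
def varHess (γ R G L : ℝ) (H : ℕ) : ℝ :=
  (H : ℝ) ^ 4 * G ^ 4 * R ^ 2 / (1 - γ) ^ 2 + L ^ 2 * R ^ 2 / (1 - γ) ^ 4

/-- The trust-region model `c + gᵀ v + ½ vᵀ B v`. -/
def trModel (c : ℝ) (g : Param d) (B : Param d →L[ℝ] Param d) (v : Param d) : ℝ :=
  c + inner ℝ g v + (1 / 2) * inner ℝ v (B v)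

/-- `v` is a global solution of the full-dimensional trust-region subproblem of radius `Δ`. -/
def IsTRSolution (c : ℝ) (g : Param d) (B : Param d →L[ℝ] Param d) (Δ : ℝ) (v : Param d) : Prop :=
  ‖v‖ ≤ Δ ∧ ∀ w : Param d, ‖w‖ ≤ Δ → trModel c g B v ≤ trModel c g B w

/-- Conditionally on the σ-algebra `𝒢`, the batch `b` consists of i.i.d. trajectories with the law
of the (random, `𝒢`-measurable) parameter `θ`. -/
def IsCondIIDBatch {Ω : Type*} [MeasurableSpace Ω] (m : MDP S A) (π : Policy S A d) {H k : ℕ}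
    (μ : Measure Ω) (𝒢 : MeasurableSpace Ω) (θ : Ω → Param d)
    (b : Ω → Fin k → Traj S A H) : Prop :=
  ∀ C : Set Ω, MeasurableSet[𝒢] C → ∀ B : Set (Fin k → Traj S A H), MeasurableSet B →
    μ (C ∩ b ⁻¹' B) =
      ∫⁻ ω in C, Measure.pi (fun _ : Fin k => trajLaw m π H (θ ω)) B ∂μ

/-- `θ 0, …, θ T` is a run of `T` iterations of full-dimension SOPO from `θ₀`. In iteration `t`,
fresh batches `bg t` and `bH t`, of sizes `kg` and `kH`, are sampled from the current policy, and
the step is a global solution of the trust-region subproblem of radius `Δ` for the resulting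
gradient and Hessian estimates. The σ-algebra `ℱ t` collects the randomness before iteration `t`.
Where the subproblem has several solutions, any of them may be taken. -/
structure IsRun {Ω : Type*} [mΩ : MeasurableSpace Ω] (m : MDP S A) (π : Policy S A d)
    {H kg kH : ℕ} (T : ℕ) (Δ : ℝ) (θ₀ : Param d) (μ : Measure Ω) (ℱ : Filtration ℕ mΩ)
    (θ : ℕ → Ω → Param d) (bg : ℕ → Ω → Fin kg → Traj S A H)
    (bH : ℕ → Ω → Fin kH → Traj S A H) : Prop where
  start : ∀ ω, θ 0 ω = θ₀
  measurable_iterate : ∀ t ≤ T, Measurable[ℱ t] (θ t)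
  measurable_batchGrad : ∀ t < T, Measurable[ℱ (t + 1)] (bg t)
  measurable_batchHess : ∀ t < T, Measurable[ℱ (t + 1)] (bH t)
  sample_grad : ∀ t < T, IsCondIIDBatch m π μ (ℱ t) (θ t) (bg t)
  sample_hess : ∀ t < T, IsCondIIDBatch m π μ (ℱ t) (θ t) (bH t)
  step : ∀ t < T, ∀ᵐ ω ∂μ,
    IsTRSolution (J m π H (θ t ω)) (batchGrad m π (bg t ω) (θ t ω))
      (batchHess m π (bH t ω) (θ t ω)) Δ (θ (t + 1) ω - θ t ω)

end

end SOPO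

/-! The proof has a deterministic half, about trust-region steps, and a statistical half, about the
estimators.

Trust-region steps. Measure length in units of Δ, curvature in MΔ, gradients in MΔ² and values in
MΔ³. The Lipschitz constant of the Hessian and the radius then both become 1, the conditions on the
batch sizes make every mean sampling error at most 1/48, and the condition on T makes the initial
gap at most T/192. Let v be the step from x to y = x + v, and let D be the decrease achieved by the
following step. Since that step minimizes the noisy model, no direction of the unit ball improves
the true model at y by more than D + 1/6 + noise (`ModelDecrease.of_step`), where 1/6 is the cubic
Taylor remainder. Testing this with ±w for unit vectors w bounds the negative curvature at y by 2(D
+ 1/6 + noise). Testing it with v, and expanding the objective from y back to x, bounds u = -⟨∇f(y),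
v⟩ by 1/6 plus half of the decrease over both steps, plus noise. The multiplier rule for the
subproblem at x shows that ∇f(y) is a nonpositive multiple of v up to a vector of norm at most 1/2 +
noise. Together these give ‖∇f(y)‖ ≤ 5/8 + half of the two-step decrease + noise
(`norm_grad_step_le`). After the last step the infimum of J plays the part of a further value.

Summed over the path the decreases telescope, and the averaged gradient bound is 571/768 < 3/4
units, that is, less than 3ε/M; the averaged curvature bound is one unit, 2√ε (`sum_bounds_le`). The
bound on the gradient norm is itself never below 25/48, so Markov's inequality applies to its excess
over 25/48, which is what makes the probability 7/8 reachable.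

Sampling errors. Only second moments, uniform in θ, are available, so derivatives of expectations
are obtained from the fundamental theorem of calculus and Fubini rather than from a dominating
function (`IsDensityFamily.hasFDerivAt_integral`). The law of the first n steps does not depend on
the horizon; differentiating this identity shows that the score of a step is orthogonal to every
square-integrable function of the earlier steps (`integral_smul_score_eq_zero`). This yields the
policy gradient and Hessian theorems, and makes the scores pairwise orthogonal, whence the constant
G_g². For the Hessian batch, symmetrization and the noncommutative Khintchine inequality
(`sum_sq_norm_signedSum_le`) give a mean square error of at most 11 log d / n times the second
moment, and the second moment is at most 2 G_H². -/

open Filter Topology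

/-! ### Differentiating expectations under uniform second-moment bounds. -/

section DifferentiationUnderIntegral

/-- Scheffé's lemma for densities depending continuously on a parameter. -/
lemma tendsto_integral_abs_sub_of_density {Y X : Type*} [TopologicalSpace Y]
    [FirstCountableTopology Y] [MeasurableSpace X] {ν : Measure X} {p : Y → X → ℝ}
    (hp0 : ∀ y x, 0 ≤ p y x) (hpi : ∀ y, Integrable (p y) ν) (hp1 : ∀ y, ∫ x, p y x ∂ν = 1)
    (hpc : ∀ x, Continuous fun y => p y x) (y₀ : Y) :
    Tendsto (fun y => ∫ x, |p y x - p y₀ x| ∂ν) (𝓝 y₀) (𝓝 0) := by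
  -- Both densities have mass 1, so the L¹ distance is twice the integral of the part where `p y`
  -- falls below `p y₀`; that part is dominated by the fixed function `p y₀`.
  have h1 : ∀ y, ∫ x, |p y x - p y₀ x| ∂ν = 2 * ∫ x, max (p y₀ x - p y x) 0 ∂ν := by
    intro y
    have hi : Integrable (fun x => p y x - p y₀ x) ν := (hpi y).sub (hpi y₀)
    have hi' : Integrable (fun x => max (p y₀ x - p y x) 0) ν :=
      ((hpi y₀).sub (hpi y)).pos_part
    have h2 : ∀ x, |p y x - p y₀ x| = (p y x - p y₀ x) + 2 * max (p y₀ x - p y x) 0 := by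
      intro x
      rcases le_total (p y₀ x) (p y x) with h | h
      · rw [abs_of_nonneg (by linarith), max_eq_right (by linarith)]; ring
      · rw [abs_of_nonpos (by linarith), max_eq_left (by linarith)]; ring
    simp_rw [h2]
    rw [integral_add hi (hi'.const_mul 2), integral_sub (hpi y) (hpi y₀), hp1, hp1,
      integral_const_mul]
    ring
  simp_rw [h1]
  have h3 : Tendsto (fun y => ∫ x, max (p y₀ x - p y x) 0 ∂ν) (𝓝 y₀) (𝓝 (∫ _, (0 : ℝ) ∂ν)) := by
    refine tendsto_integral_filter_of_dominated_convergence (p y₀) ?_ ?_ (hpi y₀) ?_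
    · exact Eventually.of_forall fun y => (((hpi y₀).sub (hpi y)).pos_part).aestronglyMeasurable
    · refine Eventually.of_forall fun y => Eventually.of_forall fun x => ?_
      rw [Real.norm_of_nonneg (le_max_right _ _)]
      exact max_le (by linarith [hp0 y x]) (hp0 y₀ x)
    · refine Eventually.of_forall fun x => ?_
      have : Continuous fun y => max (p y₀ x - p y x) 0 :=
        (continuous_const.sub (hpc x)).max continuous_const
      simpa using this.tendsto y₀
  simpa using h3.const_mul 2

/-- A family of probability densities that depends continuously on a parameter. -/
structure IsDensityFamily {Y X : Type*} [TopologicalSpace Y] [MeasurableSpace X] (ν : Measure X)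
    (p : Y → X → ℝ) : Prop where
  nonneg : ∀ y x, 0 ≤ p y x
  measurable : ∀ y, Measurable (p y)
  integrable : ∀ y, Integrable (p y) ν
  integral_eq_one : ∀ y, ∫ x, p y x ∂ν = 1
  continuous : ∀ x, Continuous fun y => p y x

variable {X F : Type*} [MeasurableSpace X] [NormedAddCommGroup F] [NormedSpace ℝ F]
  {ν : Measure X}

lemma mul_norm_le_of_sq {p x : ℝ} (hp : 0 ≤ p) : p * x ≤ p + p * x ^ 2 := by
  nlinarith [mul_nonneg hp (sq_nonneg (x - 1)), mul_nonneg hp (sq_nonneg x)]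

lemma IsDensityFamily.integrable_smul {Y : Type*} [TopologicalSpace Y] {p : Y → X → ℝ}
    (hp : IsDensityFamily ν p) {y : Y} {f : X → F} (hf : StronglyMeasurable f)
    (hi : Integrable (fun x => p y x * ‖f x‖ ^ 2) ν) : Integrable (fun x => p y x • f x) ν := by
  refine ((hp.integrable y).add hi).mono
    ((hp.measurable y).stronglyMeasurable.smul hf).aestronglyMeasurable
    (Eventually.of_forall fun x => ?_)
  have h0 := hp.nonneg y x
  rw [norm_smul, Real.norm_of_nonneg h0, Real.norm_of_nonneg
    (by have : 0 ≤ p y x * ‖f x‖ ^ 2 := by positivity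
        exact add_nonneg h0 this)]
  exact mul_norm_le_of_sq h0

/-- A bounded continuous approximation of the identity. -/
noncomputable def softClip (N : ℝ) (x : F) : F := (1 + ‖x‖ / N)⁻¹ • x

lemma continuous_softClip {N : ℝ} (hN : 0 < N) : Continuous (softClip N : F → F) := by
  unfold softClip
  refine Continuous.smul (Continuous.inv₀ (by fun_prop) fun x => ?_) continuous_id
  positivity

lemma norm_softClip_le {N : ℝ} (hN : 0 < N) (x : F) : ‖softClip N x‖ ≤ N := by
  have h : 0 < 1 + ‖x‖ / N := by positivity
  rw [softClip, norm_smul, norm_inv, Real.norm_of_nonneg h.le, inv_mul_le_iff₀ h]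
  field_simp
  linarith

/-- The clipping error is quadratic in `x` with a factor `1 / N`, so a second-moment bound that is
uniform in the parameter makes clipping a uniform approximation. -/
lemma norm_sub_softClip_le {N : ℝ} (hN : 0 < N) (x : F) : ‖x - softClip N x‖ ≤ ‖x‖ ^ 2 / N := by
  have h : 0 < 1 + ‖x‖ / N := by positivity
  have : x - softClip N x = ((‖x‖ / N) * (1 + ‖x‖ / N)⁻¹) • x := by
    rw [softClip]
    nth_rewrite 1 [← one_smul ℝ x]
    rw [← sub_smul]
    congr 1
    field_simp
    ring
  rw [this, norm_smul, Real.norm_of_nonneg (by positivity)]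
  have h1 : (1 + ‖x‖ / N)⁻¹ ≤ 1 := inv_le_one_of_one_le₀ (by
    have : 0 ≤ ‖x‖ / N := by positivity
    linarith)
  calc ‖x‖ / N * (1 + ‖x‖ / N)⁻¹ * ‖x‖ ≤ ‖x‖ / N * 1 * ‖x‖ := by gcongr
    _ = ‖x‖ ^ 2 / N := by ring

lemma softClip_smul_integrable {Y : Type*} [TopologicalSpace Y] {p : Y → X → ℝ}
    (hp : IsDensityFamily ν p) {N : ℝ} (hN : 0 < N) (y : Y) {f : X → F}
    (hf : StronglyMeasurable f) : Integrable (fun x => p y x • softClip N (f x)) ν := by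
  refine ((hp.integrable y).mul_const N).mono
    ((hp.measurable y).stronglyMeasurable.smul
      ((continuous_softClip hN).comp_stronglyMeasurable hf)).aestronglyMeasurable
    (Eventually.of_forall fun x => ?_)
  have h0 := hp.nonneg y x
  rw [norm_smul, norm_mul, Real.norm_of_nonneg hN.le]
  gcongr
  exact norm_softClip_le hN _

/-- For a bounded integrand the change of density is negligible by Scheffé's lemma, and under the
fixed density `p y₀` dominated convergence applies. -/
lemma continuous_integral_smul_softClip {Y : Type*} [TopologicalSpace Y]
    [FirstCountableTopology Y] {p : Y → X → ℝ}
    (hp : IsDensityFamily ν p) {f : Y → X → F} (hf : ∀ y, StronglyMeasurable (f y))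
    (hfc : ∀ x, Continuous fun y => f y x) {N : ℝ} (hN : 0 < N) :
    Continuous fun y => ∫ x, p y x • softClip N (f y x) ∂ν := by
  refine continuous_iff_continuousAt.2 fun y₀ => ?_
  have h1 := tendsto_integral_abs_sub_of_density hp.nonneg hp.integrable hp.integral_eq_one
    hp.continuous y₀
  have h2 : Tendsto (fun y => ∫ x, p y₀ x • softClip N (f y x) ∂ν) (𝓝 y₀)
      (𝓝 (∫ x, p y₀ x • softClip N (f y₀ x) ∂ν)) := by
    refine tendsto_integral_filter_of_dominated_convergence (fun x => p y₀ x * N) ?_ ?_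
      ((hp.integrable y₀).mul_const N) ?_
    · exact Eventually.of_forall fun y =>
        (softClip_smul_integrable hp hN y₀ (hf y)).aestronglyMeasurable
    · refine Eventually.of_forall fun y => Eventually.of_forall fun x => ?_
      rw [norm_smul, Real.norm_of_nonneg (hp.nonneg _ _)]
      exact mul_le_mul_of_nonneg_left (norm_softClip_le hN _) (hp.nonneg _ _)
    · refine Eventually.of_forall fun x => ?_
      exact (((continuous_softClip hN).comp (hfc x)).const_smul (p y₀ x)).tendsto y₀
  have h3 : Tendsto (fun y => ∫ x, (p y x - p y₀ x) • softClip N (f y x) ∂ν) (𝓝 y₀) (𝓝 0) := by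
    refine squeeze_zero_norm (a := fun y => (∫ x, |p y x - p y₀ x| ∂ν) * N) (fun y => ?_) ?_
    · rw [← integral_mul_const]
      refine norm_integral_le_of_norm_le ((((hp.integrable y).sub
        (hp.integrable y₀)).abs).mul_const N) (Eventually.of_forall fun x => ?_)
      rw [norm_smul, Real.norm_eq_abs]
      exact mul_le_mul_of_nonneg_left (norm_softClip_le hN _) (abs_nonneg _)
    · simpa using h1.mul_const N
  have h4 := h3.add h2
  rw [zero_add] at h4
  refine h4.congr fun y => ?_
  rw [← integral_add]
  · congr 1; ext x
    rw [← add_smul, sub_add_cancel]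
  · simp_rw [sub_smul]
    exact (softClip_smul_integrable hp hN y (hf y)).sub
      (softClip_smul_integrable hp hN y₀ (hf y))
  · exact softClip_smul_integrable hp hN y₀ (hf y)

/-- Expectations of continuously varying functions with bounded second moments are continuous in
the parameter. -/
lemma IsDensityFamily.continuous_integral_smul {Y : Type*} [TopologicalSpace Y]
    [FirstCountableTopology Y] {p : Y → X → ℝ} (hp : IsDensityFamily ν p) {f : Y → X → F}
    (hf : ∀ y, StronglyMeasurable (f y)) (hfc : ∀ x, Continuous fun y => f y x) {C : ℝ}
    (hi : ∀ y, Integrable (fun x => p y x * ‖f y x‖ ^ 2) ν)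
    (hC : ∀ y, ∫ x, p y x * ‖f y x‖ ^ 2 ∂ν ≤ C) :
    Continuous fun y => ∫ x, p y x • f y x ∂ν := by
  refine continuous_of_uniform_approx_of_continuous fun u hu => ?_
  obtain ⟨ε, hε, hεu⟩ := Metric.mem_uniformity_dist.1 hu
  -- At this clipping level the error is at most `C / N`, which is less than `ε` for all parameters
  -- at once; the extra 1 makes the inequality strict and the level positive.
  have hN : 0 < (|C| + 1) / ε := by positivity
  refine ⟨_, continuous_integral_smul_softClip hp hf hfc hN, fun y => hεu ?_⟩
  rw [dist_eq_norm, ← integral_sub (hp.integrable_smul (hf y) (hi y))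
    (softClip_smul_integrable hp hN y (hf y))]
  have hb : ‖∫ x, (p y x • f y x - p y x • softClip ((|C| + 1) / ε) (f y x)) ∂ν‖ ≤
      ∫ x, p y x * ‖f y x‖ ^ 2 / ((|C| + 1) / ε) ∂ν := by
    refine norm_integral_le_of_norm_le ((hi y).div_const _) (Eventually.of_forall fun x => ?_)
    rw [← smul_sub, norm_smul, Real.norm_of_nonneg (hp.nonneg _ _), mul_div_assoc]
    exact mul_le_mul_of_nonneg_left (norm_sub_softClip_le hN _) (hp.nonneg _ _)
  refine hb.trans_lt ?_
  rw [integral_div, div_lt_iff₀ hN]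
  have : ε * ((|C| + 1) / ε) = |C| + 1 := by field_simp
  rw [this]
  linarith [hC y, le_abs_self C]

/-- Differentiation of a parametric integral along a line under a second moment bound on the
logarithmic derivative. -/
lemma IsDensityFamily.hasDerivAt_integral [CompleteSpace F] [SFinite ν] {p : ℝ → X → ℝ}
    (hp : IsDensityFamily ν p) {q f : ℝ → X → F} (hf : ∀ y, StronglyMeasurable (f y))
    (hfc : ∀ x, Continuous fun y => f y x) {C : ℝ}
    (hi : ∀ y, Integrable (fun x => p y x * ‖f y x‖ ^ 2) ν)
    (hC : ∀ y, ∫ x, p y x * ‖f y x‖ ^ 2 ∂ν ≤ C)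
    (hq : ∀ t, Integrable (q t) ν) (hqd : ∀ t x, HasDerivAt (fun t => q t x) (p t x • f t x) t)
    (t₀ : ℝ) :
    HasDerivAt (fun t => ∫ x, q t x ∂ν) (∫ x, p t₀ x • f t₀ x ∂ν) t₀ := by
  have hcont := hp.continuous_integral_smul hf hfc hi hC
  have hpf : ∀ x, Continuous fun t => p t x • f t x := fun x => (hp.continuous x).smul (hfc x)
  have hsm : StronglyMeasurable (Function.uncurry fun (t : ℝ) (x : X) => p t x • f t x) :=
    stronglyMeasurable_uncurry_of_continuous_of_stronglyMeasurable hpf fun t =>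
      (hp.measurable t).stronglyMeasurable.smul (hf t)
  have hint : ∀ t, Integrable (fun x => p t x • f t x) ν := fun t => hp.integrable_smul (hf t) (hi t)
  have hbound : ∀ t, ∫ x, ‖p t x • f t x‖ ∂ν ≤ 1 + C := by
    intro t
    calc ∫ x, ‖p t x • f t x‖ ∂ν ≤ ∫ x, (p t x + p t x * ‖f t x‖ ^ 2) ∂ν := by
          refine integral_mono (hint t).norm ((hp.integrable t).add (hi t)) fun x => ?_
          simp only [norm_smul, Real.norm_of_nonneg (hp.nonneg t x)]
          exact mul_norm_le_of_sq (hp.nonneg t x)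
      _ = 1 + ∫ x, p t x * ‖f t x‖ ^ 2 ∂ν := by
          rw [integral_add (hp.integrable t) (hi t), hp.integral_eq_one]
      _ ≤ 1 + C := by linarith [hC t]
  -- Integrating the pointwise derivative over the segment and exchanging the integrals needs only
  -- the uniform L¹ bound `1 + C`. Continuity of the inner integral then allows differentiation at
  -- `t₀`.
  have key : ∀ t, ∫ x, q t x ∂ν =
      (∫ x, q t₀ x ∂ν) + ∫ s in t₀..t, ∫ x, p s x • f s x ∂ν := by
    intro t
    have hprod : Integrable (Function.uncurry fun (s : ℝ) (x : X) => p s x • f s x)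
        ((volume.restrict (Set.uIoc t₀ t)).prod ν) := by
      refine (integrable_prod_iff hsm.aestronglyMeasurable).2 ⟨Eventually.of_forall hint, ?_⟩
      have : IsFiniteMeasure ((volume : Measure ℝ).restrict (Set.uIoc t₀ t)) :=
        ⟨by simp [Set.uIoc]⟩
      refine Integrable.of_bound (C := 1 + C)
        (hsm.norm.integral_prod_right.aestronglyMeasurable) (Eventually.of_forall fun s => ?_)
      rw [Real.norm_of_nonneg (integral_nonneg fun x => norm_nonneg _)]
      exact hbound s
    have hsw : (∫ s in t₀..t, ∫ x, p s x • f s x ∂ν) = ∫ x, (∫ s in t₀..t, p s x • f s x) ∂ν :=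
      intervalIntegral_integral_swap hprod
    have hftc : ∀ x, (∫ s in t₀..t, p s x • f s x) = q t x - q t₀ x := fun x =>
      intervalIntegral.integral_eq_sub_of_hasDerivAt (fun s _ => hqd s x)
        ((hpf x).intervalIntegrable _ _)
    rw [hsw]
    simp_rw [hftc]
    rw [integral_sub (hq t) (hq t₀)]
    abel
  have hd := (intervalIntegral.integral_hasDerivAt_right (hcont.intervalIntegrable t₀ t₀)
    hcont.stronglyMeasurable.stronglyMeasurableAtFilter hcont.continuousAt).const_add
    (∫ x, q t₀ x ∂ν)
  exact hd.congr_of_eventuallyEq (Eventually.of_forall key)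

/-- A function with continuous directional derivatives along all lines is differentiable. -/
lemma hasFDerivAt_of_continuous_lineDeriv {E : Type*} [NormedAddCommGroup E] [NormedSpace ℝ E]
    {f : E → F} {f' : E → E →L[ℝ] F}
    (hf : ∀ x v, HasDerivAt (fun t : ℝ => f (x + t • v)) (f' x v) 0) {x : E}
    (hc : ContinuousAt f' x) : HasFDerivAt f (f' x) x := by
  rw [hasFDerivAt_iff_isLittleO_nhds_zero, Asymptotics.isLittleO_iff]
  intro c hc0
  obtain ⟨δ, hδ, hδc⟩ := Metric.continuousAt_iff.1 hc c hc0
  filter_upwards [Metric.ball_mem_nhds (0 : E) hδ] with v hv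
  have hline : ∀ s : ℝ, HasDerivAt (fun t : ℝ => f (x + t • v) - t • f' x v)
      (f' (x + s • v) v - f' x v) s := by
    intro s
    have h1 := hf (x + s • v) v
    have h2 : HasDerivAt (fun t : ℝ => f (x + t • v)) (f' (x + s • v) v) s := by
      have h3 : HasDerivAt (fun t : ℝ => t - s) 1 s := (hasDerivAt_id s).sub_const s
      have h4 := HasDerivAt.scomp (h := fun t : ℝ => t - s) s (by simpa using h1) h3
      rw [one_smul] at h4
      refine h4.congr_of_eventuallyEq (Eventually.of_forall fun t => ?_)
      simp only [Function.comp]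
      congr 1
      rw [sub_smul]; abel
    have h5 : HasDerivAt (fun t : ℝ => t • f' x v) (f' x v) s := by
      simpa using (hasDerivAt_id s).smul_const (f' x v)
    exact h2.sub h5
  -- Mean value inequality on the segment from `x` to `x + v`: after the linear part is subtracted,
  -- the derivative is at most `c * ‖v‖` because `f'` is continuous at `x`.
  have hmv := norm_image_sub_le_of_norm_deriv_le_segment_01' (C := c * ‖v‖)
    (fun s _ => (hline s).hasDerivWithinAt) (fun s hs => ?_)
  · simpa [sub_right_comm] using hmv
  · rw [← _root_.sub_apply]
    refine (ContinuousLinearMap.le_opNorm _ _).trans ?_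
    gcongr
    rw [← dist_eq_norm]
    refine (hδc ?_).le
    rw [dist_eq_norm, add_sub_cancel_left, norm_smul, Real.norm_of_nonneg hs.1]
    have : ‖v‖ < δ := by simpa using hv
    calc s * ‖v‖ ≤ 1 * ‖v‖ := by gcongr; exact hs.2.le
      _ < δ := by simpa using this

lemma IsDensityFamily.comp {Y Z : Type*} [TopologicalSpace Y] [TopologicalSpace Z]
    {p : Y → X → ℝ} (hp : IsDensityFamily ν p) {φ : Z → Y} (hφ : Continuous φ) :
    IsDensityFamily ν (fun z => p (φ z)) :=
  ⟨fun _ => hp.nonneg _, fun _ => hp.measurable _, fun _ => hp.integrable _,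
    fun _ => hp.integral_eq_one _, fun x => (hp.continuous x).comp hφ⟩

lemma IsDensityFamily.hasFDerivAt_integral [CompleteSpace F] [SFinite ν]
    {E : Type*} [NormedAddCommGroup E] [NormedSpace ℝ E] {p : E → X → ℝ}
    (hp : IsDensityFamily ν p) {q : E → X → F} {L : E → X → E →L[ℝ] F}
    (hL : ∀ y, StronglyMeasurable (L y)) (hLc : ∀ x, Continuous fun y => L y x) {C : ℝ}
    (hi : ∀ y, Integrable (fun x => p y x * ‖L y x‖ ^ 2) ν)
    (hC : ∀ y, ∫ x, p y x * ‖L y x‖ ^ 2 ∂ν ≤ C)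
    (hq : ∀ y, Integrable (q y) ν)
    (hqd : ∀ y x, HasFDerivAt (fun y => q y x) (p y x • L y x) y) (y : E) :
    HasFDerivAt (fun y => ∫ x, q y x ∂ν) (∫ x, p y x • L y x ∂ν) y := by
  refine hasFDerivAt_of_continuous_lineDeriv (f' := fun y => ∫ x, p y x • L y x ∂ν)
    (fun z v => ?_) (hp.continuous_integral_smul hL hLc hi hC).continuousAt
  have hφ : Continuous fun t : ℝ => z + t • v := by fun_prop
  have hLi : Integrable (fun x => p z x • L z x) ν := hp.integrable_smul (hL z) (hi z)
  rw [ContinuousLinearMap.integral_apply hLi]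
  have hLv : ∀ y, StronglyMeasurable fun x => L y x v := fun y =>
    (ContinuousLinearMap.apply ℝ F v).continuous.comp_stronglyMeasurable (hL y)
  have hle : ∀ y x, p y x * ‖L y x v‖ ^ 2 ≤ p y x * ‖L y x‖ ^ 2 * ‖v‖ ^ 2 := fun y x => by
    rw [mul_assoc, ← mul_pow]
    have := (L y x).le_opNorm v
    have := hp.nonneg y x
    gcongr
  have hLvi : ∀ y, Integrable (fun x => p y x * ‖L y x v‖ ^ 2) ν := fun y => by
    refine ((hi y).mul_const (‖v‖ ^ 2)).mono
      ((hp.measurable y).stronglyMeasurable.mul ((hLv y).norm.pow 2)).aestronglyMeasurable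
      (Eventually.of_forall fun x => ?_)
    have := hp.nonneg y x
    rw [Real.norm_of_nonneg (by positivity), Real.norm_of_nonneg (by positivity)]
    exact hle y x
  have key := (hp.comp hφ).hasDerivAt_integral (q := fun t x => q (z + t • v) x)
    (f := fun t x => L (z + t • v) x v) (C := C * ‖v‖ ^ 2) (fun t => hLv _)
    (fun x => ((ContinuousLinearMap.apply ℝ F v).continuous.comp (hLc x)).comp hφ)
    (fun t => hLvi _) (fun t => ?_) (fun t => hq _) (fun t x => ?_) 0
  · simpa using key
  · refine (integral_mono (hLvi _) ((hi _).mul_const _) (hle _)).trans ?_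
    rw [integral_mul_const]
    gcongr
    exact hC _
  · have h1 : HasDerivAt (fun t : ℝ => z + t • v) v t := by
      simpa using ((hasDerivAt_id t).smul_const v).const_add z
    exact (hqd (z + t • v) x).comp_hasDerivAt t h1

/-! ### Measurability of derivatives in the sample. -/

section Measurability

variable {E : Type*} [NormedAddCommGroup E] [NormedSpace ℝ E]

/-- A directional derivative is a sequential limit of difference quotients, each measurable in `x`.
-/
lemma stronglyMeasurable_fderiv_apply {f : X → E → F}
    (hf : ∀ θ, StronglyMeasurable fun x => f x θ) (hd : ∀ x, Differentiable ℝ (f x)) (θ v : E) :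
    StronglyMeasurable fun x => fderiv ℝ (f x) θ v := by
  have hlim : Tendsto (fun n : ℕ => 1 / ((n : ℝ) + 1)) atTop (𝓝[≠] 0) :=
    tendsto_nhdsWithin_iff.2 ⟨tendsto_one_div_add_atTop_nhds_zero_nat,
      Eventually.of_forall fun n => by simp only [Set.mem_compl_iff, Set.mem_singleton_iff]
                                       positivity⟩
  refine stronglyMeasurable_of_tendsto (u := atTop)
    (f := fun (n : ℕ) x => (1 / ((n : ℝ) + 1))⁻¹ • (f x (θ + (1 / ((n : ℝ) + 1)) • v) - f x θ))
    (fun n => ((hf _).sub (hf θ)).const_smul _) ?_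
  refine tendsto_pi_nhds.2 fun x => ?_
  have h1 : HasDerivAt (fun t : ℝ => θ + t • v) v 0 := by
    simpa using ((hasDerivAt_id (0 : ℝ)).smul_const v).const_add θ
  have h2 : HasDerivAt (fun t : ℝ => f x (θ + t • v)) (fderiv ℝ (f x) θ v) 0 := by
    have := (hd x (θ + (0 : ℝ) • v)).hasFDerivAt.comp_hasDerivAt (0 : ℝ) h1
    simpa [Function.comp_def] using this
  have h3 := (hasDerivAt_iff_tendsto_slope_zero.1 h2).comp hlim
  refine h3.congr fun n => ?_
  simp

lemma stronglyMeasurable_clm {ι : Type*} [Fintype ι] {E : Type*} [NormedAddCommGroup E]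
    [InnerProductSpace ℝ E] (b : OrthonormalBasis ι ℝ E) {L : X → E →L[ℝ] F}
    (hL : ∀ v, StronglyMeasurable fun x => L x v) : StronglyMeasurable L := by
  have : L = fun x => ∑ i, ContinuousLinearMap.smulRightL ℝ E F (innerSL ℝ (b i)) (L x (b i)) := by
    ext x v
    simp only [_root_.sum_apply, ContinuousLinearMap.smulRightL_apply_apply]
    conv_lhs => rw [← b.sum_repr' v]
    simp
  rw [this]
  exact Finset.stronglyMeasurable_fun_sum _ fun i _ =>
    (ContinuousLinearMap.continuous _).comp_stronglyMeasurable (hL (b i))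

lemma stronglyMeasurable_gradient {ι : Type*} [Fintype ι] {E : Type*} [NormedAddCommGroup E]
    [InnerProductSpace ℝ E] [CompleteSpace E] (b : OrthonormalBasis ι ℝ E) {f : X → E → ℝ}
    (hf : ∀ θ, StronglyMeasurable fun x => f x θ) (hd : ∀ x, Differentiable ℝ (f x)) (θ : E) :
    StronglyMeasurable fun x => gradient (f x) θ :=
  (InnerProductSpace.toDual ℝ E).symm.continuous.comp_stronglyMeasurable
    (stronglyMeasurable_clm b fun v => stronglyMeasurable_fderiv_apply hf hd θ v)

lemma ContDiff.gradient_right {E : Type*} [NormedAddCommGroup E]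
    [InnerProductSpace ℝ E] [CompleteSpace E] {f : E → ℝ} (hf : ContDiff ℝ 2 f) :
    ContDiff ℝ 1 (gradient f) :=
  (InnerProductSpace.toDual ℝ E).symm.contDiff.comp (hf.fderiv_right (by norm_num))

end Measurability

end DifferentiationUnderIntegral

/-! ### Trajectory laws and their consistency under truncation. -/

namespace SOPO

instance {S A : Type*} [MeasurableSpace S] [MeasurableSpace A] (m : MDP S A) :
    IsMarkovKernel m.trans := m.isMarkov_trans

instance {S A : Type*} [MeasurableSpace S] [MeasurableSpace A] (m : MDP S A) :
    IsProbabilityMeasure m.init := m.isProb_init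

instance {S A : Type*} [MeasurableSpace S] [MeasurableSpace A] {d : ℕ} (π : Policy S A d) :
    SigmaFinite π.ref := π.sigmaFinite_ref

lemma init_cons_traj {B : Type*} {n : ℕ} (x : B) (τ : Fin (n + 1) → B) :
    (Fin.init (Fin.cons x τ : Fin (n + 2) → B) : Fin (n + 1) → B) =
      Fin.cons x (Fin.init τ : Fin n → B) := by
  ext j : 1
  refine Fin.cases rfl (fun j => rfl) j

section Trajectories

variable {S A : Type*} [MeasurableSpace S] [MeasurableSpace A] {d : ℕ}

instance isSFiniteKernel_baseKernel (m : MDP S A) (ν : Measure A) [SFinite ν] :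
    ∀ n, IsSFiniteKernel (baseKernel m ν n)
  | 0 => by unfold baseKernel; infer_instance
  | n + 1 => by
      have := isSFiniteKernel_baseKernel m ν n
      unfold baseKernel
      infer_instance

instance (m : MDP S A) (π : Policy S A d) (n : ℕ) : SFinite (baseMeasure m π n) := by
  unfold baseMeasure
  infer_instance

lemma measurable_cons_traj (n : ℕ) :
    Measurable (fun x : S × (A × Traj S A n) =>
      (Fin.cons (x.1, x.2.1) x.2.2 : Traj S A (n + 1))) := by
  refine measurable_pi_lambda _ fun i => ?_
  refine Fin.cases ?_ (fun j => ?_) i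
  · simp only [Fin.cons_zero]; fun_prop
  · simp only [Fin.cons_succ]; fun_prop

lemma lintegral_baseKernel_succ (m : MDP S A) (ν : Measure A) [SFinite ν] (n : ℕ) (s : S)
    {F : Traj S A (n + 1) → ENNReal} (hF : Measurable F) :
    ∫⁻ τ, F τ ∂(baseKernel m ν (n + 1) s) =
      ∫⁻ a, ∫⁻ s', ∫⁻ τ, F (Fin.cons (s, a) τ) ∂(baseKernel m ν n s') ∂(m.trans (s, a)) ∂ν := by
  have hc := measurable_cons_traj (S := S) (A := A) n
  rw [baseKernel, Kernel.lintegral_map _ hc _ hF,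
    Kernel.lintegral_id_prod (f := fun x : S × (A × Traj S A n) =>
      F (Fin.cons (x.1, x.2.1) x.2.2)) (hF.comp hc),
    Kernel.lintegral_compProd _ _ _ (by
      exact (hF.comp hc).comp (measurable_const.prodMk measurable_id))]
  simp only [Kernel.const_apply]
  refine lintegral_congr fun a => ?_
  rw [Kernel.lintegral_comp]
  exact (hF.comp hc).comp (measurable_const.prodMk (measurable_const.prodMk measurable_id))

lemma measurable_init_traj (n : ℕ) :
    Measurable (fun τ : Traj S A (n + 1) => (Fin.init τ : Traj S A n)) :=
  measurable_pi_lambda _ fun _ => measurable_pi_apply _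

lemma measurable_step (π : Policy S A d) (θ : Param d) {n : ℕ} (h : Fin n) :
    Measurable (fun τ : Traj S A n => π.dens θ (τ h).1 (τ h).2) := by
  have := π.measurable_dens θ
  exact this.comp (measurable_pi_apply h)

lemma measurable_density (π : Policy S A d) (θ : Param d) (n : ℕ) :
    Measurable (fun τ : Traj S A n => density π θ τ) := by
  unfold density
  exact Finset.measurable_prod _ fun h _ => measurable_step π θ h

lemma dens_nonneg (π : Policy S A d) (θ : Param d) (s : S) (a : A) : 0 ≤ π.dens θ s a := by
  rcases π.pos_or_zero s a with h | h
  · exact (h θ).le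
  · exact (h θ).ge

lemma density_nonneg (π : Policy S A d) (θ : Param d) {n : ℕ} (τ : Traj S A n) :
    0 ≤ density π θ τ :=
  Finset.prod_nonneg fun _ _ => dens_nonneg π θ _ _

lemma density_cons (π : Policy S A d) (θ : Param d) {n : ℕ} (s : S) (a : A) (τ : Traj S A n) :
    density π θ (Fin.cons (s, a) τ : Traj S A (n + 1)) = π.dens θ s a * density π θ τ := by
  simp [density, Fin.prod_univ_succ]

/-- Integrating out the last action. -/
lemma lintegral_baseKernel_init (m : MDP S A) (π : Policy S A d) (θ : Param d) :
    ∀ (n : ℕ) (s : S) {F : Traj S A n → ENNReal}, Measurable F →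
      ∫⁻ τ, F (Fin.init τ) * ENNReal.ofReal (density π θ τ) ∂(baseKernel m π.ref (n + 1) s) =
        ∫⁻ τ, F τ * ENNReal.ofReal (density π θ τ) ∂(baseKernel m π.ref n s) := by
  intro n
  induction n with
  | zero =>
    intro s F hF
    rw [lintegral_baseKernel_succ]
    · simp only [baseKernel, Kernel.const_apply]
      have : ∀ (x : S × A) (τ : Traj S A 0), F (Fin.init (Fin.cons x τ : Traj S A 1)) =
          F Fin.elim0 := fun x τ => by congr 1; exact Subsingleton.elim _ _
      simp only [this, density_cons]
      have h1 : ∀ τ : Traj S A 0, density π θ τ = 1 := fun τ => by simp [density]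
      simp only [h1, mul_one, lintegral_const, measure_univ]
      have hm : Measurable fun a => ENNReal.ofReal (π.dens θ s a) :=
        ((π.measurable_dens θ).comp (measurable_const.prodMk measurable_id)).ennreal_ofReal
      rw [lintegral_const_mul _ hm]
      rw [π.lintegral_dens]
      simp only [ENNReal.ofReal_one, mul_one]
      exact (lintegral_dirac' _ hF).symm
    · exact (hF.comp (measurable_init_traj 0)).mul (measurable_density π θ 1).ennreal_ofReal
  | succ n ih =>
    intro s F hF
    have hF₁ : Measurable fun τ : Traj S A (n + 2) =>
        F (Fin.init τ) * ENNReal.ofReal (density π θ τ) :=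
      (hF.comp (measurable_init_traj _)).mul (measurable_density π θ _).ennreal_ofReal
    have hF₂ : Measurable fun τ : Traj S A (n + 1) => F τ * ENNReal.ofReal (density π θ τ) :=
      hF.mul (measurable_density π θ _).ennreal_ofReal
    rw [lintegral_baseKernel_succ _ _ _ _ hF₁, lintegral_baseKernel_succ _ _ _ _ hF₂]
    refine lintegral_congr fun a => lintegral_congr fun s' => ?_
    -- The induction peels off the first step: its density factor is absorbed into the test
    -- function, and the last action is integrated out of the remaining tail.
    have hG : Measurable fun τ : Traj S A n =>
        F (Fin.cons (s, a) τ) * ENNReal.ofReal (π.dens θ s a) :=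
      (hF.comp ((measurable_cons_traj n).comp
        (measurable_const.prodMk (measurable_const.prodMk measurable_id)))).mul_const _
    have key := ih s' hG
    simp only [density_cons, ENNReal.ofReal_mul (dens_nonneg π θ s a), ← mul_assoc,
      init_cons_traj] at key ⊢
    exact key

lemma lintegral_trajLaw (m : MDP S A) (π : Policy S A d) (n : ℕ) (θ : Param d)
    (F : Traj S A n → ENNReal) :
    ∫⁻ τ, F τ ∂(trajLaw m π n θ) =
      ∫⁻ τ, ENNReal.ofReal (density π θ τ) * F τ ∂(baseMeasure m π n) :=
  lintegral_withDensity_eq_lintegral_mul_non_measurable _ (measurable_density π θ n).ennreal_ofReal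
    (Filter.Eventually.of_forall fun _ => ENNReal.ofReal_lt_top) F

/-- The action density integrates to 1 in every state, so the last step can be integrated out. This
consistency carries the total mass 1 from the empty trajectory to every horizon, and later drives
the causality argument. -/
lemma map_init_trajLaw (m : MDP S A) (π : Policy S A d) (n : ℕ) (θ : Param d) :
    (trajLaw m π (n + 1) θ).map Fin.init = trajLaw m π n θ := by
  refine Measure.ext_of_lintegral _ fun F hF => ?_
  rw [lintegral_map hF (measurable_init_traj n), lintegral_trajLaw, lintegral_trajLaw,
    baseMeasure, baseMeasure, Measure.lintegral_bind (Kernel.aemeasurable _),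
    Measure.lintegral_bind (Kernel.aemeasurable _)]
  · simp_rw [mul_comm (ENNReal.ofReal _)]
    exact lintegral_congr fun s => lintegral_baseKernel_init m π θ n s hF
  · exact ((measurable_density π θ n).ennreal_ofReal.mul hF).aemeasurable
  · exact ((measurable_density π θ _).ennreal_ofReal.mul
      (hF.comp (measurable_init_traj n))).aemeasurable

instance isProbabilityMeasure_trajLaw (m : MDP S A) (π : Policy S A d) (n : ℕ) (θ : Param d) :
    IsProbabilityMeasure (trajLaw m π n θ) := by
  induction n with
  | zero =>
    constructor
    rw [← setLIntegral_one, setLIntegral_univ, lintegral_trajLaw]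
    simp [density, baseMeasure, baseKernel]
  | succ n ih =>
    rw [← map_init_trajLaw] at ih
    exact Measure.isProbabilityMeasure_of_map (Fin.init)

/-- The first `n` steps of a trajectory. -/
def trunc {n H : ℕ} (h : n ≤ H) (τ : Traj S A H) : Traj S A n := fun i => τ (Fin.castLE h i)

lemma measurable_trunc {n H : ℕ} (h : n ≤ H) :
    Measurable (trunc h : Traj S A H → Traj S A n) :=
  measurable_pi_lambda _ fun _ => measurable_pi_apply _

lemma map_trunc_trajLaw (m : MDP S A) (π : Policy S A d) {n H : ℕ} (h : n ≤ H) (θ : Param d) :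
    (trajLaw m π H θ).map (trunc h) = trajLaw m π n θ := by
  induction H, h using Nat.le_induction with
  | base =>
    have : (trunc le_rfl : Traj S A n → Traj S A n) = id := rfl
    rw [this, Measure.map_id]
  | succ k hk ih =>
    have : (trunc (hk.trans k.le_succ) : Traj S A (k + 1) → Traj S A n) =
        trunc hk ∘ Fin.init := rfl
    rw [this, ← Measure.map_map (measurable_trunc hk) (measurable_init_traj k),
      map_init_trajLaw, ih]

end Trajectories
end SOPO

namespace SOPO

/-! ### Scores and derivatives of the trajectory density. -/

section Score

variable {S A : Type*} [MeasurableSpace S] [MeasurableSpace A] {d : ℕ}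

lemma contDiff_logDens (π : Policy S A d) (s : S) (a : A) : ContDiff ℝ 2 (logDens π s a) := by
  rcases π.pos_or_zero s a with h | h
  · exact (π.contDiff_dens s a).log fun θ => (h θ).ne'
  · have : logDens π s a = fun _ => 0 := by ext θ; simp [logDens, h]
    rw [this]; exact contDiff_const

lemma measurable_logDens (π : Policy S A d) (θ : Param d) :
    Measurable fun x : S × A => logDens π x.1 x.2 θ :=
  Real.measurable_log.comp (π.measurable_dens θ)

/-- The gradient of `log π_θ(a_h | s_h)`. -/
noncomputable def score (π : Policy S A d) {n : ℕ} (τ : Traj S A n) (h : Fin n) (θ : Param d) :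
    Param d :=
  gradient (logDens π (τ h).1 (τ h).2) θ

/-- The sum of the scores of the steps of a trajectory, i.e. the gradient of `log p(τ; θ)`. -/
noncomputable def totalScore (π : Policy S A d) {n : ℕ} (τ : Traj S A n) (θ : Param d) : Param d :=
  ∑ h, score π τ h θ

lemma contDiff_score (π : Policy S A d) {n : ℕ} (τ : Traj S A n) (h : Fin n) :
    ContDiff ℝ 1 (score π τ h) :=
  (contDiff_logDens π _ _).gradient_right

lemma contDiff_totalScore (π : Policy S A d) {n : ℕ} (τ : Traj S A n) :
    ContDiff ℝ 1 (totalScore π τ) :=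
  ContDiff.sum fun h _ => contDiff_score π τ h

lemma stronglyMeasurable_gradient_logDens (π : Policy S A d) (θ : Param d) :
    StronglyMeasurable fun x : S × A => gradient (logDens π x.1 x.2) θ :=
  stronglyMeasurable_gradient (EuclideanSpace.basisFun (Fin d) ℝ)
    (fun θ => (measurable_logDens π θ).stronglyMeasurable)
    (fun _ => (contDiff_logDens π _ _).differentiable (by norm_num)) θ

lemma stronglyMeasurable_score (π : Policy S A d) {n : ℕ} (h : Fin n) (θ : Param d) :
    StronglyMeasurable fun τ : Traj S A n => score π τ h θ :=
  (stronglyMeasurable_gradient_logDens π θ).comp_measurable (measurable_pi_apply h)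

lemma stronglyMeasurable_totalScore (π : Policy S A d) {n : ℕ} (θ : Param d) :
    StronglyMeasurable fun τ : Traj S A n => totalScore π τ θ :=
  Finset.stronglyMeasurable_fun_sum _ fun h _ => stronglyMeasurable_score π h θ

lemma stronglyMeasurable_fderiv_score (π : Policy S A d) {n : ℕ} (h : Fin n) (θ : Param d) :
    StronglyMeasurable fun τ : Traj S A n => fderiv ℝ (score π τ h) θ :=
  stronglyMeasurable_clm (EuclideanSpace.basisFun (Fin d) ℝ) fun v =>
    stronglyMeasurable_fderiv_apply (fun θ => stronglyMeasurable_score π h θ)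
      (fun τ => (contDiff_score π τ h).differentiable (by norm_num)) θ v

lemma continuous_dens (π : Policy S A d) (s : S) (a : A) : Continuous fun θ => π.dens θ s a :=
  (π.contDiff_dens s a).continuous

/-- The admissible actions do not depend on the parameter. Hence each trajectory either allows
logarithms for all parameters or contributes nothing for any of them. -/
lemma density_pos_or_zero (π : Policy S A d) {n : ℕ} (τ : Traj S A n) :
    (∀ θ h, 0 < π.dens θ (τ h).1 (τ h).2) ∨ ∀ θ, density π θ τ = 0 := by
  by_cases H : ∀ h, ∀ θ, 0 < π.dens θ (τ h).1 (τ h).2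
  · exact Or.inl fun θ h => H h θ
  · right
    push Not at H
    obtain ⟨h, θ, hθ⟩ := H
    have h0 := (π.pos_or_zero (τ h).1 (τ h).2).resolve_left fun h' => hθ.not_gt (h' θ)
    exact fun θ => Finset.prod_eq_zero (Finset.mem_univ h) (h0 θ)

lemma hasFDerivAt_logDens (π : Policy S A d) {n : ℕ} (τ : Traj S A n) (h : Fin n) (θ : Param d) :
    HasFDerivAt (logDens π (τ h).1 (τ h).2) (innerSL ℝ (score π τ h θ)) θ :=
  (((contDiff_logDens π _ _).differentiable (by norm_num)) θ).hasGradientAt.hasFDerivAt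

lemma innerSL_totalScore (π : Policy S A d) {n : ℕ} (τ : Traj S A n) (θ : Param d) :
    innerSL ℝ (totalScore π τ θ) = ∑ h, innerSL ℝ (score π τ h θ) := by
  simp [totalScore, map_sum]

lemma density_eq_exp (π : Policy S A d) {n : ℕ} (τ : Traj S A n)
    (hpos : ∀ θ h, 0 < π.dens θ (τ h).1 (τ h).2) (θ : Param d) :
    density π θ τ = Real.exp (∑ h, logDens π (τ h).1 (τ h).2 θ) := by
  rw [Real.exp_sum]
  exact Finset.prod_congr rfl fun h _ => (Real.exp_log (hpos θ h)).symm

/-- On admissible trajectories the density is the exponential of the summed log-densities; on the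
others both sides vanish identically, whatever the scores are. -/
lemma hasFDerivAt_density (π : Policy S A d) {n : ℕ} (τ : Traj S A n) (θ : Param d) :
    HasFDerivAt (fun θ => density π θ τ) (density π θ τ • innerSL ℝ (totalScore π τ θ)) θ := by
  rcases density_pos_or_zero π τ with h | h
  · have h1 : HasFDerivAt (fun θ => ∑ h, logDens π (τ h).1 (τ h).2 θ)
        (innerSL ℝ (totalScore π τ θ)) θ := by
      rw [innerSL_totalScore]
      exact HasFDerivAt.fun_sum fun h _ => hasFDerivAt_logDens π τ h θ
    have h2 := h1.exp
    rw [← density_eq_exp π τ h] at h2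
    exact h2.congr_of_eventuallyEq (Eventually.of_forall fun θ => density_eq_exp π τ h θ)
  · simp only [h, zero_smul]
    exact hasFDerivAt_const _ _

lemma gradient_log_density (π : Policy S A d) {n : ℕ} (τ : Traj S A n) (θ : Param d)
    (hτ : density π θ τ ≠ 0) :
    gradient (fun θ' => Real.log (density π θ' τ)) θ = totalScore π τ θ := by
  have h1 := (hasFDerivAt_density π τ θ).log hτ
  rw [smul_smul, inv_mul_cancel₀ hτ, one_smul] at h1
  have h2 : HasGradientAt (fun θ' => Real.log (density π θ' τ)) (totalScore π τ θ) θ := h1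
  exact h2.gradient

variable (m : MDP S A) (π : Policy S A d)

lemma integral_trajLaw {F : Type*} [NormedAddCommGroup F] [NormedSpace ℝ F] (n : ℕ) (θ : Param d)
    (f : Traj S A n → F) :
    ∫ τ, f τ ∂(trajLaw m π n θ) = ∫ τ, density π θ τ • f τ ∂(baseMeasure m π n) := by
  rw [trajLaw, integral_withDensity_eq_integral_toReal_smul
    (measurable_density π θ n).ennreal_ofReal (Eventually.of_forall fun _ => ENNReal.ofReal_lt_top)]
  simp [ENNReal.toReal_ofReal (density_nonneg π θ _)]

lemma integrable_trajLaw_iff {F : Type*} [NormedAddCommGroup F] [NormedSpace ℝ F] (n : ℕ)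
    (θ : Param d) (f : Traj S A n → F) :
    Integrable f (trajLaw m π n θ) ↔
      Integrable (fun τ => density π θ τ • f τ) (baseMeasure m π n) := by
  rw [trajLaw, integrable_withDensity_iff_integrable_smul'
    (measurable_density π θ n).ennreal_ofReal (Eventually.of_forall fun _ => ENNReal.ofReal_lt_top)]
  simp [ENNReal.toReal_ofReal (density_nonneg π θ _)]

lemma ae_density_ne_zero (n : ℕ) (θ : Param d) :
    ∀ᵐ τ ∂(trajLaw m π n θ), density π θ τ ≠ 0 := by
  rw [trajLaw, ae_withDensity_iff (measurable_density π θ n).ennreal_ofReal]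
  refine Eventually.of_forall fun τ hτ h => hτ ?_
  simp [h]

lemma isDensityFamily_density (n : ℕ) :
    IsDensityFamily (baseMeasure m π n) (fun (θ : Param d) (τ : Traj S A n) => density π θ τ) where
  nonneg θ τ := density_nonneg π θ τ
  measurable θ := measurable_density π θ n
  integrable θ := by
    have := (integrable_trajLaw_iff m π n θ (fun _ => (1 : ℝ))).1 (integrable_const _)
    simpa using this
  integral_eq_one θ := by
    have := integral_trajLaw m π n θ (fun _ => (1 : ℝ))
    simpa using this.symm
  continuous τ := continuous_finsetProd _ fun h _ => continuous_dens π _ _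

/-- Differentiation of an expectation in the parameter of the law. -/
lemma hasFDerivAt_expectation {F : Type*} [NormedAddCommGroup F] [NormedSpace ℝ F]
    [CompleteSpace F] {n : ℕ} {f : Param d → Traj S A n → F}
    {L : Param d → Traj S A n → Param d →L[ℝ] F}
    (hL : ∀ θ, StronglyMeasurable (L θ)) (hLc : ∀ τ, Continuous fun θ => L θ τ) {C : ℝ}
    (hi : ∀ θ, Integrable (fun τ => ‖L θ τ‖ ^ 2) (trajLaw m π n θ))
    (hC : ∀ θ, ∫ τ, ‖L θ τ‖ ^ 2 ∂(trajLaw m π n θ) ≤ C)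
    (hf : ∀ θ, Integrable (f θ) (trajLaw m π n θ))
    (hfd : ∀ θ τ, HasFDerivAt (fun θ => density π θ τ • f θ τ) (density π θ τ • L θ τ) θ)
    (θ : Param d) :
    HasFDerivAt (fun θ => ∫ τ, f θ τ ∂(trajLaw m π n θ)) (∫ τ, L θ τ ∂(trajLaw m π n θ)) θ := by
  simp_rw [integral_trajLaw] at hC ⊢
  simp_rw [integrable_trajLaw_iff] at hi hf
  exact (isDensityFamily_density m π n).hasFDerivAt_integral hL hLc hi hC hf hfd θ

end Score

end SOPO

namespace SOPO

/-! ### From bounds in the extended reals to real moments. -/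

section Moments

lemma integrable_norm_pow_of_lintegral_le {X F : Type*} [MeasurableSpace X] [NormedAddCommGroup F]
    {μ : Measure X} {f : X → F} (hf : StronglyMeasurable f) (k : ℕ) {B : ℝ} (hB : 0 ≤ B)
    (h : ∫⁻ x, ‖f x‖ₑ ^ k ∂μ ≤ ENNReal.ofReal B) :
    Integrable (fun x => ‖f x‖ ^ k) μ ∧ ∫ x, ‖f x‖ ^ k ∂μ ≤ B := by
  have h1 : ∀ x, ENNReal.ofReal (‖f x‖ ^ k) = ‖f x‖ₑ ^ k := fun x => by
    rw [ENNReal.ofReal_pow (norm_nonneg _), ofReal_norm]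
  have hm : AEStronglyMeasurable (fun x => ‖f x‖ ^ k) μ := (hf.norm.pow k).aestronglyMeasurable
  constructor
  · refine ⟨hm, ?_⟩
    rw [hasFiniteIntegral_iff_ofReal (Eventually.of_forall fun x => by positivity)]
    simp_rw [h1]
    exact h.trans_lt ENNReal.ofReal_lt_top
  · rw [integral_eq_lintegral_of_nonneg_ae (Eventually.of_forall fun x => by positivity) hm]
    simp_rw [h1]
    exact ENNReal.toReal_le_of_le_ofReal hB h

lemma integral_sq_le_of_integral_fourth_le {X F : Type*} [MeasurableSpace X] [NormedAddCommGroup F]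
    {μ : Measure X} [IsProbabilityMeasure μ] {f : X → F} (hf : StronglyMeasurable f) {G : ℝ}
    (hG : 0 < G) (hi : Integrable (fun x => ‖f x‖ ^ 4) μ) (h : ∫ x, ‖f x‖ ^ 4 ∂μ ≤ G ^ 4) :
    Integrable (fun x => ‖f x‖ ^ 2) μ ∧ ∫ x, ‖f x‖ ^ 2 ∂μ ≤ G ^ 2 := by
  -- Arithmetic-geometric mean inequality with the weight chosen so that the bound integrates to
  -- exactly `G ^ 2`.
  have hle : ∀ x, ‖f x‖ ^ 2 ≤ ‖f x‖ ^ 4 * (1 / (2 * G ^ 2)) + G ^ 2 / 2 := fun x => by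
    have : 0 ≤ (‖f x‖ ^ 2 - G ^ 2) ^ 2 / (2 * G ^ 2) := by positivity
    have h2 : (‖f x‖ ^ 2 - G ^ 2) ^ 2 / (2 * G ^ 2) =
        ‖f x‖ ^ 4 * (1 / (2 * G ^ 2)) + G ^ 2 / 2 - ‖f x‖ ^ 2 := by
      field_simp; ring
    linarith
  have hbi : Integrable (fun x => ‖f x‖ ^ 4 * (1 / (2 * G ^ 2)) + G ^ 2 / 2) μ :=
    (hi.mul_const _).add (integrable_const _)
  have hi2 : Integrable (fun x => ‖f x‖ ^ 2) μ := by
    refine hbi.mono (hf.norm.pow 2).aestronglyMeasurable (Eventually.of_forall fun x => ?_)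
    rw [Real.norm_of_nonneg (by positivity), Real.norm_of_nonneg (by positivity)]
    exact hle x
  refine ⟨hi2, (integral_mono hi2 hbi hle).trans ?_⟩
  rw [integral_add (hi.mul_const _) (integrable_const _), integral_mul_const, integral_const]
  simp only [probReal_univ, smul_eq_mul, one_mul]
  calc (∫ x, ‖f x‖ ^ 4 ∂μ) * (1 / (2 * G ^ 2)) + G ^ 2 / 2
      ≤ G ^ 4 * (1 / (2 * G ^ 2)) + G ^ 2 / 2 := by gcongr
    _ = G ^ 2 := by field_simp; ring

end Moments

/-! ### Orthogonality of a score to the past. -/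

section Causality

variable {S A : Type*} [MeasurableSpace S] [MeasurableSpace A] {d : ℕ}
variable {m : MDP S A} {π : Policy S A d}

/-- The scores of trajectories of length `n` have second moments bounded by `C`. -/
def ScoreL2 (m : MDP S A) (π : Policy S A d) (n : ℕ) (C : ℝ) : Prop :=
  ∀ (θ : Param d) (h : Fin n), Integrable (fun τ => ‖score π τ h θ‖ ^ 2) (trajLaw m π n θ) ∧
    ∫ τ, ‖score π τ h θ‖ ^ 2 ∂(trajLaw m π n θ) ≤ C

lemma integrable_trunc_iff {F : Type*} [NormedAddCommGroup F] {n H : ℕ} (h : n ≤ H) (θ : Param d)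
    {f : Traj S A n → F} (hf : StronglyMeasurable f) :
    Integrable (fun τ => f (trunc h τ)) (trajLaw m π H θ) ↔ Integrable f (trajLaw m π n θ) := by
  rw [← map_trunc_trajLaw m π h θ]
  exact (integrable_map_measure hf.aestronglyMeasurable (measurable_trunc h).aemeasurable).symm

lemma integral_trunc {F : Type*} [NormedAddCommGroup F] [NormedSpace ℝ F] {n H : ℕ} (h : n ≤ H)
    (θ : Param d) {f : Traj S A n → F} (hf : StronglyMeasurable f) :
    ∫ τ, f (trunc h τ) ∂(trajLaw m π H θ) = ∫ τ, f τ ∂(trajLaw m π n θ) := by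
  rw [← map_trunc_trajLaw m π h θ]
  exact (integral_map (measurable_trunc h).aemeasurable hf.aestronglyMeasurable).symm

/-- The score of a step depends on that step alone, so its moments can be computed under the law of
any prefix that contains it. -/
lemma ScoreL2.mono {n H : ℕ} {C : ℝ} (hC : ScoreL2 m π H C) (h : n ≤ H) : ScoreL2 m π n C := by
  intro θ k
  have hm : StronglyMeasurable fun τ : Traj S A n => ‖score π τ k θ‖ ^ 2 :=
    (stronglyMeasurable_score π k θ).norm.pow 2
  have := hC θ (Fin.castLE h k)
  rw [← integrable_trunc_iff h θ hm, ← integral_trunc h θ hm]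
  exact this

lemma sq_norm_sum_le {ι F : Type*} [NormedAddCommGroup F] (s : Finset ι) (f : ι → F) :
    ‖∑ i ∈ s, f i‖ ^ 2 ≤ s.card * ∑ i ∈ s, ‖f i‖ ^ 2 :=
  (pow_le_pow_left₀ (norm_nonneg _) (norm_sum_le _ _) 2).trans sq_sum_le_card_mul_sum_sq

lemma ScoreL2.totalScore {n : ℕ} {C : ℝ} (hC : ScoreL2 m π n C) (θ : Param d) :
    Integrable (fun τ => ‖totalScore π τ θ‖ ^ 2) (trajLaw m π n θ) ∧
      ∫ τ, ‖SOPO.totalScore π τ θ‖ ^ 2 ∂(trajLaw m π n θ) ≤ n * (n * C) := by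
  have hb : Integrable (fun τ => (n : ℝ) * ∑ h, ‖score π τ h θ‖ ^ 2) (trajLaw m π n θ) :=
    (integrable_finsetSum _ fun h _ => (hC θ h).1).const_mul _
  have hle : ∀ τ : Traj S A n, ‖SOPO.totalScore π τ θ‖ ^ 2 ≤ n * ∑ h, ‖score π τ h θ‖ ^ 2 :=
    fun τ => by simpa [SOPO.totalScore] using sq_norm_sum_le Finset.univ fun h => score π τ h θ
  have hi : Integrable (fun τ => ‖SOPO.totalScore π τ θ‖ ^ 2) (trajLaw m π n θ) := by
    refine hb.mono' ((stronglyMeasurable_totalScore π θ).norm.pow 2).aestronglyMeasurable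
      (Eventually.of_forall fun τ => ?_)
    rw [Real.norm_of_nonneg (by positivity)]
    exact hle τ
  refine ⟨hi, (integral_mono hi hb hle).trans ?_⟩
  rw [integral_const_mul, integral_finsetSum _ fun h _ => (hC θ h).1]
  gcongr
  calc ∑ h, ∫ τ, ‖score π τ h θ‖ ^ 2 ∂(trajLaw m π n θ) ≤ ∑ _h : Fin n, C :=
        Finset.sum_le_sum fun h _ => (hC θ h).2
    _ = n * C := by simp

lemma integrable_of_sq {X F : Type*} [MeasurableSpace X] [NormedAddCommGroup F]
    {μ : Measure X} [IsFiniteMeasure μ] {g : X → F} (hg : StronglyMeasurable g)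
    (hg2 : Integrable (fun x => ‖g x‖ ^ 2) μ) : Integrable g μ := by
  refine Integrable.mono' ((integrable_const (1 : ℝ)).add hg2) hg.aestronglyMeasurable
    (Eventually.of_forall fun x => ?_)
  rw [Pi.add_apply]
  nlinarith [sq_nonneg (‖g x‖ - 1), norm_nonneg (g x)]

/-- The likelihood-ratio formula for bounded functions of a trajectory. -/
lemma hasGradientAt_expectation_of_bounded {n : ℕ} {C : ℝ} (hC : ScoreL2 m π n C)
    {f : Traj S A n → ℝ} (hf : StronglyMeasurable f) {B : ℝ} (hB : ∀ τ, |f τ| ≤ B) (θ : Param d) :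
    HasGradientAt (fun θ => ∫ τ, f τ ∂(trajLaw m π n θ))
      (∫ τ, f τ • totalScore π τ θ ∂(trajLaw m π n θ)) θ := by
  have hsq : ∀ θ (τ : Traj S A n),
      ‖f τ • innerSL ℝ (totalScore π τ θ)‖ ^ 2 ≤ B ^ 2 * ‖totalScore π τ θ‖ ^ 2 := fun θ τ => by
    rw [norm_smul, innerSL_apply_norm, mul_pow, Real.norm_eq_abs]
    have := hB τ
    gcongr
  have hL : ∀ θ, StronglyMeasurable fun τ : Traj S A n => f τ • innerSL ℝ (totalScore π τ θ) :=
    fun θ => hf.smul ((innerSL ℝ).continuous.comp_stronglyMeasurable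
      (stronglyMeasurable_totalScore π θ))
  have hi : ∀ θ, Integrable (fun τ => ‖f τ • innerSL ℝ (totalScore π τ θ)‖ ^ 2)
      (trajLaw m π n θ) := fun θ => by
    refine ((hC.totalScore θ).1.const_mul (B ^ 2)).mono'
      ((hL θ).norm.pow 2).aestronglyMeasurable (Eventually.of_forall fun τ => ?_)
    rw [Real.norm_of_nonneg (by positivity)]
    exact hsq θ τ
  have key := hasFDerivAt_expectation m π (f := fun _ τ => f τ)
    (L := fun θ τ => f τ • innerSL ℝ (totalScore π τ θ)) (C := B ^ 2 * (n * (n * C))) hL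
    (fun τ => ((innerSL ℝ).continuous.comp (contDiff_totalScore π τ).continuous).const_smul (f τ))
    hi (fun θ => ?_) (fun θ => ?_) (fun θ τ => ?_) θ
  · rw [hasGradientAt_iff_hasFDerivAt]
    refine key.congr_fderiv ?_
    have hint : Integrable (fun τ => f τ • totalScore π τ θ) (trajLaw m π n θ) := by
      refine integrable_of_sq (hf.smul (stronglyMeasurable_totalScore π θ)) ?_
      have h1 : ∀ τ : Traj S A n, ‖f τ • innerSL ℝ (totalScore π τ θ)‖ =
          ‖f τ • totalScore π τ θ‖ := fun τ => by rw [norm_smul, norm_smul, innerSL_apply_norm]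
      simpa only [h1] using hi θ
    ext v
    rw [ContinuousLinearMap.integral_apply (integrable_of_sq (hL θ) (hi θ)),
      InnerProductSpace.toDual_apply_apply, real_inner_comm, ← integral_inner hint]
    refine integral_congr_ae (Eventually.of_forall fun τ => ?_)
    simp only [_root_.smul_apply, innerSL_apply_apply, smul_eq_mul, real_inner_smul_right]
    rw [real_inner_comm]
  · refine (integral_mono (hi θ) ((hC.totalScore θ).1.const_mul (B ^ 2)) (hsq θ)).trans ?_
    rw [integral_const_mul]
    exact mul_le_mul_of_nonneg_left (hC.totalScore θ).2 (sq_nonneg B)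
  · exact Integrable.of_bound hf.aestronglyMeasurable B (Eventually.of_forall hB)
  · have := (hasFDerivAt_density π τ θ).mul_const (f τ)
    refine this.congr_fderiv ?_
    rw [smul_smul, smul_smul, mul_comm]

lemma totalScore_succ {n : ℕ} (τ : Traj S A (n + 1)) (θ : Param d) :
    totalScore π τ θ = totalScore π (Fin.init τ : Traj S A n) θ + score π τ (Fin.last n) θ := by
  simp [totalScore, Fin.sum_univ_castSucc, score, Fin.init]

lemma integrable_smul_of_sq {X F : Type*} [MeasurableSpace X] [NormedAddCommGroup F]
    [NormedSpace ℝ F] {μ : Measure X} {f : X → ℝ} {g : X → F} (hf : StronglyMeasurable f)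
    (hg : StronglyMeasurable g) (hf2 : Integrable (fun x => f x ^ 2) μ)
    (hg2 : Integrable (fun x => ‖g x‖ ^ 2) μ) : Integrable (fun x => f x • g x) μ := by
  refine Integrable.mono' (hf2.add hg2) (hf.smul hg).aestronglyMeasurable
    (Eventually.of_forall fun x => ?_)
  rw [norm_smul, Real.norm_eq_abs, Pi.add_apply, ← sq_abs (f x)]
  nlinarith [sq_nonneg (|f x| - ‖g x‖), sq_nonneg (|f x|), sq_nonneg ‖g x‖]

/-- The expectation of `f` over the first `n` steps is the same function of the parameter at
horizons `n` and `n + 1`. The two likelihood-ratio formulas for its gradient therefore agree, and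
they differ by exactly this integral. -/
lemma integral_smul_score_last_of_bounded {n : ℕ} {C : ℝ} (hC : ScoreL2 m π (n + 1) C)
    {f : Traj S A n → ℝ} (hf : StronglyMeasurable f) {B : ℝ} (hB : ∀ τ, |f τ| ≤ B) (θ : Param d) :
    ∫ τ, f (Fin.init τ) • score π τ (Fin.last n) θ ∂(trajLaw m π (n + 1) θ) = 0 := by
  have hC' := hC.mono n.le_succ
  have hfi : StronglyMeasurable fun τ : Traj S A (n + 1) => f (Fin.init τ) :=
    hf.comp_measurable (measurable_init_traj n)
  have h1 := hasGradientAt_expectation_of_bounded hC hfi (fun τ => hB _) θ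
  have h2 := hasGradientAt_expectation_of_bounded hC' hf hB θ
  have h3 : ∀ θ, ∫ τ, f (Fin.init τ) ∂(trajLaw m π (n + 1) θ) = ∫ τ, f τ ∂(trajLaw m π n θ) :=
    fun θ => integral_trunc n.le_succ θ hf
  simp_rw [h3] at h1
  have h4 := h1.unique h2
  have hf2 : Integrable (fun τ : Traj S A (n + 1) => f (Fin.init τ) ^ 2) (trajLaw m π (n + 1) θ) :=
    Integrable.of_bound (hfi.pow 2).aestronglyMeasurable (B ^ 2) (Eventually.of_forall fun τ => by
      rw [Real.norm_of_nonneg (by positivity), ← sq_abs]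
      have := hB (Fin.init τ)
      gcongr)
  have hSm : StronglyMeasurable fun τ : Traj S A n => f τ • totalScore π τ θ :=
    hf.smul (stronglyMeasurable_totalScore π θ)
  have hSi : StronglyMeasurable fun τ : Traj S A (n + 1) =>
      totalScore π (Fin.init τ : Traj S A n) θ :=
    (stronglyMeasurable_totalScore π θ).comp_measurable (measurable_init_traj n)
  have hSi2 : Integrable (fun τ : Traj S A (n + 1) =>
      ‖totalScore π (Fin.init τ : Traj S A n) θ‖ ^ 2) (trajLaw m π (n + 1) θ) :=
    (integrable_trunc_iff n.le_succ θ ((stronglyMeasurable_totalScore π θ).norm.pow 2)).2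
      (hC'.totalScore θ).1
  rw [← integral_trunc n.le_succ θ hSm] at h4
  have h5 : ∀ τ : Traj S A (n + 1), f (Fin.init τ) • totalScore π τ θ =
      f (Fin.init τ) • totalScore π (Fin.init τ : Traj S A n) θ +
        f (Fin.init τ) • score π τ (Fin.last n) θ := fun τ => by
    rw [totalScore_succ, smul_add]
  simp_rw [h5] at h4
  rw [integral_add (integrable_smul_of_sq hfi hSi hf2 hSi2)
    (integrable_smul_of_sq hfi (stronglyMeasurable_score π _ θ) hf2 (hC θ _).1)] at h4
  exact add_eq_left.1 h4

lemma softClip_tendsto {F : Type*} [NormedAddCommGroup F] [NormedSpace ℝ F] (x : F) :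
    Tendsto (fun N : ℕ => softClip ((N : ℝ) + 1) x) atTop (𝓝 x) := by
  have h1 : Tendsto (fun N : ℕ => ‖x‖ * (1 / ((N : ℝ) + 1))) atTop (𝓝 (‖x‖ * 0)) :=
    tendsto_one_div_add_atTop_nhds_zero_nat.const_mul _
  have h2 := ((h1.const_add 1).inv₀ (by simp)).smul_const x
  simpa [softClip, div_eq_mul_inv] using h2

lemma norm_softClip_le_norm {F : Type*} [NormedAddCommGroup F] [NormedSpace ℝ F] {N : ℝ}
    (hN : 0 < N) (x : F) : ‖softClip N x‖ ≤ ‖x‖ := by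
  have h : 1 ≤ 1 + ‖x‖ / N := by
    have : 0 ≤ ‖x‖ / N := by positivity
    linarith
  rw [softClip, norm_smul, norm_inv, Real.norm_of_nonneg (by linarith)]
  exact mul_le_of_le_one_left (norm_nonneg _) (inv_le_one_of_one_le₀ h)

/-- The score of a step is orthogonal to every square-integrable function of the earlier steps. -/
lemma integral_smul_score_eq_zero {H : ℕ} {C : ℝ} (hC : ScoreL2 m π H C) (h : Fin H)
    {f : Traj S A h → ℝ} (hf : StronglyMeasurable f) (θ : Param d)
    (hf2 : Integrable (fun τ => f (trunc h.2.le τ) ^ 2) (trajLaw m π H θ)) :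
    ∫ τ, f (trunc h.2.le τ) • score π τ h θ ∂(trajLaw m π H θ) = 0 := by
  have hfm : StronglyMeasurable fun τ : Traj S A H => f (trunc h.2.le τ) :=
    hf.comp_measurable (measurable_trunc _)
  -- The bounded case applies to clipped versions of `f`; the clips are dominated by `f` itself, so
  -- the clipping level can tend to infinity.
  have hb : ∀ N : ℕ,
      ∫ τ, softClip ((N : ℝ) + 1) (f (trunc h.2.le τ)) • score π τ h θ ∂(trajLaw m π H θ) = 0 := by
    intro N
    have hN : (0 : ℝ) < (N : ℝ) + 1 := by positivity
    have hcm : StronglyMeasurable fun τ => softClip ((N : ℝ) + 1) (f τ) :=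
      (continuous_softClip hN).comp_stronglyMeasurable hf
    have h1 := integral_smul_score_last_of_bounded (hC.mono (Nat.succ_le_of_lt h.2)) hcm
      (B := (N : ℝ) + 1) (fun τ => norm_softClip_le hN (f τ)) θ
    have h2 : StronglyMeasurable fun τ : Traj S A (h + 1) =>
        softClip ((N : ℝ) + 1) (f (Fin.init τ)) • score π τ (Fin.last h) θ :=
      (hcm.comp_measurable (measurable_init_traj _)).smul (stronglyMeasurable_score π _ θ)
    rwa [← integral_trunc (Nat.succ_le_of_lt h.2) θ h2] at h1
  have hlim : Tendsto (fun N : ℕ => ∫ τ, softClip ((N : ℝ) + 1) (f (trunc h.2.le τ)) •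
      score π τ h θ ∂(trajLaw m π H θ)) atTop
      (𝓝 (∫ τ, f (trunc h.2.le τ) • score π τ h θ ∂(trajLaw m π H θ))) := by
    refine tendsto_integral_of_dominated_convergence
      (fun τ => ‖f (trunc h.2.le τ) • score π τ h θ‖) (fun N => ?_)
      (integrable_smul_of_sq hfm (stronglyMeasurable_score π h θ) hf2 (hC θ h).1).norm
      (fun N => Eventually.of_forall fun τ => ?_) (Eventually.of_forall fun τ => ?_)
    · exact (((continuous_softClip (by positivity)).comp_stronglyMeasurable hfm).smul
        (stronglyMeasurable_score π h θ)).aestronglyMeasurable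
    · rw [norm_smul, norm_smul]
      gcongr
      exact norm_softClip_le_norm (by positivity) _
    · exact (softClip_tendsto _).smul_const _
  simp_rw [hb] at hlim
  exact (tendsto_nhds_unique hlim tendsto_const_nhds)

/-- Each coordinate of the earlier score is a square-integrable function of the past of step `h`, so
orthogonality applies coordinate by coordinate. -/
lemma integral_inner_score_eq_zero {H : ℕ} {C : ℝ} (hC : ScoreL2 m π H C) {k h : Fin H}
    (hkh : k < h) (θ : Param d) :
    ∫ τ, inner ℝ (score π τ k θ) (score π τ h θ) ∂(trajLaw m π H θ) = 0 := by
  let k' : Fin h := ⟨k, hkh⟩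
  have hsm : ∀ j, StronglyMeasurable fun τ : Traj S A h => score π τ k' θ j := fun j =>
    (EuclideanSpace.proj (𝕜 := ℝ) j).continuous.comp_stronglyMeasurable
      (stronglyMeasurable_score π k' θ)
  have hcoord : ∀ (τ : Traj S A H) j, score π (trunc h.2.le τ) k' θ j = score π τ k θ j :=
    fun τ j => rfl
  have hsq : ∀ j, Integrable (fun τ => score π (trunc h.2.le τ) k' θ j ^ 2)
      (trajLaw m π H θ) := fun j => by
    refine (hC θ k).1.mono' (((hsm j).comp_measurable (measurable_trunc _)).pow 2).aestronglyMeasurable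
      (Eventually.of_forall fun τ => ?_)
    rw [Real.norm_of_nonneg (by positivity), hcoord, ← sq_abs, ← Real.norm_eq_abs]
    gcongr
    exact PiLp.norm_apply_le _ _
  have h0 : ∀ j, ∫ τ, score π τ k θ j * score π τ h θ j ∂(trajLaw m π H θ) = 0 := fun j => by
    have h1 := integral_smul_score_eq_zero hC h (hsm j) θ (hsq j)
    have hint := integrable_smul_of_sq ((hsm j).comp_measurable (measurable_trunc h.2.le))
      (stronglyMeasurable_score π h θ) (hsq j) (hC θ h).1
    have h2 := (EuclideanSpace.proj j : Param d →L[ℝ] ℝ).integral_comp_comm hint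
    simp only [Function.comp_def] at h2
    rw [h1, map_zero] at h2
    exact h2
  have h1 : ∀ τ : Traj S A H, inner ℝ (score π τ k θ) (score π τ h θ) =
      ∑ j, score π τ k θ j * score π τ h θ j := fun τ => by
    simp [PiLp.inner_apply, mul_comm]
  simp_rw [h1]
  rw [integral_finsetSum]
  · exact Finset.sum_eq_zero fun j _ => h0 j
  · intro j _
    have hp : ∀ k, StronglyMeasurable fun τ : Traj S A H => score π τ k θ j := fun k =>
      (EuclideanSpace.proj (𝕜 := ℝ) j).continuous.comp_stronglyMeasurable
        (stronglyMeasurable_score π k θ)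
    have hsq' : ∀ k, Integrable (fun τ => ‖score π τ k θ j‖ ^ 2) (trajLaw m π H θ) := fun k => by
      refine (hC θ k).1.mono' ((hp k).norm.pow 2).aestronglyMeasurable
        (Eventually.of_forall fun τ => ?_)
      rw [Real.norm_of_nonneg (by positivity)]
      gcongr
      exact PiLp.norm_apply_le _ _
    have := integrable_smul_of_sq (hp k) (hp h) (by simpa using hsq' k) (hsq' h)
    simpa using this

end Causality

end SOPO

namespace SOPO

/-! ### Discounted sums and power-mean inequalities. -/

section GeometricSums

lemma sum_pow_le {x : ℝ} (h0 : 0 ≤ x) (h1 : x < 1) (n : ℕ) :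
    ∑ i : Fin n, x ^ (i : ℕ) ≤ 1 / (1 - x) := by
  rw [Fin.sum_univ_eq_sum_range (fun i => x ^ i) n, le_div_iff₀ (by linarith), geom_sum_mul_neg]
  linarith [pow_nonneg h0 n]

lemma sum_Ici_pow_le {x : ℝ} (h0 : 0 ≤ x) (h1 : x < 1) {n : ℕ} (h : Fin n) :
    ∑ i ∈ Finset.Ici h, x ^ (i : ℕ) ≤ x ^ (h : ℕ) / (1 - x) := by
  have h2 : ∑ i ∈ Finset.Ici h, x ^ (i : ℕ) = ∑ i ∈ Finset.Ico (h : ℕ) n, x ^ i := by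
    rw [← Fin.map_valEmbedding_Ici, Finset.sum_map]; rfl
  rw [h2, le_div_iff₀ (by linarith), geom_sum_Ico_mul_neg _ h.2.le]
  linarith [pow_nonneg h0 n]

lemma sum_succ_mul_pow_le {x : ℝ} (h0 : 0 ≤ x) (h1 : x < 1) (n : ℕ) :
    ∑ i : Fin n, ((i : ℝ) + 1) * x ^ (i : ℕ) ≤ 1 / (1 - x) ^ 2 := by
  -- Exact closed form of the partial sum of the differentiated geometric series; the correction
  -- terms have a nonpositive total.
  have key : (∑ i ∈ Finset.range n, ((i : ℝ) + 1) * x ^ i) * (1 - x) ^ 2 =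
      1 - (n + 1) * x ^ n + n * x ^ (n + 1) := by
    induction n with
    | zero => simp
    | succ n ih =>
      rw [Finset.sum_range_succ, add_mul, ih]
      push_cast
      ring
  rw [Fin.sum_univ_eq_sum_range (fun i => ((i : ℝ) + 1) * x ^ i) n,
    le_div_iff₀ (by have : 0 < 1 - x := by linarith
                    positivity), key]
  have : 0 ≤ x ^ n * (n * (1 - x) + 1) := by
    have : 0 ≤ 1 - x := by linarith
    positivity
  nlinarith [this, pow_succ x n]

lemma sq_sum_weighted_le {ι : Type*} (s : Finset ι) (w a : ι → ℝ) (hw : ∀ i, 0 ≤ w i) :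
    (∑ i ∈ s, w i * a i) ^ 2 ≤ (∑ i ∈ s, w i) * ∑ i ∈ s, w i * a i ^ 2 :=
  Finset.sum_sq_le_sum_mul_sum_of_sq_le_mul s (fun i _ => hw i)
    (fun i _ => mul_nonneg (hw i) (sq_nonneg _)) fun i _ => by apply le_of_eq; ring

lemma fourth_pow_sum_le {ι : Type*} [Fintype ι] (a : ι → ℝ) :
    (∑ i, a i) ^ 4 ≤ (Fintype.card ι : ℝ) ^ 3 * ∑ i, a i ^ 4 := by
  have h1 : (∑ i, a i) ^ 2 ≤ (Fintype.card ι : ℝ) * ∑ i, a i ^ 2 :=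
    sq_sum_le_card_mul_sum_sq
  have h2 : (∑ i, a i ^ 2) ^ 2 ≤ (Fintype.card ι : ℝ) * ∑ i, (a i ^ 2) ^ 2 :=
    sq_sum_le_card_mul_sum_sq
  calc (∑ i, a i) ^ 4 = ((∑ i, a i) ^ 2) ^ 2 := by ring
    _ ≤ ((Fintype.card ι : ℝ) * ∑ i, a i ^ 2) ^ 2 := by gcongr
    _ = (Fintype.card ι : ℝ) ^ 2 * (∑ i, a i ^ 2) ^ 2 := by ring
    _ ≤ (Fintype.card ι : ℝ) ^ 2 * ((Fintype.card ι : ℝ) * ∑ i, (a i ^ 2) ^ 2) := by gcongr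
    _ = (Fintype.card ι : ℝ) ^ 3 * ∑ i, a i ^ 4 := by
        simp_rw [← pow_mul]; ring

end GeometricSums

/-! ### The single-trajectory estimators. -/

section Estimators

variable {S A : Type*} [MeasurableSpace S] [MeasurableSpace A] {d : ℕ}
variable {m : MDP S A} {π : Policy S A d}

lemma one_sub_discount_pos (m : MDP S A) : 0 < 1 - m.discount := by linarith [m.discount_lt_one]

lemma measurable_cost_step (m : MDP S A) {n : ℕ} (h : Fin n) :
    Measurable fun τ : Traj S A n => m.cost (τ h).1 (τ h).2 :=
  m.measurable_cost.comp (measurable_pi_apply h)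

lemma measurable_costToGo (m : MDP S A) {n : ℕ} (h : Fin n) :
    Measurable fun τ : Traj S A n => costToGo m τ h :=
  Finset.measurable_fun_sum _ fun i _ => (measurable_cost_step m i).const_mul _

lemma measurable_totalCost (m : MDP S A) (n : ℕ) :
    Measurable fun τ : Traj S A n => totalCost m τ :=
  Finset.measurable_fun_sum _ fun i _ => (measurable_cost_step m i).const_mul _

lemma abs_sum_cost_le {R : ℝ} (hcost : BoundedCost m R) {n : ℕ} (s : Finset (Fin n))
    (τ : Traj S A n) :
    |∑ i ∈ s, m.discount ^ (i : ℕ) * m.cost (τ i).1 (τ i).2| ≤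
      R * ∑ i ∈ s, m.discount ^ (i : ℕ) := by
  refine (Finset.abs_sum_le_sum_abs _ _).trans ?_
  rw [Finset.mul_sum]
  refine Finset.sum_le_sum fun i _ => ?_
  have h0 := pow_nonneg m.discount_nonneg (i : ℕ)
  rw [abs_mul, abs_of_nonneg h0, mul_comm]
  exact mul_le_mul_of_nonneg_right (hcost _ _) h0

lemma abs_totalCost_le {R : ℝ} (hR : 0 ≤ R) (hcost : BoundedCost m R) {n : ℕ} (τ : Traj S A n) :
    |totalCost m τ| ≤ R / (1 - m.discount) := by
  refine (abs_sum_cost_le hcost Finset.univ τ).trans ?_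
  rw [div_eq_mul_one_div]
  exact mul_le_mul_of_nonneg_left (sum_pow_le m.discount_nonneg m.discount_lt_one n) hR

lemma abs_costToGo_le {R : ℝ} (hR : 0 ≤ R) (hcost : BoundedCost m R) {n : ℕ} (τ : Traj S A n)
    (h : Fin n) : |costToGo m τ h| ≤ R / (1 - m.discount) * m.discount ^ (h : ℕ) := by
  refine (abs_sum_cost_le hcost _ τ).trans ?_
  rw [div_mul_eq_mul_div, mul_div_assoc]
  exact mul_le_mul_of_nonneg_left (sum_Ici_pow_le m.discount_nonneg m.discount_lt_one h) hR

lemma totalCost_eq_add (m : MDP S A) {n : ℕ} (τ : Traj S A n) (h : Fin n) :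
    totalCost m τ = totalCost m (trunc h.2.le τ) + costToGo m τ h := by
  rw [totalCost, costToGo, ← Finset.sum_filter_add_sum_filter_not Finset.univ (· < h)]
  congr 1
  · refine (Finset.sum_bij (fun j _ => Fin.castLE h.2.le j) (fun j _ => ?_) (fun a _ b _ hab => ?_)
      (fun b hb => ?_) fun j _ => rfl).symm
    · simp only [Finset.mem_filter, Finset.mem_univ, true_and]
      exact j.2
    · exact Fin.castLE_injective _ hab
    · simp only [Finset.mem_filter, Finset.mem_univ, true_and] at hb
      exact ⟨⟨b, hb⟩, Finset.mem_univ _, rfl⟩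
  · refine Finset.sum_congr ?_ fun _ _ => rfl
    ext i; simp

lemma gradEst_eq (m : MDP S A) (π : Policy S A d) {n : ℕ} (τ : Traj S A n) (θ : Param d) :
    gradEst m π τ θ = ∑ h, costToGo m τ h • score π τ h θ := rfl

/-- Summation by costs instead of by scores. The discount weights become explicit and the inner sums
have orthogonal terms, which saves a factor over the triangle inequality. -/
lemma gradEst_eq_sum_cost (m : MDP S A) (π : Policy S A d) {n : ℕ} (τ : Traj S A n)
    (θ : Param d) :
    gradEst m π τ θ = ∑ i : Fin n, (m.discount ^ (i : ℕ) * m.cost (τ i).1 (τ i).2) •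
      ∑ h ∈ Finset.Iic i, score π τ h θ := by
  simp_rw [gradEst_eq, costToGo, Finset.sum_smul, Finset.smul_sum]
  refine Finset.sum_comm' fun x y => ?_
  simp

lemma contDiff_gradEst (m : MDP S A) (π : Policy S A d) {n : ℕ} (τ : Traj S A n) :
    ContDiff ℝ 1 (gradEst m π τ) :=
  ContDiff.sum fun h _ => (contDiff_score π τ h).const_smul _

lemma stronglyMeasurable_gradEst (m : MDP S A) (π : Policy S A d) {n : ℕ} (θ : Param d) :
    StronglyMeasurable fun τ : Traj S A n => gradEst m π τ θ :=
  Finset.stronglyMeasurable_fun_sum _ fun h _ =>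
    (measurable_costToGo m h).stronglyMeasurable.smul (stronglyMeasurable_score π h θ)

lemma stronglyMeasurable_fderiv_gradEst (m : MDP S A) (π : Policy S A d) {n : ℕ} (θ : Param d) :
    StronglyMeasurable fun τ : Traj S A n => fderiv ℝ (gradEst m π τ) θ :=
  stronglyMeasurable_clm (EuclideanSpace.basisFun (Fin d) ℝ) fun v =>
    stronglyMeasurable_fderiv_apply (fun θ => stronglyMeasurable_gradEst m π θ)
      (fun τ => (contDiff_gradEst m π τ).differentiable (by norm_num)) θ v

/-- The Hessian estimator, with the gradient of the log-density of the trajectory written as the sum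
of the scores. -/
noncomputable def hessScore (m : MDP S A) (π : Policy S A d) {n : ℕ} (τ : Traj S A n)
    (θ : Param d) : Param d →L[ℝ] Param d :=
  fderiv ℝ (gradEst m π τ) θ + (innerSL ℝ (totalScore π τ θ)).smulRight (gradEst m π τ θ)

lemma hessEst_eq_hessScore {n : ℕ} {τ : Traj S A n} {θ : Param d} (h : density π θ τ ≠ 0) :
    hessEst m π τ θ = hessScore m π τ θ := by
  rw [hessEst, hessScore, gradient_log_density π τ θ h]

/-- Outside the common support `Real.log 0 = 0` makes the log-density constant, so the rank-one term
disappears there although `totalScore` need not vanish. `hessEst` and `hessScore` may thus differ,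
but only on a null set of the trajectory law. -/
lemma hessEst_eq_fderiv {n : ℕ} {τ : Traj S A n} (h : ∀ θ, density π θ τ = 0) (θ : Param d) :
    hessEst m π τ θ = fderiv ℝ (gradEst m π τ) θ := by
  have : gradient (fun θ' => Real.log (density π θ' τ)) θ = 0 := by
    simp [h, gradient_fun_const]
  simp [hessEst, this]

lemma density_ne_zero_iff (π : Policy S A d) {n : ℕ} (τ : Traj S A n) (θ θ' : Param d) :
    density π θ τ ≠ 0 ↔ density π θ' τ ≠ 0 := by
  rcases density_pos_or_zero π τ with h | h
  · have : ∀ θ, density π θ τ ≠ 0 := fun θ => Finset.prod_ne_zero_iff.2 fun k _ => (h θ k).ne'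
    simp [this]
  · simp [h]

lemma continuous_smulRight_innerSL {Y : Type*} [TopologicalSpace Y] {f g : Y → Param d}
    (hf : Continuous f) (hg : Continuous g) :
    Continuous fun y => (innerSL ℝ (f y)).smulRight (g y) := by
  have h1 : Continuous fun y =>
      ContinuousLinearMap.smulRightL ℝ (Param d) (Param d) (innerSL ℝ (f y)) (g y) := by
    fun_prop
  exact h1

lemma stronglyMeasurable_smulRight_innerSL {Y : Type*} [MeasurableSpace Y] {f g : Y → Param d}
    (hf : StronglyMeasurable f) (hg : StronglyMeasurable g) :
    StronglyMeasurable fun y => (innerSL ℝ (f y)).smulRight (g y) := by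
  have h1 : Continuous fun x : Param d × Param d => (innerSL ℝ x.1).smulRight x.2 :=
    continuous_smulRight_innerSL continuous_fst continuous_snd
  have h2 : StronglyMeasurable fun y => (f y, g y) := hf.prodMk hg
  have h3 := h1.comp_stronglyMeasurable h2
  simpa only [Function.comp_def] using h3

lemma continuous_hessScore (m : MDP S A) (π : Policy S A d) {n : ℕ} (τ : Traj S A n) :
    Continuous fun θ => hessScore m π τ θ := by
  have h1 := (contDiff_gradEst m π τ).continuous_fderiv (by norm_num)
  have h2 := continuous_smulRight_innerSL (contDiff_totalScore π τ).continuous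
    (contDiff_gradEst m π τ).continuous
  unfold hessScore
  exact h1.add h2

lemma stronglyMeasurable_hessScore (m : MDP S A) (π : Policy S A d) {n : ℕ} (θ : Param d) :
    StronglyMeasurable fun τ : Traj S A n => hessScore m π τ θ := by
  have h1 := stronglyMeasurable_fderiv_gradEst m π (n := n) θ
  have h2 := stronglyMeasurable_smulRight_innerSL (stronglyMeasurable_totalScore π (n := n) θ)
    (stronglyMeasurable_gradEst m π θ)
  unfold hessScore
  exact h1.add h2

lemma continuous_hessEst (m : MDP S A) (π : Policy S A d) {n : ℕ} (τ : Traj S A n) :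
    Continuous fun θ => hessEst m π τ θ := by
  by_cases h : ∀ θ, density π θ τ = 0
  · simp_rw [hessEst_eq_fderiv h]
    exact (contDiff_gradEst m π τ).continuous_fderiv (by norm_num)
  · push Not at h
    obtain ⟨θ₁, h₁⟩ := h
    have : ∀ θ, hessEst m π τ θ = hessScore m π τ θ := fun θ =>
      hessEst_eq_hessScore ((density_ne_zero_iff π τ θ₁ θ).1 h₁)
    simp_rw [this]
    exact continuous_hessScore m π τ

lemma stronglyMeasurable_hessEst (m : MDP S A) (π : Policy S A d) {n : ℕ} (θ : Param d) :
    StronglyMeasurable fun τ : Traj S A n => hessEst m π τ θ := by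
  classical
  have : (fun τ : Traj S A n => hessEst m π τ θ) = fun τ =>
      if density π θ τ = 0 then fderiv ℝ (gradEst m π τ) θ else hessScore m π τ θ := by
    ext1 τ
    split_ifs with h
    · refine hessEst_eq_fderiv (fun θ' => ?_) θ
      by_contra h'
      exact (density_ne_zero_iff π τ θ' θ).1 h' h
    · exact hessEst_eq_hessScore h
  rw [this]
  exact StronglyMeasurable.ite (measurable_density π θ n (measurableSet_singleton 0))
    (stronglyMeasurable_fderiv_gradEst m π θ) (stronglyMeasurable_hessScore m π θ)

lemma hessEst_ae_eq (m : MDP S A) (π : Policy S A d) (n : ℕ) (θ : Param d) :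
    (fun τ => hessEst m π τ θ) =ᵐ[trajLaw m π n θ] fun τ => hessScore m π τ θ := by
  filter_upwards [ae_density_ne_zero m π n θ] with τ h
  exact hessEst_eq_hessScore h

end Estimators

end SOPO

namespace SOPO

/-! ### Policy gradient theorem and second moments of the estimators. -/

section PolicyGradient

variable {S A : Type*} [MeasurableSpace S] [MeasurableSpace A] {d : ℕ}
variable {m : MDP S A} {π : Policy S A d}

lemma integrable_mul_of_bounded_left {X F : Type*} [MeasurableSpace X] [NormedAddCommGroup F]
    [NormedSpace ℝ F] {μ : Measure X} {f : X → ℝ} {g : X → F} (hf : Measurable f) {B : ℝ}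
    (hB : ∀ x, |f x| ≤ B) (hg : Integrable g μ) : Integrable (fun x => f x • g x) μ :=
  hg.bdd_smul B hf.aestronglyMeasurable (Eventually.of_forall hB)

lemma integrable_sq_of_sq_le {X F : Type*} [MeasurableSpace X] [NormedAddCommGroup F]
    {μ : Measure X} {f : X → F} {g : X → ℝ} (hf : StronglyMeasurable f) (hg : Integrable g μ)
    (h : ∀ x, ‖f x‖ ^ 2 ≤ g x) : Integrable (fun x => ‖f x‖ ^ 2) μ := by
  refine hg.mono' (hf.norm.pow 2).aestronglyMeasurable (Eventually.of_forall fun x => ?_)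
  rw [Real.norm_of_nonneg (by positivity)]
  exact h x

lemma J_eq_integral (m : MDP S A) (π : Policy S A d) (H : ℕ) (θ : Param d) :
    J m π H θ = ∫ τ, totalCost m τ ∂(trajLaw m π H θ) := by
  rw [J, integral_trajLaw]
  simp_rw [smul_eq_mul, mul_comm]

lemma abs_J_le {R : ℝ} (hR : 0 ≤ R) (hcost : BoundedCost m R) (H : ℕ) (θ : Param d) :
    |J m π H θ| ≤ R / (1 - m.discount) := by
  rw [J_eq_integral, ← Real.norm_eq_abs]
  refine (norm_integral_le_of_norm_le_const
    (Eventually.of_forall fun τ => abs_totalCost_le hR hcost τ)).trans ?_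
  simp

/-- The policy gradient theorem. -/
theorem hasGradientAt_J {H : ℕ} {R C : ℝ} (hR : 0 ≤ R) (hcost : BoundedCost m R)
    (hC : ScoreL2 m π H C) (θ : Param d) :
    HasGradientAt (J m π H) (∫ τ, gradEst m π τ θ ∂(trajLaw m π H θ)) θ := by
  have h1 := hasGradientAt_expectation_of_bounded hC (measurable_totalCost m H).stronglyMeasurable
    (abs_totalCost_le hR hcost) θ
  have h2 : J m π H = fun θ => ∫ τ, totalCost m τ ∂(trajLaw m π H θ) :=
    funext fun θ => J_eq_integral m π H θ
  rw [h2]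
  convert h1 using 1
  have hs : ∀ h, Integrable (fun τ => score π τ h θ) (trajLaw m π H θ) := fun h =>
    integrable_of_sq (stronglyMeasurable_score π h θ) (hC θ h).1
  have hi1 : ∀ h, Integrable (fun τ => totalCost m τ • score π τ h θ) (trajLaw m π H θ) :=
    fun h => integrable_mul_of_bounded_left (measurable_totalCost m H)
      (abs_totalCost_le hR hcost) (hs h)
  have hi2 : ∀ h, Integrable (fun τ => costToGo m τ h • score π τ h θ) (trajLaw m π H θ) :=
    fun h => integrable_mul_of_bounded_left (measurable_costToGo m h)
      (fun τ => abs_costToGo_le hR hcost τ h) (hs h)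
  have hi3 : ∀ h : Fin H, Integrable
      (fun τ => totalCost m (trunc h.2.le τ) • score π τ h θ) (trajLaw m π H θ) :=
    fun h => integrable_mul_of_bounded_left
      ((measurable_totalCost m h).comp (measurable_trunc h.2.le))
      (fun τ => abs_totalCost_le hR hcost (trunc h.2.le τ)) (hs h)
  simp_rw [gradEst_eq, totalScore, Finset.smul_sum]
  rw [integral_finsetSum _ fun h _ => hi2 h, integral_finsetSum _ fun h _ => hi1 h]
  refine Finset.sum_congr rfl fun h _ => ?_
  -- The total cost splits into the cost before step `h` and the cost-to-go; the former is a
  -- function of the past and is orthogonal to the score.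
  simp_rw [totalCost_eq_add m _ h, add_smul]
  rw [integral_add (hi3 h) (hi2 h), right_eq_add]
  refine integral_smul_score_eq_zero hC h (measurable_totalCost m h).stronglyMeasurable θ ?_
  refine Integrable.of_bound (((measurable_totalCost m h).comp
    (measurable_trunc h.2.le)).pow_const 2).aestronglyMeasurable ((R / (1 - m.discount)) ^ 2)
    (Eventually.of_forall fun τ => ?_)
  rw [Real.norm_of_nonneg (by positivity), ← sq_abs]
  have := abs_totalCost_le hR hcost (trunc h.2.le τ)
  gcongr

lemma ScoreL2.integrable_inner {H : ℕ} {C : ℝ} (hC : ScoreL2 m π H C) (θ : Param d)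
    (k h : Fin H) :
    Integrable (fun τ => inner ℝ (score π τ k θ) (score π τ h θ)) (trajLaw m π H θ) := by
  refine Integrable.mono' ((hC θ k).1.add (hC θ h).1)
    ((stronglyMeasurable_score π k θ).inner (stronglyMeasurable_score π h θ)).aestronglyMeasurable
    (Eventually.of_forall fun τ => ?_)
  rw [Pi.add_apply]
  refine (norm_inner_le_norm _ _).trans ?_
  nlinarith [sq_nonneg (‖score π τ k θ‖ - ‖score π τ h θ‖), sq_nonneg ‖score π τ k θ‖,
    sq_nonneg ‖score π τ h θ‖]

/-- The second moment of a partial sum of scores, which are pairwise orthogonal. -/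
lemma ScoreL2.integral_sq_sum_le {H : ℕ} {C : ℝ} (hC : ScoreL2 m π H C) (θ : Param d)
    (s : Finset (Fin H)) :
    Integrable (fun τ => ‖∑ h ∈ s, score π τ h θ‖ ^ 2) (trajLaw m π H θ) ∧
    ∫ τ, ‖∑ h ∈ s, score π τ h θ‖ ^ 2 ∂(trajLaw m π H θ) ≤ s.card * C := by
  have h1 : ∀ τ : Traj S A H, ‖∑ h ∈ s, score π τ h θ‖ ^ 2 =
      ∑ k ∈ s, ∑ h ∈ s, inner ℝ (score π τ k θ) (score π τ h θ) := fun τ => by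
    rw [← real_inner_self_eq_norm_sq, sum_inner]
    simp_rw [inner_sum]
  simp_rw [h1]
  refine ⟨integrable_finsetSum _ fun k _ => integrable_finsetSum _ fun h _ =>
    hC.integrable_inner θ k h, ?_⟩
  rw [integral_finsetSum _ fun k _ => integrable_finsetSum _ fun h _ => hC.integrable_inner θ k h]
  simp_rw [integral_finsetSum s fun h _ => hC.integrable_inner θ _ h]
  rw [← nsmul_eq_mul, ← Finset.sum_const]
  refine Finset.sum_le_sum fun k hk => ?_
  rw [Finset.sum_eq_single_of_mem k hk]
  · simp_rw [real_inner_self_eq_norm_sq]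
    exact (hC θ k).2
  · intro h _ hne
    rcases lt_or_gt_of_ne hne with hlt | hlt
    · rw [← integral_inner_score_eq_zero hC hlt θ]
      exact integral_congr_ae (Eventually.of_forall fun τ => real_inner_comm _ _)
    · exact integral_inner_score_eq_zero hC hlt θ

/-- The second moment of the gradient estimator. -/
theorem integral_sq_gradEst_le {H : ℕ} {R G : ℝ} (hcost : BoundedCost m R)
    (hC : ScoreL2 m π H (G ^ 2)) (θ : Param d) :
    Integrable (fun τ => ‖gradEst m π τ θ‖ ^ 2) (trajLaw m π H θ) ∧
    ∫ τ, ‖gradEst m π τ θ‖ ^ 2 ∂(trajLaw m π H θ) ≤ varGrad m.discount R G := by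
  have hγ := one_sub_discount_pos m
  have hγ0 := m.discount_nonneg
  set γ := m.discount with hγdef
  -- Cauchy-Schwarz with weights `γ ^ i` costs one factor `1 / (1 - γ)`. By orthogonality the
  -- partial sum up to `i` has second moment at most `(i + 1) * G ^ 2`, and summing these against `γ
  -- ^ i` costs two more.
  have hle : ∀ τ : Traj S A H, ‖gradEst m π τ θ‖ ^ 2 ≤
      R ^ 2 * (1 / (1 - γ)) * ∑ i : Fin H, γ ^ (i : ℕ) * ‖∑ h ∈ Finset.Iic i, score π τ h θ‖ ^ 2 := by
    intro τ
    have h1 : ‖gradEst m π τ θ‖ ≤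
        R * ∑ i : Fin H, γ ^ (i : ℕ) * ‖∑ h ∈ Finset.Iic i, score π τ h θ‖ := by
      rw [gradEst_eq_sum_cost, Finset.mul_sum]
      refine (norm_sum_le _ _).trans (Finset.sum_le_sum fun i _ => ?_)
      rw [norm_smul, norm_mul, Real.norm_of_nonneg (by positivity), Real.norm_eq_abs]
      have := hcost (τ i).1 (τ i).2
      calc γ ^ (i : ℕ) * |m.cost (τ i).1 (τ i).2| * ‖∑ h ∈ Finset.Iic i, score π τ h θ‖
          ≤ γ ^ (i : ℕ) * R * ‖∑ h ∈ Finset.Iic i, score π τ h θ‖ := by gcongr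
        _ = _ := by ring
    calc ‖gradEst m π τ θ‖ ^ 2
        ≤ (R * ∑ i : Fin H, γ ^ (i : ℕ) * ‖∑ h ∈ Finset.Iic i, score π τ h θ‖) ^ 2 := by gcongr
      _ = R ^ 2 * (∑ i : Fin H, γ ^ (i : ℕ) * ‖∑ h ∈ Finset.Iic i, score π τ h θ‖) ^ 2 := by ring
      _ ≤ R ^ 2 * ((∑ i : Fin H, γ ^ (i : ℕ)) *
            ∑ i : Fin H, γ ^ (i : ℕ) * ‖∑ h ∈ Finset.Iic i, score π τ h θ‖ ^ 2) := by
          gcongr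
          exact sq_sum_weighted_le _ _ _ fun i => by positivity
      _ ≤ R ^ 2 * (1 / (1 - γ) *
            ∑ i : Fin H, γ ^ (i : ℕ) * ‖∑ h ∈ Finset.Iic i, score π τ h θ‖ ^ 2) := by
          gcongr
          exact sum_pow_le hγ0 m.discount_lt_one H
      _ = _ := by ring
  have hbi : Integrable (fun τ => R ^ 2 * (1 / (1 - γ)) *
      ∑ i : Fin H, γ ^ (i : ℕ) * ‖∑ h ∈ Finset.Iic i, score π τ h θ‖ ^ 2) (trajLaw m π H θ) :=
    (integrable_finsetSum _ fun i _ => ((hC.integral_sq_sum_le θ _).1.const_mul _)).const_mul _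
  have hi := integrable_sq_of_sq_le (stronglyMeasurable_gradEst m π θ) hbi hle
  refine ⟨hi, (integral_mono hi hbi hle).trans ?_⟩
  rw [integral_const_mul, integral_finsetSum _ fun i _ =>
    (hC.integral_sq_sum_le θ _).1.const_mul _]
  simp_rw [integral_const_mul]
  calc R ^ 2 * (1 / (1 - γ)) * ∑ i : Fin H, γ ^ (i : ℕ) *
        ∫ τ, ‖∑ h ∈ Finset.Iic i, score π τ h θ‖ ^ 2 ∂(trajLaw m π H θ)
      ≤ R ^ 2 * (1 / (1 - γ)) * ∑ i : Fin H, γ ^ (i : ℕ) * (((i : ℕ) + 1 : ℝ) * G ^ 2) := by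
        gcongr with i _
        refine (hC.integral_sq_sum_le θ _).2.trans ?_
        simp
    _ = R ^ 2 * (1 / (1 - γ)) * ((∑ i : Fin H, (((i : ℕ) : ℝ) + 1) * γ ^ (i : ℕ)) * G ^ 2) := by
        rw [Finset.sum_mul]
        congr 1
        exact Finset.sum_congr rfl fun i _ => by ring
    _ ≤ R ^ 2 * (1 / (1 - γ)) * (1 / (1 - γ) ^ 2 * G ^ 2) := by
        gcongr
        exact sum_succ_mul_pow_le hγ0 m.discount_lt_one H
    _ = varGrad γ R G := by rw [varGrad]; field_simp

lemma fderiv_gradEst (m : MDP S A) (π : Policy S A d) {n : ℕ} (τ : Traj S A n) (θ : Param d) :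
    fderiv ℝ (gradEst m π τ) θ = ∑ h, costToGo m τ h • fderiv ℝ (score π τ h) θ := by
  have hd : ∀ h, DifferentiableAt ℝ (score π τ h) θ := fun h =>
    (contDiff_score π τ h).differentiable (by norm_num) θ
  have : gradEst m π τ = fun θ => ∑ h, costToGo m τ h • score π τ h θ := rfl
  rw [this]
  exact (HasFDerivAt.fun_sum fun h _ => (hd h).hasFDerivAt.const_smul (costToGo m τ h)).fderiv

/-- Write `K = R / (1 - γ)`. The derivative term is at most `K` times a discounted sum, the rank-one
term at most `K` times the squared sum of score norms. Squaring the sum of two terms gives the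
factor 2, which later turns 11 into 22; weighted Cauchy-Schwarz and the fourth-power mean inequality
do the rest. -/
lemma sq_norm_hessScore_le {R : ℝ} (hR : 0 ≤ R) (hcost : BoundedCost m R) {H : ℕ}
    (τ : Traj S A H) (θ : Param d) :
    ‖hessScore m π τ θ‖ ^ 2 ≤
      2 * ((R / (1 - m.discount)) ^ 2 * (1 / (1 - m.discount)) *
          ∑ h : Fin H, m.discount ^ (h : ℕ) * ‖fderiv ℝ (score π τ h) θ‖ ^ 2 +
        (R / (1 - m.discount)) ^ 2 * (H : ℝ) ^ 3 * ∑ h, ‖score π τ h θ‖ ^ 4) := by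
  have hγ := one_sub_discount_pos m
  have hγ0 := m.discount_nonneg
  have hK : 0 ≤ R / (1 - m.discount) := by positivity
  set K := R / (1 - m.discount) with hKdef
  have h1 : ‖fderiv ℝ (gradEst m π τ) θ‖ ≤
      K * ∑ h : Fin H, m.discount ^ (h : ℕ) * ‖fderiv ℝ (score π τ h) θ‖ := by
    rw [fderiv_gradEst, Finset.mul_sum]
    refine (norm_sum_le _ _).trans (Finset.sum_le_sum fun h _ => ?_)
    rw [norm_smul, Real.norm_eq_abs, ← mul_assoc]
    exact mul_le_mul_of_nonneg_right (abs_costToGo_le hR hcost τ h) (norm_nonneg _)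
  have h2 : ‖gradEst m π τ θ‖ ≤ K * ∑ h, ‖score π τ h θ‖ := by
    rw [gradEst_eq, Finset.mul_sum]
    refine (norm_sum_le _ _).trans (Finset.sum_le_sum fun h _ => ?_)
    rw [norm_smul, Real.norm_eq_abs]
    refine mul_le_mul_of_nonneg_right ((abs_costToGo_le hR hcost τ h).trans ?_) (norm_nonneg _)
    exact mul_le_of_le_one_right hK (pow_le_one₀ hγ0 m.discount_lt_one.le)
  have h3 : ‖totalScore π τ θ‖ ≤ ∑ h, ‖score π τ h θ‖ := norm_sum_le _ _
  have h4 : ‖hessScore m π τ θ‖ ≤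
      K * (∑ h : Fin H, m.discount ^ (h : ℕ) * ‖fderiv ℝ (score π τ h) θ‖) +
        K * (∑ h, ‖score π τ h θ‖) ^ 2 := by
    refine (norm_add_le _ _).trans (add_le_add h1 ?_)
    rw [ContinuousLinearMap.norm_smulRight_apply, innerSL_apply_norm]
    calc ‖totalScore π τ θ‖ * ‖gradEst m π τ θ‖
        ≤ (∑ h, ‖score π τ h θ‖) * (K * ∑ h, ‖score π τ h θ‖) := by gcongr
      _ = _ := by ring
  have h5 := sq_sum_weighted_le Finset.univ (fun h : Fin H => m.discount ^ (h : ℕ))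
    (fun h => ‖fderiv ℝ (score π τ h) θ‖) fun i => by positivity
  have h6 := fourth_pow_sum_le fun h : Fin H => ‖score π τ h θ‖
  rw [Fintype.card_fin] at h6
  have h7 := sum_pow_le hγ0 m.discount_lt_one H
  set x := ∑ h : Fin H, m.discount ^ (h : ℕ) * ‖fderiv ℝ (score π τ h) θ‖
  set y := ∑ h, ‖score π τ h θ‖
  calc ‖hessScore m π τ θ‖ ^ 2 ≤ (K * x + K * y ^ 2) ^ 2 := by gcongr
    _ ≤ 2 * (K ^ 2 * x ^ 2 + K ^ 2 * y ^ 4) := by nlinarith [sq_nonneg (K * x - K * y ^ 2)]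
    _ ≤ 2 * (K ^ 2 * (1 / (1 - m.discount) *
          ∑ h : Fin H, m.discount ^ (h : ℕ) * ‖fderiv ℝ (score π τ h) θ‖ ^ 2) +
        K ^ 2 * ((H : ℝ) ^ 3 * ∑ h, ‖score π τ h θ‖ ^ 4)) := by
        gcongr
        refine h5.trans ?_
        gcongr
    _ = _ := by ring

/-! ### Moment bounds from the assumptions; the policy Hessian theorem. -/

section ExpectedLS

variable {H : ℕ} {R G L : ℝ}

lemma ExpectedLS.score_fourth (hG : 0 < G) (hLS : ExpectedLS m π H G L) (θ : Param d)
    (h : Fin H) : Integrable (fun τ => ‖score π τ h θ‖ ^ 4) (trajLaw m π H θ) ∧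
      ∫ τ, ‖score π τ h θ‖ ^ 4 ∂(trajLaw m π H θ) ≤ G ^ 4 :=
  integrable_norm_pow_of_lintegral_le (stronglyMeasurable_score π h θ) 4 (by positivity)
    (hLS θ h).1

lemma ExpectedLS.fderiv_score_sq (hLS : ExpectedLS m π H G L) (θ : Param d)
    (h : Fin H) : Integrable (fun τ => ‖fderiv ℝ (score π τ h) θ‖ ^ 2) (trajLaw m π H θ) ∧
      ∫ τ, ‖fderiv ℝ (score π τ h) θ‖ ^ 2 ∂(trajLaw m π H θ) ≤ L ^ 2 :=
  integrable_norm_pow_of_lintegral_le (stronglyMeasurable_fderiv_score π h θ) 2 (by positivity)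
    (hLS θ h).2

lemma ExpectedLS.scoreL2 (hG : 0 < G) (hLS : ExpectedLS m π H G L) :
    ScoreL2 m π H (G ^ 2) := fun θ h =>
  integral_sq_le_of_integral_fourth_le (stronglyMeasurable_score π h θ) hG
    (hLS.score_fourth hG θ h).1 (hLS.score_fourth hG θ h).2

lemma integral_sq_hessScore_le (hR : 0 ≤ R) (hG : 0 < G) (hcost : BoundedCost m R)
    (hLS : ExpectedLS m π H G L) (θ : Param d) :
    Integrable (fun τ => ‖hessScore m π τ θ‖ ^ 2) (trajLaw m π H θ) ∧
    ∫ τ, ‖hessScore m π τ θ‖ ^ 2 ∂(trajLaw m π H θ) ≤ 2 * varHess m.discount R G L H := by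
  have hγ := one_sub_discount_pos m
  have hγ0 := m.discount_nonneg
  have hle := fun τ : Traj S A H => sq_norm_hessScore_le (π := π) hR hcost τ θ
  set K := R / (1 - m.discount) with hKdef
  have hi1 : Integrable (fun τ => K ^ 2 * (1 / (1 - m.discount)) *
      ∑ h : Fin H, m.discount ^ (h : ℕ) * ‖fderiv ℝ (score π τ h) θ‖ ^ 2) (trajLaw m π H θ) :=
    (integrable_finsetSum _ fun h _ => (hLS.fderiv_score_sq θ h).1.const_mul _).const_mul _
  have hi2 : Integrable (fun τ => K ^ 2 * (H : ℝ) ^ 3 * ∑ h, ‖score π τ h θ‖ ^ 4)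
      (trajLaw m π H θ) :=
    (integrable_finsetSum _ fun h _ => (hLS.score_fourth hG θ h).1).const_mul _
  have hbi := (hi1.add hi2).const_mul 2
  have hi := integrable_sq_of_sq_le (stronglyMeasurable_hessScore m π θ) hbi hle
  refine ⟨hi, (integral_mono hi hbi hle).trans ?_⟩
  rw [integral_const_mul]
  refine mul_le_mul_of_nonneg_left ?_ (by norm_num)
  simp only [Pi.add_apply]
  rw [integral_add hi1 hi2, integral_const_mul, integral_const_mul,
    integral_finsetSum _ fun h _ => (hLS.fderiv_score_sq θ h).1.const_mul _,
    integral_finsetSum _ fun h _ => (hLS.score_fourth hG θ h).1]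
  simp_rw [integral_const_mul]
  calc K ^ 2 * (1 / (1 - m.discount)) * ∑ h : Fin H, m.discount ^ (h : ℕ) *
          ∫ τ, ‖fderiv ℝ (score π τ h) θ‖ ^ 2 ∂(trajLaw m π H θ) +
        K ^ 2 * (H : ℝ) ^ 3 * ∑ h, ∫ τ, ‖score π τ h θ‖ ^ 4 ∂(trajLaw m π H θ)
      ≤ K ^ 2 * (1 / (1 - m.discount)) * ∑ h : Fin H, m.discount ^ (h : ℕ) * L ^ 2 +
        K ^ 2 * (H : ℝ) ^ 3 * ∑ _h : Fin H, G ^ 4 := by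
        gcongr with h _ h _
        · exact (hLS.fderiv_score_sq θ h).2
        · exact (hLS.score_fourth hG θ h).2
    _ = K ^ 2 * (1 / (1 - m.discount)) * ((∑ h : Fin H, m.discount ^ (h : ℕ)) * L ^ 2) +
        K ^ 2 * (H : ℝ) ^ 4 * G ^ 4 := by
        rw [Finset.sum_mul]
        simp
        ring
    _ ≤ K ^ 2 * (1 / (1 - m.discount)) * (1 / (1 - m.discount) * L ^ 2) +
        K ^ 2 * (H : ℝ) ^ 4 * G ^ 4 := by
        gcongr
        exact sum_pow_le hγ0 m.discount_lt_one H
    _ = varHess m.discount R G L H := by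
        rw [varHess, hKdef]
        field_simp
        ring

theorem integral_sq_hessEst_le (hR : 0 ≤ R) (hG : 0 < G) (hcost : BoundedCost m R)
    (hLS : ExpectedLS m π H G L) (θ : Param d) :
    Integrable (fun τ => ‖hessEst m π τ θ‖ ^ 2) (trajLaw m π H θ) ∧
    ∫ τ, ‖hessEst m π τ θ‖ ^ 2 ∂(trajLaw m π H θ) ≤ 2 * varHess m.discount R G L H := by
  have h : (fun τ => ‖hessEst m π τ θ‖ ^ 2) =ᵐ[trajLaw m π H θ]
      fun τ => ‖hessScore m π τ θ‖ ^ 2 := by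
    filter_upwards [hessEst_ae_eq m π H θ] with τ hτ
    rw [hτ]
  rw [integrable_congr h, integral_congr_ae h]
  exact integral_sq_hessScore_le hR hG hcost hLS θ

lemma gradient_J (hR : 0 ≤ R) (hG : 0 < G) (hcost : BoundedCost m R)
    (hLS : ExpectedLS m π H G L) (θ : Param d) :
    gradient (J m π H) θ = ∫ τ, gradEst m π τ θ ∂(trajLaw m π H θ) :=
  (hasGradientAt_J hR hcost (hLS.scoreL2 hG) θ).gradient

/-- The policy Hessian theorem. -/
theorem hasFDerivAt_gradient_J (hR : 0 ≤ R) (hG : 0 < G) (hcost : BoundedCost m R)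
    (hLS : ExpectedLS m π H G L) (θ : Param d) :
    HasFDerivAt (gradient (J m π H)) (∫ τ, hessEst m π τ θ ∂(trajLaw m π H θ)) θ := by
  rw [integral_congr_ae (hessEst_ae_eq m π H θ)]
  have hfun : gradient (J m π H) = fun θ => ∫ τ, gradEst m π τ θ ∂(trajLaw m π H θ) :=
    funext fun θ => gradient_J hR hG hcost hLS θ
  rw [hfun]
  refine hasFDerivAt_expectation m π (f := fun θ τ => gradEst m π τ θ)
    (L := fun θ τ => hessScore m π τ θ) (fun θ => stronglyMeasurable_hessScore m π θ)
    (fun τ => continuous_hessScore m π τ)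
    (fun θ => (integral_sq_hessScore_le hR hG hcost hLS θ).1)
    (fun θ => (integral_sq_hessScore_le hR hG hcost hLS θ).2)
    (fun θ => integrable_of_sq (stronglyMeasurable_gradEst m π θ)
      (integral_sq_gradEst_le hcost (hLS.scoreL2 hG) θ).1) (fun θ τ => ?_) θ
  -- The product rule for density times gradient estimator gives the density times both parts of
  -- `hessScore`.
  have h1 := (hasFDerivAt_density π τ θ).smul
    (((contDiff_gradEst m π τ).differentiable (by norm_num)) θ).hasFDerivAt
  refine h1.congr_fderiv ?_
  ext v : 1
  simp [hessScore, smul_add, smul_smul]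

lemma hess_J (hR : 0 ≤ R) (hG : 0 < G) (hcost : BoundedCost m R)
    (hLS : ExpectedLS m π H G L) (θ : Param d) :
    hess (J m π H) θ = ∫ τ, hessEst m π τ θ ∂(trajLaw m π H θ) :=
  (hasFDerivAt_gradient_J hR hG hcost hLS θ).fderiv

/-- Symmetry of second derivatives. It holds for the mean Hessian although a single estimate need
not be symmetric. -/
lemma inner_hess_J_comm (hR : 0 ≤ R) (hG : 0 < G) (hcost : BoundedCost m R)
    (hLS : ExpectedLS m π H G L) (θ v w : Param d) :
    inner ℝ (hess (J m π H) θ v) w = inner ℝ v (hess (J m π H) θ w) := by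
  have h1 : ∀ θ, HasFDerivAt (J m π H) (innerSL ℝ (gradient (J m π H) θ)) θ := fun θ => by
    rw [gradient_J hR hG hcost hLS θ]
    exact (hasGradientAt_J hR hcost (hLS.scoreL2 hG) θ).hasFDerivAt
  have h2 : HasFDerivAt (gradient (J m π H)) (hess (J m π H) θ) θ := by
    rw [hess_J hR hG hcost hLS θ]
    exact hasFDerivAt_gradient_J hR hG hcost hLS θ
  have h3 := ((innerSL ℝ : Param d →L⋆[ℝ] Param d →L[ℝ] ℝ)).hasFDerivAt.comp θ h2
  have h4 : inner ℝ (hess (J m π H) θ v) w = inner ℝ (hess (J m π H) θ w) v :=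
    second_derivative_symmetric h1 h3 v w
  rw [h4, real_inner_comm]

end ExpectedLS

end PolicyGradient

end SOPO

namespace SOPO

/-! ### Noncommutative Khintchine inequality by exchange of signs. -/

section Khintchine

variable {E : Type*} [NormedAddCommGroup E] [InnerProductSpace ℝ E]

/-- The trace of a continuous endomorphism. -/
noncomputable def opTrace (B : E →L[ℝ] E) : ℝ := LinearMap.trace ℝ E (B : E →ₗ[ℝ] E)

/-- Symmetry of a continuous endomorphism. -/
def IsSymm (B : E →L[ℝ] E) : Prop := ∀ x y, inner ℝ (B x) y = inner ℝ x (B y)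

lemma opTrace_eq {ι : Type*} [Fintype ι] (b : OrthonormalBasis ι ℝ E) (B : E →L[ℝ] E) :
    opTrace B = ∑ i, inner ℝ (b i) (B (b i)) :=
  LinearMap.trace_eq_sum_inner _ b

lemma opTrace_smul (c : ℝ) (B : E →L[ℝ] E) : opTrace (c • B) = c * opTrace B := by
  simp [opTrace]

lemma opTrace_sum {ι : Type*} (s : Finset ι) (B : ι → E →L[ℝ] E) :
    opTrace (∑ i ∈ s, B i) = ∑ i ∈ s, opTrace (B i) := by
  simp [opTrace]

lemma opTrace_sub (B C : E →L[ℝ] E) : opTrace (B - C) = opTrace B - opTrace C := by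
  simp [opTrace]

lemma IsSymm.smul {B : E →L[ℝ] E} (hB : IsSymm B) (c : ℝ) : IsSymm (c • B) := fun x y => by
  simp [real_inner_smul_left, real_inner_smul_right, hB x y]

lemma IsSymm.sub {B C : E →L[ℝ] E} (hB : IsSymm B) (hC : IsSymm C) : IsSymm (B - C) :=
  fun x y => by simp [inner_sub_left, inner_sub_right, hB x y, hC x y]

lemma IsSymm.sum {ι : Type*} (s : Finset ι) {B : ι → E →L[ℝ] E} (hB : ∀ i ∈ s, IsSymm (B i)) :
    IsSymm (∑ i ∈ s, B i) := fun x y => by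
  simp only [_root_.sum_apply, sum_inner, inner_sum]
  exact Finset.sum_congr rfl fun i hi => hB i hi x y

/-- The sign encoded by a Boolean. -/
def boolSign (b : Bool) : ℝ := if b then 1 else -1

lemma boolSign_not (b : Bool) : boolSign (!b) = -boolSign b := by cases b <;> simp [boolSign]

lemma boolSign_mul_self (b : Bool) : boolSign b * boolSign b = 1 := by cases b <;> simp [boolSign]

/-- The signed sum of a family of operators. -/
noncomputable def signedSum {n : ℕ} (A : Fin n → E →L[ℝ] E) (σ : Fin n → Bool) : E →L[ℝ] E :=
  ∑ i, boolSign (σ i) • A i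

/-- Flipping the sign of one coordinate. -/
def flipSign {n : ℕ} (i : Fin n) : Equiv.Perm (Fin n → Bool) :=
  Function.Involutive.toPerm (fun σ => Function.update σ i (!σ i)) fun σ => by simp

lemma flipSign_apply_self {n : ℕ} (i : Fin n) (σ : Fin n → Bool) : flipSign i σ i = !σ i :=
  Function.update_self _ _ _

lemma flipSign_apply_of_ne {n : ℕ} {i j : Fin n} (h : j ≠ i) (σ : Fin n → Bool) :
    flipSign i σ j = σ j :=
  Function.update_of_ne h _ _

lemma signedSum_sub_flip {n : ℕ} (A : Fin n → E →L[ℝ] E) (σ : Fin n → Bool) (i : Fin n) :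
    signedSum A σ - signedSum A (flipSign i σ) = (2 * boolSign (σ i)) • A i := by
  rw [signedSum, signedSum, ← Finset.sum_sub_distrib, Finset.sum_eq_single i]
  · rw [flipSign_apply_self, boolSign_not]
    rw [← sub_smul]; congr 1; ring
  · intro j _ hj
    rw [flipSign_apply_of_ne hj, sub_self]
  · simp

lemma isSymm_signedSum {n : ℕ} {A : Fin n → E →L[ℝ] E} (hA : ∀ i, IsSymm (A i))
    (σ : Fin n → Bool) : IsSymm (signedSum A σ) :=
  IsSymm.sum _ fun i _ => (hA i).smul _

lemma norm_sq_le_of_eigenvalues_sq_le {ι : Type*} [Fintype ι] {Y : E →L[ℝ] E}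
    {u : OrthonormalBasis (ι) ℝ E} {l : ι → ℝ}
    (h : ∀ i, ∀ k : ℕ, (Y ^ k) (u i) = l i ^ k • u i) {r : ℝ} (hr : 0 ≤ r)
    (hl : ∀ i, l i ^ 2 ≤ r) : ‖Y‖ ^ 2 ≤ r := by
  have hx : ∀ x, ‖Y x‖ ^ 2 ≤ r * ‖x‖ ^ 2 := fun x => by
    have h1 : Y x = ∑ i, (inner ℝ (u i) x * l i) • u i := by
      conv_lhs => rw [← u.sum_repr' x]
      rw [map_sum]
      refine Finset.sum_congr rfl fun i _ => ?_
      have := h i 1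
      rw [pow_one, pow_one] at this
      rw [map_smul, this, smul_smul]
    rw [h1, ← real_inner_self_eq_norm_sq, u.orthonormal.inner_sum,
      ← u.sum_sq_norm_inner_right x, Finset.mul_sum]
    refine Finset.sum_le_sum fun i _ => ?_
    simp only [conj_trivial, Real.norm_eq_abs, sq_abs]
    nlinarith [mul_le_mul_of_nonneg_right (hl i) (sq_nonneg (inner ℝ (u i) x))]
  have h2 : ‖Y‖ ≤ Real.sqrt r := by
    refine ContinuousLinearMap.opNorm_le_bound _ (Real.sqrt_nonneg r) fun x => ?_
    rw [← Real.sqrt_sq (norm_nonneg x), ← Real.sqrt_mul hr]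
    exact Real.le_sqrt_of_sq_le (hx x)
  calc ‖Y‖ ^ 2 ≤ Real.sqrt r ^ 2 := by gcongr
    _ = r := Real.sq_sqrt hr

lemma opTrace_pow_eq {Y : E →L[ℝ] E}
    {u : OrthonormalBasis (Fin (Module.finrank ℝ E)) ℝ E} {l : Fin (Module.finrank ℝ E) → ℝ}
    (h : ∀ i, ∀ k : ℕ, (Y ^ k) (u i) = l i ^ k • u i) (k : ℕ) :
    opTrace (Y ^ k) = ∑ i, l i ^ k := by
  rw [opTrace_eq u]
  refine Finset.sum_congr rfl fun i _ => ?_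
  rw [h, real_inner_smul_right, real_inner_self_eq_norm_sq, u.norm_eq_one]
  simp

/-- Expanding in eigenbases of both `Y` and `Z` gives nonnegative weights times scalar monomials, so
trace inequalities reduce to inequalities between real numbers even though `Y` and `Z` need not
commute. -/
lemma opTrace_mul_pow_mul_pow {A Y Z : E →L[ℝ] E} (hA : IsSymm A)
    {u v : OrthonormalBasis (Fin (Module.finrank ℝ E)) ℝ E}
    {l μ : Fin (Module.finrank ℝ E) → ℝ}
    (hu : ∀ i, ∀ k : ℕ, (Y ^ k) (u i) = l i ^ k • u i)
    (hv : ∀ i, ∀ k : ℕ, (Z ^ k) (v i) = μ i ^ k • v i) (k j : ℕ) :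
    opTrace (A * (Y ^ k * A * Z ^ j)) =
      ∑ b, ∑ a, inner ℝ (u a) (A (v b)) ^ 2 * (l a ^ k * μ b ^ j) := by
  have hYk : ∀ x, (Y ^ k) x = ∑ a, (inner ℝ (u a) x * l a ^ k) • u a := fun x => by
    conv_lhs => rw [← u.sum_repr' x]
    rw [map_sum]
    exact Finset.sum_congr rfl fun i _ => by rw [map_smul, hu, smul_smul]
  rw [opTrace_eq v]
  refine Finset.sum_congr rfl fun b _ => ?_
  rw [mul_apply_eq_comp, mul_apply_eq_comp, mul_apply_eq_comp,
    hv, map_smul, map_smul, map_smul, real_inner_smul_right, ← hA, hYk, inner_sum, Finset.mul_sum]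
  refine Finset.sum_congr rfl fun a _ => ?_
  rw [real_inner_smul_right, real_inner_comm]
  ring

variable [FiniteDimensional ℝ E]

lemma opTrace_one : opTrace (1 : E →L[ℝ] E) = Module.finrank ℝ E := by
  rw [opTrace, ContinuousLinearMap.toLinearMap_one]; exact LinearMap.trace_one ℝ E

lemma IsSymm.exists_eigenbasis {Y : E →L[ℝ] E} (hY : IsSymm Y) :
    ∃ (u : OrthonormalBasis (Fin (Module.finrank ℝ E)) ℝ E) (l : Fin (Module.finrank ℝ E) → ℝ),
      ∀ i, ∀ k : ℕ, (Y ^ k) (u i) = l i ^ k • u i := by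
  have hs : (Y : E →ₗ[ℝ] E).IsSymmetric := hY
  refine ⟨hs.eigenvectorBasis rfl, hs.eigenvalues rfl, fun i k => ?_⟩
  induction k with
  | zero => simp
  | succ k ih =>
    have h1 : Y (hs.eigenvectorBasis rfl i) =
        hs.eigenvalues rfl i • hs.eigenvectorBasis rfl i := hs.apply_eigenvectorBasis rfl i
    rw [pow_succ, mul_apply_eq_comp, h1, map_smul, ih, smul_smul, pow_succ, mul_comm]

/-- The operator norm of a symmetric operator is bounded by its even Schatten norms. -/
lemma IsSymm.norm_pow_le_opTrace {Y : E →L[ℝ] E} (hY : IsSymm Y) {q : ℕ} (hq : q ≠ 0) :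
    ‖Y‖ ^ (2 * q) ≤ opTrace (Y ^ (2 * q)) := by
  obtain ⟨u, l, h⟩ := hY.exists_eigenbasis
  rw [opTrace_pow_eq h]
  have h0 : ∀ i, 0 ≤ l i ^ (2 * q) := fun i => by rw [pow_mul]; positivity
  rcases isEmpty_or_nonempty (Fin (Module.finrank ℝ E)) with he | he
  · have := norm_sq_le_of_eigenvalues_sq_le h le_rfl fun i => he.elim i
    have h1 : ‖Y‖ = 0 := by nlinarith [norm_nonneg Y]
    rw [h1, zero_pow (by omega)]
    exact Finset.sum_nonneg fun i _ => h0 i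
  · obtain ⟨j, hj⟩ := Finite.exists_max fun i => l i ^ 2
    calc ‖Y‖ ^ (2 * q) = (‖Y‖ ^ 2) ^ q := pow_mul _ _ _
      _ ≤ (l j ^ 2) ^ q := by
          exact pow_le_pow_left₀ (sq_nonneg _)
            (norm_sq_le_of_eigenvalues_sq_le h (sq_nonneg _) hj) q
      _ = l j ^ (2 * q) := (pow_mul _ _ _).symm
      _ ≤ ∑ i, l i ^ (2 * q) := Finset.single_le_sum (fun i _ => h0 i) (Finset.mem_univ j)

/-- Rearrangement: `|a| ^ k - |b| ^ k` and `|a| ^ l - |b| ^ l` have the same sign. Evenness of the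
exponent allows passing to absolute values. -/
lemma pow_mul_pow_add_le {a b : ℝ} {m k : ℕ} (hm : Even m) (hk : k ≤ m) :
    a ^ k * b ^ (m - k) + a ^ (m - k) * b ^ k ≤ a ^ m + b ^ m := by
  obtain ⟨l, rfl⟩ := Nat.exists_eq_add_of_le hk
  rw [Nat.add_sub_cancel_left]
  have h1 : a ^ (k + l) = |a| ^ k * |a| ^ l := by rw [← pow_add, hm.pow_abs]
  have h2 : b ^ (k + l) = |b| ^ k * |b| ^ l := by rw [← pow_add, hm.pow_abs]
  have h3 : a ^ k * b ^ l ≤ |a| ^ k * |b| ^ l := by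
    rw [← abs_pow, ← abs_pow, ← abs_mul]; exact le_abs_self _
  have h4 : a ^ l * b ^ k ≤ |a| ^ l * |b| ^ k := by
    rw [← abs_pow, ← abs_pow, ← abs_mul]; exact le_abs_self _
  have h5 : 0 ≤ (|a| ^ k - |b| ^ k) * (|a| ^ l - |b| ^ l) := by
    rcases le_total |a| |b| with h | h
    · exact mul_nonneg_of_nonpos_of_nonpos
        (sub_nonpos.2 (pow_le_pow_left₀ (abs_nonneg _) h _))
        (sub_nonpos.2 (pow_le_pow_left₀ (abs_nonneg _) h _))
    · exact mul_nonneg (sub_nonneg.2 (pow_le_pow_left₀ (abs_nonneg _) h _))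
        (sub_nonneg.2 (pow_le_pow_left₀ (abs_nonneg _) h _))
  rw [h1, h2]
  nlinarith

lemma sum_pow_mul_pow_le {a b : ℝ} {m : ℕ} (hm : Even m) :
    2 * ∑ k ∈ Finset.range (m + 1), a ^ k * b ^ (m - k) ≤ (m + 1) * (a ^ m + b ^ m) := by
  have h1 : ∑ k ∈ Finset.range (m + 1), a ^ k * b ^ (m - k) =
      ∑ k ∈ Finset.range (m + 1), a ^ (m - k) * b ^ k := by
    rw [← Finset.sum_range_reflect]
    refine Finset.sum_congr rfl fun k hk => ?_
    have := Finset.mem_range.1 hk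
    congr 2; omega
  calc 2 * ∑ k ∈ Finset.range (m + 1), a ^ k * b ^ (m - k)
      = ∑ k ∈ Finset.range (m + 1), (a ^ k * b ^ (m - k) + a ^ (m - k) * b ^ k) := by
        rw [Finset.sum_add_distrib, ← h1, two_mul]
    _ ≤ ∑ _k ∈ Finset.range (m + 1), (a ^ m + b ^ m) :=
        Finset.sum_le_sum fun k hk => pow_mul_pow_add_le hm (by
          have := Finset.mem_range.1 hk; omega)
    _ = (m + 1) * (a ^ m + b ^ m) := by simp; ring

lemma pow_sub_pow_eq_sum {R : Type*} [Ring R] (y z : R) (m : ℕ) :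
    y ^ (m + 1) - z ^ (m + 1) = ∑ k ∈ Finset.range (m + 1), y ^ k * (y - z) * z ^ (m - k) := by
  induction m with
  | zero => simp
  | succ m ih =>
    have h1 : y ^ (m + 2) - z ^ (m + 2) =
        (y ^ (m + 1) - z ^ (m + 1)) * z + y ^ (m + 1) * (y - z) := by
      rw [pow_succ y (m + 1), pow_succ z (m + 1)]; noncomm_ring
    rw [h1, ih, Finset.sum_range_succ _ (m + 1), Finset.sum_mul]
    congr 1
    · refine Finset.sum_congr rfl fun k hk => ?_
      have := Finset.mem_range.1 hk
      rw [mul_assoc, ← pow_succ]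
      congr 2; omega
    · simp

/-- A trace form of the arithmetic-geometric mean inequality. -/
lemma two_mul_sum_opTrace_le {A Y Z : E →L[ℝ] E} (hA : IsSymm A) (hY : IsSymm Y) (hZ : IsSymm Z)
    {m : ℕ} (hm : Even m) :
    2 * ∑ k ∈ Finset.range (m + 1), opTrace (A * (Y ^ k * A * Z ^ (m - k))) ≤
      (m + 1) * (‖A‖ ^ 2 * opTrace (Y ^ m) + ‖A‖ ^ 2 * opTrace (Z ^ m)) := by
  obtain ⟨u, l, hu⟩ := hY.exists_eigenbasis
  obtain ⟨v, μ, hv⟩ := hZ.exists_eigenbasis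
  simp_rw [opTrace_mul_pow_mul_pow hA hu hv, opTrace_pow_eq hu, opTrace_pow_eq hv]
  have h1 : ∑ k ∈ Finset.range (m + 1), ∑ b, ∑ a,
      inner ℝ (u a) (A (v b)) ^ 2 * (l a ^ k * μ b ^ (m - k)) =
      ∑ b, ∑ a, inner ℝ (u a) (A (v b)) ^ 2 *
        ∑ k ∈ Finset.range (m + 1), l a ^ k * μ b ^ (m - k) := by
    rw [Finset.sum_comm]
    refine Finset.sum_congr rfl fun b _ => ?_
    rw [Finset.sum_comm]
    exact Finset.sum_congr rfl fun a _ => (Finset.mul_sum _ _ _).symm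
  have h2 : 2 * ∑ b, ∑ a, inner ℝ (u a) (A (v b)) ^ 2 *
        ∑ k ∈ Finset.range (m + 1), l a ^ k * μ b ^ (m - k) ≤
      ∑ b, ∑ a, inner ℝ (u a) (A (v b)) ^ 2 * ((m + 1) * (l a ^ m + μ b ^ m)) := by
    rw [Finset.mul_sum]
    refine Finset.sum_le_sum fun b _ => ?_
    rw [Finset.mul_sum]
    refine Finset.sum_le_sum fun a _ => ?_
    rw [mul_left_comm]
    exact mul_le_mul_of_nonneg_left (sum_pow_mul_pow_le hm) (sq_nonneg _)
  have hnorm : ∀ w : OrthonormalBasis (Fin (Module.finrank ℝ E)) ℝ E, ∀ i,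
      ‖A (w i)‖ ^ 2 ≤ ‖A‖ ^ 2 := fun w i => by
    have := A.le_opNorm (w i)
    rw [w.norm_eq_one, mul_one] at this
    gcongr
  -- By Parseval the weights in each row sum to `‖A (u a)‖ ^ 2`, at most `‖A‖ ^ 2`; the columns are
  -- treated likewise below.
  have hl : ∑ b, ∑ a, inner ℝ (u a) (A (v b)) ^ 2 * l a ^ m ≤ ‖A‖ ^ 2 * ∑ a, l a ^ m := by
    rw [Finset.sum_comm, Finset.mul_sum]
    refine Finset.sum_le_sum fun a _ => ?_
    rw [← Finset.sum_mul]
    refine mul_le_mul_of_nonneg_right ?_ (hm.pow_nonneg _)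
    refine le_trans (le_of_eq ?_) (hnorm u a)
    rw [← v.sum_sq_norm_inner_left]
    refine Finset.sum_congr rfl fun b _ => ?_
    rw [Real.norm_eq_abs, sq_abs, hA]
  have hμ : ∑ b, ∑ a, inner ℝ (u a) (A (v b)) ^ 2 * μ b ^ m ≤ ‖A‖ ^ 2 * ∑ b, μ b ^ m := by
    rw [Finset.mul_sum]
    refine Finset.sum_le_sum fun b _ => ?_
    rw [← Finset.sum_mul]
    refine mul_le_mul_of_nonneg_right ?_ (hm.pow_nonneg _)
    refine le_trans (le_of_eq ?_) (hnorm v b)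
    rw [← u.sum_sq_norm_inner_right]
    exact Finset.sum_congr rfl fun b _ => by rw [Real.norm_eq_abs, sq_abs]
  rw [h1]
  refine h2.trans ?_
  have h3 : ∑ b, ∑ a, inner ℝ (u a) (A (v b)) ^ 2 * ((m + 1) * (l a ^ m + μ b ^ m)) =
      (m + 1) * (∑ b, ∑ a, inner ℝ (u a) (A (v b)) ^ 2 * l a ^ m +
        ∑ b, ∑ a, inner ℝ (u a) (A (v b)) ^ 2 * μ b ^ m) := by
    simp_rw [← Finset.sum_add_distrib, Finset.mul_sum]
    exact Finset.sum_congr rfl fun b _ => Finset.sum_congr rfl fun a _ => by ring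
  rw [h3]
  gcongr

/-- A discrete integration by parts. Averaging with the flipped sign replaces the power by a
difference of powers of two operators that differ by `2 * boolSign (σ i)` times `A i`; telescoping
produces a second factor `A i`, and the two signs multiply to 1. -/
lemma sum_sign_opTrace_le {n : ℕ} {A : Fin n → E →L[ℝ] E} (hA : ∀ i, IsSymm (A i)) {m : ℕ}
    (hm : Even m) (i : Fin n) :
    ∑ σ, boolSign (σ i) * opTrace (A i * signedSum A σ ^ (m + 1)) ≤
      (m + 1) * ‖A i‖ ^ 2 * ∑ σ, opTrace (signedSum A σ ^ m) := by
  set s := ∑ σ, boolSign (σ i) * opTrace (A i * signedSum A σ ^ (m + 1)) with hs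
  have h1 : s = ∑ σ, -boolSign (σ i) * opTrace (A i * signedSum A (flipSign i σ) ^ (m + 1)) := by
    rw [hs, ← Equiv.sum_comp (flipSign i)]
    refine Finset.sum_congr rfl fun σ _ => ?_
    rw [flipSign_apply_self, boolSign_not]
  have h2 : 2 * s = ∑ σ, 2 * ∑ k ∈ Finset.range (m + 1), opTrace
      (A i * (signedSum A σ ^ k * A i * signedSum A (flipSign i σ) ^ (m - k))) := by
    rw [two_mul]
    nth_rewrite 2 [h1]
    rw [hs, ← Finset.sum_add_distrib]
    refine Finset.sum_congr rfl fun σ _ => ?_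
    rw [neg_mul, ← sub_eq_add_neg, ← mul_sub, ← opTrace_sub, ← mul_sub, pow_sub_pow_eq_sum,
      Finset.mul_sum (s := Finset.range (m + 1)) (a := A i), opTrace_sum, Finset.mul_sum,
      Finset.mul_sum]
    refine Finset.sum_congr rfl fun k _ => ?_
    rw [signedSum_sub_flip, mul_smul_comm, smul_mul_assoc, mul_smul_comm, opTrace_smul,
      ← mul_assoc]
    congr 1
    linear_combination 2 * boolSign_mul_self (σ i)
  have h3 : 2 * s ≤ ∑ σ, (m + 1) * (‖A i‖ ^ 2 * opTrace (signedSum A σ ^ m) +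
      ‖A i‖ ^ 2 * opTrace (signedSum A (flipSign i σ) ^ m)) := by
    rw [h2]
    exact Finset.sum_le_sum fun σ _ => two_mul_sum_opTrace_le (hA i) (isSymm_signedSum hA _)
      (isSymm_signedSum hA _) hm
  have h4 : ∑ σ, opTrace (signedSum A (flipSign i σ) ^ m) = ∑ σ, opTrace (signedSum A σ ^ m) :=
    Equiv.sum_comp (flipSign i) fun σ => opTrace (signedSum A σ ^ m)
  rw [← Finset.mul_sum, Finset.sum_add_distrib, ← Finset.mul_sum, ← Finset.mul_sum, h4] at h3
  linarith

/-- Splitting one factor off the power exposes a sign times `A i`, the form to which the exchange of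
signs applies. Iteration generates the product of odd numbers. -/
lemma sum_opTrace_pow_succ_le {n : ℕ} {A : Fin n → E →L[ℝ] E} (hA : ∀ i, IsSymm (A i)) (q : ℕ) :
    ∑ σ, opTrace (signedSum A σ ^ (2 * (q + 1))) ≤
      (2 * q + 1) * (∑ i, ‖A i‖ ^ 2) * ∑ σ, opTrace (signedSum A σ ^ (2 * q)) := by
  have h1 : ∑ σ, opTrace (signedSum A σ ^ (2 * (q + 1))) =
      ∑ i, ∑ σ, boolSign (σ i) * opTrace (A i * signedSum A σ ^ (2 * q + 1)) := by
    rw [Finset.sum_comm]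
    refine Finset.sum_congr rfl fun σ _ => ?_
    rw [show 2 * (q + 1) = 2 * q + 1 + 1 by ring, pow_succ']
    nth_rewrite 1 [signedSum]
    rw [Finset.sum_mul, opTrace_sum]
    exact Finset.sum_congr rfl fun i _ => by rw [smul_mul_assoc, opTrace_smul]
  rw [h1, Finset.mul_sum (s := Finset.univ) (f := fun i => ‖A i‖ ^ 2), Finset.sum_mul]
  refine Finset.sum_le_sum fun i _ => ?_
  refine (sum_sign_opTrace_le hA (even_two_mul q) i).trans (le_of_eq ?_)
  push_cast; ring

/-- The noncommutative Khintchine inequality for even Schatten norms. -/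
lemma sum_opTrace_pow_le {n : ℕ} {A : Fin n → E →L[ℝ] E} (hA : ∀ i, IsSymm (A i)) (q : ℕ) :
    ∑ σ, opTrace (signedSum A σ ^ (2 * q)) ≤
      2 ^ n * ((∏ j ∈ Finset.range q, (2 * (j : ℝ) + 1)) * Module.finrank ℝ E) *
        (∑ i, ‖A i‖ ^ 2) ^ q := by
  induction q with
  | zero => simp [opTrace_one]
  | succ q ih =>
    refine (sum_opTrace_pow_succ_le hA q).trans ?_
    have h0 : 0 ≤ ∑ i, ‖A i‖ ^ 2 := Finset.sum_nonneg fun i _ => by positivity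
    calc (2 * (q : ℝ) + 1) * (∑ i, ‖A i‖ ^ 2) * ∑ σ, opTrace (signedSum A σ ^ (2 * q))
        ≤ (2 * (q : ℝ) + 1) * (∑ i, ‖A i‖ ^ 2) * (2 ^ n *
          ((∏ j ∈ Finset.range q, (2 * (j : ℝ) + 1)) * Module.finrank ℝ E) *
            (∑ i, ‖A i‖ ^ 2) ^ q) := by gcongr
      _ = _ := by rw [Finset.prod_range_succ]; ring

/-- The noncommutative Khintchine inequality for the operator norm. -/
theorem sum_sq_norm_signedSum_le {n : ℕ} {A : Fin n → E →L[ℝ] E} (hA : ∀ i, IsSymm (A i))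
    {q : ℕ} (hq : q ≠ 0) {c : ℝ} (hc : 0 ≤ c)
    (hqc : (∏ j ∈ Finset.range q, (2 * (j : ℝ) + 1)) * Module.finrank ℝ E ≤ c ^ q) :
    ∑ σ, ‖signedSum A σ‖ ^ 2 ≤ 2 ^ n * (c * ∑ i, ‖A i‖ ^ 2) := by
  have h0 : 0 ≤ ∑ i, ‖A i‖ ^ 2 := Finset.sum_nonneg fun i _ => by positivity
  have hcard : (Fintype.card (Fin n → Bool) : ℝ) = 2 ^ n := by simp
  -- Jensen's inequality over the signs passes from the `2 * q`-th moment, which traces control, to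
  -- the second moment. The dimension enters only through a `q`-th root.
  have h1 := Real.pow_arith_mean_le_arith_mean_pow Finset.univ
    (fun _ : Fin n → Bool => (1 / 2 ^ n : ℝ)) (fun σ => ‖signedSum A σ‖ ^ 2)
    (fun _ _ => by positivity) (by simp) (fun _ _ => by positivity) q
  rw [← Finset.mul_sum, ← Finset.mul_sum] at h1
  have h2 : ∑ σ, (‖signedSum A σ‖ ^ 2) ^ q ≤ 2 ^ n * (c * ∑ i, ‖A i‖ ^ 2) ^ q := by
    calc ∑ σ, (‖signedSum A σ‖ ^ 2) ^ q ≤ ∑ σ, opTrace (signedSum A σ ^ (2 * q)) := by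
          refine Finset.sum_le_sum fun σ _ => ?_
          rw [← pow_mul]
          exact (isSymm_signedSum hA σ).norm_pow_le_opTrace hq
      _ ≤ _ := sum_opTrace_pow_le hA q
      _ ≤ 2 ^ n * c ^ q * (∑ i, ‖A i‖ ^ 2) ^ q := by gcongr
      _ = _ := by rw [mul_pow]; ring
  have h3 : (1 / 2 ^ n * ∑ σ, ‖signedSum A σ‖ ^ 2) ^ q ≤ (c * ∑ i, ‖A i‖ ^ 2) ^ q := by
    refine h1.trans ?_
    rw [one_div, inv_mul_le_iff₀ (by positivity)]
    exact h2
  have h4 := le_of_pow_le_pow_left₀ hq (by positivity) h3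
  rwa [one_div, inv_mul_le_iff₀ (by positivity)] at h4

end Khintchine

end SOPO

namespace SOPO

/-! ### Choice of the moment order; the constant 11. -/

section LogDimension

lemma one_add_pow_ge {x : ℝ} (hx : 0 ≤ x) (q : ℕ) :
    1 + q * x + q * (q - 1) / 2 * x ^ 2 ≤ (1 + x) ^ q := by
  induction q with
  | zero => simp
  | succ q ih =>
    rw [pow_succ]
    refine le_trans ?_ (mul_le_mul_of_nonneg_right ih (by linarith))
    push_cast
    have h1 : 0 ≤ (q : ℝ) * (q - 1) := by
      rcases Nat.eq_zero_or_pos q with rfl | h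
      · simp
      · have : (1 : ℝ) ≤ q := by exact_mod_cast h
        exact mul_nonneg (by linarith) (by linarith)
    nlinarith [mul_nonneg h1 (pow_nonneg hx 3)]

lemma prod_odd_le {q : ℕ} (hq : 5 ≤ q) :
    ∏ j ∈ Finset.range q, (2 * (j : ℝ) + 1) ≤ (4 / 5 * q) ^ q := by
  induction q, hq using Nat.le_induction with
  | base => norm_num [Finset.prod_range_succ]
  | succ q hq ih =>
    have hq' : (5 : ℝ) ≤ q := by exact_mod_cast hq
    -- Three binomial terms suffice: they bound `(1 + 1 / q) ^ q` below by `5 / 2 - 1 / (2 * q)`,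
    -- enough for the ratio of consecutive bounds to absorb the factor `2 * q + 1`.
    have h1 := one_add_pow_ge (x := 1 / (q : ℝ)) (by positivity) q
    have h2 : 1 + (q : ℝ) * (1 / q) + q * (q - 1) / 2 * (1 / (q : ℝ)) ^ 2 =
        5 / 2 - 1 / (2 * q) := by
      field_simp; ring
    rw [h2] at h1
    have h3 : (2 * (q : ℝ) + 1) ≤ 4 / 5 * (q + 1) * (1 + 1 / (q : ℝ)) ^ q := by
      refine le_trans ?_ (mul_le_mul_of_nonneg_left h1 (by positivity))
      have : 1 / (2 * (q : ℝ)) * (q + 1) ≤ 3 / 5 := by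
        rw [div_mul_eq_mul_div, div_le_iff₀ (by positivity)]; linarith
      nlinarith
    have h4 : (4 / 5 * ((q + 1 : ℕ) : ℝ)) ^ (q + 1) =
        (4 / 5 * q) ^ q * (4 / 5 * (q + 1) * (1 + 1 / (q : ℝ)) ^ q) := by
      have : (4 / 5 * ((q + 1 : ℕ) : ℝ)) = 4 / 5 * q * (1 + 1 / (q : ℝ)) := by
        push_cast; field_simp
      rw [pow_succ, this, mul_pow]
      field_simp
    rw [Finset.prod_range_succ, h4]
    gcongr

lemma le_eleven_log {d : ℕ} (h2 : 2 ≤ d) (h31 : d ≤ 31) : (d : ℝ) ≤ 11 * Real.log d := by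
  have hl := Real.log_two_gt_d9
  have hpow : ∀ k : ℕ, 2 ^ k ≤ d → k * Real.log 2 ≤ Real.log d := fun k hk => by
    rw [← Real.log_pow]
    exact Real.log_le_log (by positivity) (by exact_mod_cast hk)
  -- The break points compare `d` with powers of 2: 11 log 2 > 7, 33 log 2 > 22, and from 23² ≥ 2⁹
  -- the last range has 11 log d ≥ 49.5 log 2 > 31.
  rcases lt_or_ge d 8 with h | h
  · have h1 := hpow 1 (by simpa using h2)
    have : (d : ℝ) ≤ 7 := by exact_mod_cast Nat.lt_succ_iff.1 h
    push_cast at h1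
    linarith
  rcases lt_or_ge d 23 with h' | h'
  · have h1 := hpow 3 (by simpa using h)
    have : (d : ℝ) ≤ 22 := by exact_mod_cast Nat.lt_succ_iff.1 h'
    push_cast at h1
    linarith
  · have h1 : (9 : ℕ) * Real.log 2 ≤ (2 : ℕ) * Real.log d := by
      rw [← Real.log_pow, ← Real.log_pow]
      refine Real.log_le_log (by positivity) ?_
      have : 512 ≤ d ^ 2 := by nlinarith
      have h3 : (512 : ℝ) ≤ (d : ℝ) ^ 2 := by exact_mod_cast this
      norm_num at h3 ⊢
      exact h3
    have : (d : ℝ) ≤ 31 := by exact_mod_cast h31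
    push_cast at h1
    linarith

lemma exists_moment_order {d : ℕ} (hd : 32 ≤ d) :
    ∃ q : ℕ, q ≠ 0 ∧
      (∏ j ∈ Finset.range q, (2 * (j : ℝ) + 1)) * d ≤ (11 / 4 * Real.log d) ^ q := by
  have hd' : (32 : ℝ) ≤ d := by exact_mod_cast hd
  have hl : 5 * Real.log 2 ≤ Real.log d := by
    have : (5 : ℕ) * Real.log 2 ≤ Real.log d := by
      rw [← Real.log_pow]
      exact Real.log_le_log (by positivity) (by norm_num; exact hd)
    exact_mod_cast this
  have hl2 := Real.log_two_gt_d9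
  have he := Real.exp_one_lt_d9
  have hexp : (d : ℝ) = Real.exp (Real.log d) := (Real.exp_log (by linarith)).symm
  rcases le_or_gt (Real.log d) 4 with h4 | h4
  · refine ⟨4, by norm_num, ?_⟩
    have h1 : (d : ℝ) ≤ 55 := by
      rw [hexp]
      calc Real.exp (Real.log d) ≤ Real.exp 4 := Real.exp_le_exp.2 h4
        _ = Real.exp 1 ^ 4 := by rw [← Real.exp_nat_mul]; norm_num
        _ ≤ 2.7182818286 ^ 4 := by gcongr
        _ ≤ 55 := by norm_num
    have h2 : (9 : ℝ) ≤ 11 / 4 * Real.log d := by linarith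
    calc (∏ j ∈ Finset.range 4, (2 * (j : ℝ) + 1)) * d = 105 * d := by
          norm_num [Finset.prod_range_succ]
      _ ≤ 9 ^ 4 := by linarith
      _ ≤ (11 / 4 * Real.log d) ^ 4 := by gcongr
  · have hq1 := Nat.le_ceil (Real.log d)
    have hq2 := Nat.ceil_lt_add_one (a := Real.log d) (by linarith)
    have hq5 : 5 ≤ ⌈Real.log d⌉₊ := by
      have : (4 : ℝ) < ⌈Real.log d⌉₊ := h4.trans_le hq1
      exact_mod_cast this
    generalize ⌈Real.log d⌉₊ = q at hq1 hq2 hq5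
    have hq5' : (5 : ℝ) ≤ q := by exact_mod_cast hq5
    refine ⟨q, by omega, ?_⟩
    have h1 : (d : ℝ) ≤ Real.exp 1 ^ q := by
      rw [hexp, ← Real.exp_nat_mul, mul_one]
      exact Real.exp_le_exp.2 hq1
    calc (∏ j ∈ Finset.range q, (2 * (j : ℝ) + 1)) * d ≤ (4 / 5 * q) ^ q * Real.exp 1 ^ q :=
          mul_le_mul (prod_odd_le hq5) h1 (by positivity) (by positivity)
      _ = (4 / 5 * q * Real.exp 1) ^ q := (mul_pow _ _ _).symm
      _ ≤ (11 / 4 * Real.log d) ^ q := by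
          -- Rounding up costs at most the factor 5/4 since log d > 4, and (4/5) · e · (5/4) = e <
          -- 11/4.
          refine pow_le_pow_left₀ (by positivity) ?_ q
          nlinarith

end LogDimension

/-! ### Mean square error of averages of vectors. -/

section IIDAverages

variable {T : Type*} [MeasurableSpace T] {P : Measure T} [IsProbabilityMeasure P] {n : ℕ}

lemma integral_comp_eval {F : Type*} [NormedAddCommGroup F] [NormedSpace ℝ F] {f : T → F}
    (hf : StronglyMeasurable f) (i : Fin n) :
    ∫ b, f (b i) ∂(Measure.pi fun _ : Fin n => P) = ∫ x, f x ∂P := by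
  have h := measurePreserving_eval (fun _ : Fin n => P) i
  have := integral_map (μ := Measure.pi fun _ : Fin n => P) (f := f) h.measurable.aemeasurable
    hf.aestronglyMeasurable
  rw [h.map_eq] at this
  exact this.symm

lemma integrable_comp_eval {F : Type*} [NormedAddCommGroup F] {f : T → F} (hf : Integrable f P)
    (i : Fin n) : Integrable (fun b : Fin n → T => f (b i)) (Measure.pi fun _ : Fin n => P) :=
  (measurePreserving_eval (fun _ : Fin n => P) i).integrable_comp_of_integrable hf

/-- The mean of `n` independent copies of a real random variable has mean square error at most
`1 / n` times the second moment. -/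
lemma integral_sq_mean_sub_le_real (hn : n ≠ 0) {f : T → ℝ} (hf : StronglyMeasurable f)
    (hf2 : Integrable (fun x => f x ^ 2) P) :
    Integrable (fun b : Fin n → T => ((n : ℝ)⁻¹ * ∑ i, f (b i) - ∫ x, f x ∂P) ^ 2)
      (Measure.pi fun _ => P) ∧
    ∫ b, ((n : ℝ)⁻¹ * ∑ i, f (b i) - ∫ x, f x ∂P) ^ 2 ∂(Measure.pi fun _ : Fin n => P) ≤
      (n : ℝ)⁻¹ * ∫ x, f x ^ 2 ∂P := by
  have hmem : MemLp f 2 P := (memLp_two_iff_integrable_sq hf.aestronglyMeasurable).2 hf2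
  have hn' : (n : ℝ) ≠ 0 := by exact_mod_cast hn
  have hev : ∀ i : Fin n, MemLp (fun b : Fin n → T => f (b i)) 2 (Measure.pi fun _ => P) :=
    fun i => hmem.comp_measurePreserving (measurePreserving_eval _ i)
  have hsum : MemLp (fun b : Fin n → T => ∑ i, f (b i)) 2 (Measure.pi fun _ => P) :=
    memLp_finsetSum _ fun i _ => hev i
  have hmean : ∫ b, ∑ i, f (b i) ∂(Measure.pi fun _ : Fin n => P) = n * ∫ x, f x ∂P := by
    rw [integral_finsetSum _ fun i _ => (hev i).integrable (by norm_num)]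
    simp_rw [integral_comp_eval hf]
    simp
  have heq : ∀ b : Fin n → T, ((n : ℝ)⁻¹ * ∑ i, f (b i) - ∫ x, f x ∂P) ^ 2 =
      (n : ℝ)⁻¹ ^ 2 * (∑ i, f (b i) - n * ∫ x, f x ∂P) ^ 2 := fun b => by
    field_simp
  have hvar : ∫ b, (∑ i, f (b i) - n * ∫ x, f x ∂P) ^ 2 ∂(Measure.pi fun _ : Fin n => P) =
      n * variance f P := by
    have h1 := variance_sum_pi (μ := fun _ : Fin n => P) (X := fun _ => f) fun _ => hmem
    rw [← hmean]
    rw [variance_eq_integral (by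
      have := hsum.aestronglyMeasurable.aemeasurable
      convert this using 1; ext b; simp)] at h1
    simpa using h1
  simp_rw [heq]
  constructor
  · exact ((hsum.sub (memLp_const _)).integrable_sq).const_mul _
  · rw [integral_const_mul, hvar]
    have := variance_le_expectation_sq (μ := P) (X := f) hf.aestronglyMeasurable
    calc (n : ℝ)⁻¹ ^ 2 * (n * variance f P) = (n : ℝ)⁻¹ * variance f P := by field_simp
      _ ≤ (n : ℝ)⁻¹ * ∫ x, f x ^ 2 ∂P := by gcongr; simpa using this

lemma integral_sq_mean_sub_le {d : ℕ} (hn : n ≠ 0) {f : T → Param d} (hf : StronglyMeasurable f)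
    (hf2 : Integrable (fun x => ‖f x‖ ^ 2) P) :
    Integrable (fun b : Fin n → T => ‖(n : ℝ)⁻¹ • ∑ i, f (b i) - ∫ x, f x ∂P‖ ^ 2)
      (Measure.pi fun _ => P) ∧
    ∫ b, ‖(n : ℝ)⁻¹ • ∑ i, f (b i) - ∫ x, f x ∂P‖ ^ 2 ∂(Measure.pi fun _ : Fin n => P) ≤
      (n : ℝ)⁻¹ * ∫ x, ‖f x‖ ^ 2 ∂P := by
  have hfj : ∀ j, StronglyMeasurable fun x => f x j := fun j =>
    (EuclideanSpace.proj (𝕜 := ℝ) j).continuous.comp_stronglyMeasurable hf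
  have hfj2 : ∀ j, Integrable (fun x => f x j ^ 2) P := fun j => by
    have := integrable_sq_of_sq_le (hfj j) hf2 fun x => by
      gcongr; exact PiLp.norm_apply_le _ _
    simpa using this
  have hint := integrable_of_sq hf hf2
  have hmean : ∀ j, (∫ x, f x ∂P) j = ∫ x, f x j ∂P := fun j =>
    ((EuclideanSpace.proj j : Param d →L[ℝ] ℝ).integral_comp_comm hint).symm
  have heq : ∀ b : Fin n → T, ‖(n : ℝ)⁻¹ • ∑ i, f (b i) - ∫ x, f x ∂P‖ ^ 2 =
      ∑ j, ((n : ℝ)⁻¹ * ∑ i, f (b i) j - ∫ x, f x j ∂P) ^ 2 := fun b => by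
    rw [EuclideanSpace.norm_sq_eq]
    simp [hmean]
  simp_rw [heq]
  refine ⟨integrable_finsetSum _ fun j _ =>
    (integral_sq_mean_sub_le_real hn (hfj j) (hfj2 j)).1, ?_⟩
  rw [integral_finsetSum _ fun j _ => (integral_sq_mean_sub_le_real hn (hfj j) (hfj2 j)).1]
  simp_rw [EuclideanSpace.norm_sq_eq, Real.norm_eq_abs, sq_abs]
  rw [integral_finsetSum _ fun j _ => hfj2 j, Finset.mul_sum]
  exact Finset.sum_le_sum fun j _ => (integral_sq_mean_sub_le_real hn (hfj j) (hfj2 j)).2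

end IIDAverages

end SOPO

namespace SOPO

/-! ### Jensen's inequality for second moments. -/

section SecondMoments

lemma sq_integral_le_integral_sq {X : Type*} [MeasurableSpace X] {μ : Measure X}
    [IsProbabilityMeasure μ] {g : X → ℝ} (hg : Integrable g μ)
    (hg2 : Integrable (fun x => g x ^ 2) μ) : (∫ x, g x ∂μ) ^ 2 ≤ ∫ x, g x ^ 2 ∂μ := by
  set c := ∫ x, g x ∂μ with hc
  have h0 : 0 ≤ ∫ x, (g x - c) ^ 2 ∂μ := integral_nonneg fun x => sq_nonneg _
  have h1 : ∀ x, (g x - c) ^ 2 = g x ^ 2 - (2 * c * g x - c ^ 2) := fun x => by ring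
  simp_rw [h1] at h0
  have hi : Integrable (fun x => 2 * c * g x) μ := hg.const_mul _
  have hj : Integrable (fun x => 2 * c * g x - c ^ 2) μ := hi.sub (integrable_const _)
  rw [integral_sub hg2 hj, integral_sub hi (integrable_const _), integral_const_mul, ← hc] at h0
  simp only [integral_const, probReal_univ, one_smul] at h0
  nlinarith

lemma sq_norm_integral_le {X F : Type*} [MeasurableSpace X] [NormedAddCommGroup F]
    [NormedSpace ℝ F] {μ : Measure X} [IsProbabilityMeasure μ] {f : X → F} (hf : Integrable f μ)
    (hf2 : Integrable (fun x => ‖f x‖ ^ 2) μ) : ‖∫ x, f x ∂μ‖ ^ 2 ≤ ∫ x, ‖f x‖ ^ 2 ∂μ :=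
  (pow_le_pow_left₀ (norm_nonneg _) (norm_integral_le_integral_norm f) 2).trans
    (sq_integral_le_integral_sq hf.norm hf2)

end SecondMoments

/-! ### Symmetrization with an independent copy. -/

section Symmetrization

variable {T F : Type*} [MeasurableSpace T] {P : Measure T} [IsProbabilityMeasure P] {n : ℕ}
  [NormedAddCommGroup F]

lemma integrable_sq_sub_prod {X : T → F} (hX : StronglyMeasurable X)
    (hX2 : Integrable (fun x => ‖X x‖ ^ 2) P) :
    Integrable (fun z : T × T => ‖X z.1 - X z.2‖ ^ 2) (P.prod P) ∧
      ∫ z, ‖X z.1 - X z.2‖ ^ 2 ∂(P.prod P) ≤ 4 * ∫ x, ‖X x‖ ^ 2 ∂P := by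
  have h1 : Integrable (fun z : T × T => ‖X z.1‖ ^ 2) (P.prod P) := hX2.comp_fst P
  have h2 : Integrable (fun z : T × T => ‖X z.2‖ ^ 2) (P.prod P) := hX2.comp_snd P
  have hle : ∀ z : T × T, ‖X z.1 - X z.2‖ ^ 2 ≤ 2 * ‖X z.1‖ ^ 2 + 2 * ‖X z.2‖ ^ 2 := fun z => by
    have := norm_sub_le (X z.1) (X z.2)
    nlinarith [sq_nonneg (‖X z.1‖ - ‖X z.2‖), norm_nonneg (X z.1 - X z.2)]
  have hb := (h1.const_mul 2).add (h2.const_mul 2)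
  have hi : Integrable (fun z : T × T => ‖X z.1 - X z.2‖ ^ 2) (P.prod P) :=
    integrable_sq_of_sq_le ((hX.comp_measurable measurable_fst).sub
      (hX.comp_measurable measurable_snd)) hb hle
  refine ⟨hi, (integral_mono hi hb hle).trans ?_⟩
  simp only [Pi.add_apply]
  rw [integral_add (h1.const_mul 2) (h2.const_mul 2), integral_const_mul, integral_const_mul,
    integral_fun_fst (fun x => ‖X x‖ ^ 2), integral_fun_snd (fun x => ‖X x‖ ^ 2)]
  simp only [probReal_univ, one_smul]
  linarith

/-- Exchanging the two copies in some of the coordinates. -/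
def swapSome (σ : Fin n → Bool) (z : Fin n → T × T) : Fin n → T × T :=
  fun i => if σ i then z i else (z i).swap

lemma measurePreserving_swapSome (σ : Fin n → Bool) :
    MeasurePreserving (swapSome σ) (Measure.pi fun _ : Fin n => P.prod P)
      (Measure.pi fun _ : Fin n => P.prod P) := by
  refine measurePreserving_pi _ _ (f := fun i (z : T × T) => if σ i then z else z.swap) fun i => ?_
  cases σ i
  · simpa using Measure.measurePreserving_swap (μ := P) (ν := P)
  · exact MeasurePreserving.id (P.prod P)

variable [NormedSpace ℝ F]

/-- Symmetrization: the deviation of a sum of independent copies from its mean is dominated, in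
mean square, by the sum of the differences of two independent copies. -/
lemma integral_sq_sum_sub_le_prod {X : T → F} (hX : StronglyMeasurable X) [CompleteSpace F]
    (hX2 : Integrable (fun x => ‖X x‖ ^ 2) P) :
    Integrable (fun z : Fin n → T × T => ‖∑ i, (X (z i).1 - X (z i).2)‖ ^ 2)
      (Measure.pi fun _ => P.prod P) ∧
    Integrable (fun b : Fin n → T => ‖∑ i, X (b i) - (n : ℝ) • ∫ x, X x ∂P‖ ^ 2)
      (Measure.pi fun _ => P) ∧
    ∫ b, ‖∑ i, X (b i) - (n : ℝ) • ∫ x, X x ∂P‖ ^ 2 ∂(Measure.pi fun _ : Fin n => P) ≤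
      ∫ z, ‖∑ i, (X (z i).1 - X (z i).2)‖ ^ 2 ∂(Measure.pi fun _ : Fin n => P.prod P) := by
  have hint : Integrable X P := integrable_of_sq hX hX2
  have hev : ∀ i : Fin n, StronglyMeasurable fun b : Fin n → T => X (b i) :=
    fun i => hX.comp_measurable (measurable_pi_apply i)
  have hsumSM : StronglyMeasurable fun b : Fin n → T => ∑ i, X (b i) :=
    Finset.stronglyMeasurable_fun_sum _ fun i _ => hev i
  have hsum2 : Integrable (fun b : Fin n → T => ‖∑ i, X (b i)‖ ^ 2) (Measure.pi fun _ => P) :=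
    integrable_sq_of_sq_le hsumSM ((integrable_finsetSum Finset.univ fun i _ =>
      integrable_comp_eval hX2 i).const_mul (Fintype.card (Fin n) : ℝ))
      fun b => by simpa using sq_norm_sum_le Finset.univ fun i => X (b i)
  have hmean : ∫ b, ∑ i, X (b i) ∂(Measure.pi fun _ : Fin n => P) = (n : ℝ) • ∫ x, X x ∂P := by
    rw [integral_finsetSum _ fun i _ => integrable_comp_eval hint i]
    simp_rw [integral_comp_eval hX]
    simp [← Nat.cast_smul_eq_nsmul ℝ]
  have hsum1 := integrable_of_sq hsumSM hsum2
  have hprod := (integrable_sq_sub_prod hsumSM hsum2).1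
  have harr := measurePreserving_arrowProdEquivProdArrow T T (Fin n) (fun _ => P) (fun _ => P)
  have hcomp : (fun z : Fin n → T × T => ‖∑ i, (X (z i).1 - X (z i).2)‖ ^ 2) =
      (fun w : (Fin n → T) × (Fin n → T) => ‖∑ i, X (w.1 i) - ∑ i, X (w.2 i)‖ ^ 2) ∘
        MeasurableEquiv.arrowProdEquivProdArrow T T (Fin n) := by
    ext z
    simp [MeasurableEquiv.arrowProdEquivProdArrow, Equiv.arrowProdEquivProdArrow]
  -- Centring equals averaging over an independent second batch, so Jensen's inequality moves the
  -- average outside the square.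
  have hpt : ∀ b : Fin n → T, ∑ i, X (b i) - (n : ℝ) • ∫ x, X x ∂P =
      ∫ b', (∑ i, X (b i) - ∑ i, X (b' i)) ∂(Measure.pi fun _ : Fin n => P) := fun b => by
    rw [integral_sub (integrable_const _) hsum1, hmean]
    simp
  have hle : ∀ᵐ b ∂(Measure.pi fun _ : Fin n => P),
      ‖∑ i, X (b i) - (n : ℝ) • ∫ x, X x ∂P‖ ^ 2 ≤
        ∫ b', ‖∑ i, X (b i) - ∑ i, X (b' i)‖ ^ 2 ∂(Measure.pi fun _ : Fin n => P) := by
    filter_upwards [hprod.prod_right_ae] with b hb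
    rw [hpt b]
    exact sq_norm_integral_le ((integrable_const _).sub hsum1) hb
  have hI : Integrable (fun b : Fin n → T => ‖∑ i, X (b i) - (n : ℝ) • ∫ x, X x ∂P‖ ^ 2)
      (Measure.pi fun _ => P) := by
    refine hprod.integral_prod_left.mono'
      ((hsumSM.sub stronglyMeasurable_const).norm.pow 2).aestronglyMeasurable ?_
    filter_upwards [hle] with b hb
    rwa [Real.norm_of_nonneg (by positivity)]
  refine ⟨?_, hI, ?_⟩
  · rw [hcomp]
    exact harr.integrable_comp_of_integrable hprod
  · refine (integral_mono_ae hI hprod.integral_prod_left hle).trans_eq ?_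
    rw [← integral_prod _ hprod, hcomp]
    exact (harr.integral_comp' (f := MeasurableEquiv.arrowProdEquivProdArrow T T (Fin n)) _).symm

end Symmetrization

/-! ### Mean square error of averages of symmetric matrices. -/

section OperatorMean

variable {T : Type*} [MeasurableSpace T] {P : Measure T} [IsProbabilityMeasure P] {n d : ℕ}

/-- Exchanging the two copies in any set of coordinates preserves the law and flips the matching
signs. The symmetrized sum can therefore be averaged over all signs, and Khintchine's inequality is
applied for each fixed sample. The factor 4 is the cost of the second copy. -/
lemma integral_sq_sum_sub_le_of_moment {X : T → (Param d →L[ℝ] Param d)}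
    (hX : StronglyMeasurable X) (hsymm : ∀ x, IsSymm (X x))
    (hX2 : Integrable (fun x => ‖X x‖ ^ 2) P) {q : ℕ} (hq : q ≠ 0) {c : ℝ} (hc : 0 ≤ c)
    (hqc : (∏ j ∈ Finset.range q, (2 * (j : ℝ) + 1)) * d ≤ c ^ q) :
    ∫ b, ‖∑ i, X (b i) - (n : ℝ) • ∫ x, X x ∂P‖ ^ 2 ∂(Measure.pi fun _ : Fin n => P) ≤
      4 * c * n * ∫ x, ‖X x‖ ^ 2 ∂P := by
  obtain ⟨hz, -, hle⟩ := integral_sq_sum_sub_le_prod (n := n) hX hX2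
  obtain ⟨hd1, hd2⟩ := integrable_sq_sub_prod hX hX2
  refine hle.trans ?_
  set Q := Measure.pi fun _ : Fin n => P.prod P with hQ
  set A : (Fin n → T × T) → Fin n → (Param d →L[ℝ] Param d) :=
    fun z i => X (z i).1 - X (z i).2 with hA
  have hswap : ∀ σ z, ∑ i, A (swapSome σ z) i = signedSum (A z) σ := fun σ z => by
    refine Finset.sum_congr rfl fun i _ => ?_
    simp only [hA, swapSome, boolSign]
    cases σ i <;> simp
  have hσ : ∀ σ : Fin n → Bool, Integrable (fun z => ‖signedSum (A z) σ‖ ^ 2) Q ∧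
      ∫ z, ‖signedSum (A z) σ‖ ^ 2 ∂Q = ∫ z, ‖∑ i, A z i‖ ^ 2 ∂Q := fun σ => by
    have hp := measurePreserving_swapSome (P := P) σ
    have h1 := hp.integrable_comp_of_integrable hz
    have h2 := integral_map (μ := Q) hp.measurable.aemeasurable
      (f := fun z => ‖∑ i, A z i‖ ^ 2) (by rw [hp.map_eq]; exact hz.aestronglyMeasurable)
    rw [hp.map_eq] at h2
    simp only [hswap] at h2
    refine ⟨?_, h2.symm⟩
    refine h1.congr (Filter.Eventually.of_forall fun z => ?_)
    change _ = ‖signedSum (A z) σ‖ ^ 2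
    rw [← hswap]
    rfl
  have hsum : 2 ^ n * ∫ z, ‖∑ i, A z i‖ ^ 2 ∂Q = ∫ z, ∑ σ, ‖signedSum (A z) σ‖ ^ 2 ∂Q := by
    rw [integral_finsetSum _ fun σ _ => (hσ σ).1]
    simp [(hσ _).2]
  have hAi : ∀ i : Fin n, Integrable (fun z => ‖A z i‖ ^ 2) Q :=
    fun i => integrable_comp_eval hd1 i
  have hAi' : ∀ i : Fin n, ∫ z, ‖A z i‖ ^ 2 ∂Q ≤ 4 * ∫ x, ‖X x‖ ^ 2 ∂P := fun i => by
    refine le_trans (le_of_eq ?_) hd2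
    exact integral_comp_eval (P := P.prod P) (f := fun z => ‖X z.1 - X z.2‖ ^ 2)
      ((((hX.comp_measurable measurable_fst).sub (hX.comp_measurable measurable_snd)).norm).pow 2) i
  have hfin : 2 ^ n * ∫ z, ‖∑ i, A z i‖ ^ 2 ∂Q ≤
      2 ^ n * (4 * c * n * ∫ x, ‖X x‖ ^ 2 ∂P) := by
    rw [hsum]
    have hbound : ∀ z, ∑ σ, ‖signedSum (A z) σ‖ ^ 2 ≤ 2 ^ n * (c * ∑ i, ‖A z i‖ ^ 2) := fun z =>
      sum_sq_norm_signedSum_le (fun i => (hsymm _).sub (hsymm _)) hq hc (by simpa using hqc)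
    have hAs : Integrable (fun z => ∑ i, ‖A z i‖ ^ 2) Q := integrable_finsetSum _ fun i _ => hAi i
    have hSs : Integrable (fun z => ∑ σ, ‖signedSum (A z) σ‖ ^ 2) Q :=
      integrable_finsetSum _ fun σ _ => (hσ σ).1
    refine (integral_mono hSs ((hAs.const_mul c).const_mul _) hbound).trans ?_
    rw [integral_const_mul, integral_const_mul, integral_finsetSum _ fun i _ => hAi i]
    refine mul_le_mul_of_nonneg_left ?_ (by positivity)
    calc c * ∑ i, ∫ z, ‖A z i‖ ^ 2 ∂Q ≤ c * ∑ _i : Fin n, 4 * ∫ x, ‖X x‖ ^ 2 ∂P :=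
          mul_le_mul_of_nonneg_left (Finset.sum_le_sum fun i _ => hAi' i) hc
      _ = 4 * c * n * ∫ x, ‖X x‖ ^ 2 ∂P := by simp; ring
  exact le_of_mul_le_mul_left hfin (by positivity)

lemma sq_norm_le_sum_sq_norm_apply (B : Param d →L[ℝ] Param d) :
    ‖B‖ ^ 2 ≤ ∑ j, ‖B (EuclideanSpace.single j 1)‖ ^ 2 := by
  have h0 : 0 ≤ ∑ j, ‖B (EuclideanSpace.single j 1)‖ ^ 2 := by positivity
  rw [← Real.sq_sqrt h0]
  refine pow_le_pow_left₀ (norm_nonneg _) (B.opNorm_le_bound (Real.sqrt_nonneg _) fun x => ?_) 2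
  have hx : B x = ∑ j, x j • B (EuclideanSpace.single j 1) := by
    conv_lhs => rw [← (EuclideanSpace.basisFun (Fin d) ℝ).sum_repr x]
    simp
  rw [hx, EuclideanSpace.norm_eq x, ← Real.sqrt_mul h0]
  refine (norm_sum_le _ _).trans (Real.le_sqrt_of_sq_le ?_)
  simp_rw [norm_smul]
  exact (Finset.sum_mul_sq_le_sq_mul_sq _ _ _).trans_eq (mul_comm _ _)

/-- The mean of `n` independent copies of a random symmetric `d × d` matrix has mean square error,
in operator norm, at most `11 log d / n` times the second moment. -/
theorem integral_sq_opMean_sub_le (hd : 2 ≤ d) (hn : n ≠ 0) {X : T → (Param d →L[ℝ] Param d)}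
    (hX : StronglyMeasurable X) (hsymm : ∀ x, IsSymm (X x))
    (hX2 : Integrable (fun x => ‖X x‖ ^ 2) P) :
    Integrable (fun b : Fin n → T => ‖(n : ℝ)⁻¹ • ∑ i, X (b i) - ∫ x, X x ∂P‖ ^ 2)
      (Measure.pi fun _ => P) ∧
    ∫ b, ‖(n : ℝ)⁻¹ • ∑ i, X (b i) - ∫ x, X x ∂P‖ ^ 2 ∂(Measure.pi fun _ : Fin n => P) ≤
      11 * Real.log d * (n : ℝ)⁻¹ * ∫ x, ‖X x‖ ^ 2 ∂P := by
  have hn' : (n : ℝ) ≠ 0 := by exact_mod_cast hn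
  have hs0 : 0 ≤ ∫ x, ‖X x‖ ^ 2 ∂P := integral_nonneg fun x => by positivity
  have heq : ∀ b : Fin n → T, ‖(n : ℝ)⁻¹ • ∑ i, X (b i) - ∫ x, X x ∂P‖ ^ 2 =
      (n : ℝ)⁻¹ ^ 2 * ‖∑ i, X (b i) - (n : ℝ) • ∫ x, X x ∂P‖ ^ 2 := fun b => by
    have h : (n : ℝ)⁻¹ • ∑ i, X (b i) - ∫ x, X x ∂P =
        (n : ℝ)⁻¹ • (∑ i, X (b i) - (n : ℝ) • ∫ x, X x ∂P) := by
      rw [smul_sub, inv_smul_smul₀ hn']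
    rw [h, norm_smul, mul_pow]
    simp
  have hI : Integrable (fun b : Fin n → T => ‖(n : ℝ)⁻¹ • ∑ i, X (b i) - ∫ x, X x ∂P‖ ^ 2)
      (Measure.pi fun _ => P) := by
    simp_rw [heq]
    exact (integral_sq_sum_sub_le_prod hX hX2).2.1.const_mul _
  refine ⟨hI, ?_⟩
  -- In small dimension the sum of the column variances costs a factor `d`, at most 11 log d. In
  -- larger dimension Khintchine's inequality with constant (11/4) log d is used, and the 4 from
  -- symmetrization restores 11 log d.
  rcases le_or_gt d 31 with h31 | h31
  · have hcol : ∀ j, StronglyMeasurable fun x => X x (EuclideanSpace.single j 1) := fun j =>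
      (ContinuousLinearMap.apply ℝ (Param d)
        (EuclideanSpace.single j (1 : ℝ) : Param d)).continuous.comp_stronglyMeasurable hX
    have hle : ∀ j x, ‖X x (EuclideanSpace.single j 1)‖ ^ 2 ≤ ‖X x‖ ^ 2 := fun j x => by
      gcongr
      simpa using (X x).le_opNorm (EuclideanSpace.single j 1)
    have hcol2 := fun j => integrable_sq_of_sq_le (hcol j) hX2 (hle j)
    have hcm := fun j => integral_sq_mean_sub_le hn (hcol j) (hcol2 j)
    have hint := integrable_of_sq hX hX2
    have hpt : ∀ b : Fin n → T, ‖(n : ℝ)⁻¹ • ∑ i, X (b i) - ∫ x, X x ∂P‖ ^ 2 ≤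
        ∑ j, ‖(n : ℝ)⁻¹ • ∑ i, X (b i) (EuclideanSpace.single j 1) -
          ∫ x, X x (EuclideanSpace.single j 1) ∂P‖ ^ 2 := fun b => by
      refine (sq_norm_le_sum_sq_norm_apply _).trans_eq (Finset.sum_congr rfl fun j _ => ?_)
      rw [← ContinuousLinearMap.integral_apply hint]
      simp
    refine (integral_mono hI (integrable_finsetSum _ fun j _ => (hcm j).1) hpt).trans ?_
    rw [integral_finsetSum _ fun j _ => (hcm j).1]
    calc _ ≤ ∑ _j : Fin d, (n : ℝ)⁻¹ * ∫ x, ‖X x‖ ^ 2 ∂P :=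
          Finset.sum_le_sum fun j _ => (hcm j).2.trans
            (mul_le_mul_of_nonneg_left (integral_mono (hcol2 j) hX2 (hle j)) (by positivity))
      _ = d * ((n : ℝ)⁻¹ * ∫ x, ‖X x‖ ^ 2 ∂P) := by simp
      _ ≤ 11 * Real.log d * ((n : ℝ)⁻¹ * ∫ x, ‖X x‖ ^ 2 ∂P) := by
          gcongr
          exact le_eleven_log hd h31
      _ = _ := by ring
  · obtain ⟨q, hq, hqc⟩ := exists_moment_order h31
    have hl : 0 ≤ Real.log d := Real.log_natCast_nonneg d
    have := integral_sq_sum_sub_le_of_moment (n := n) hX hsymm hX2 hq (by positivity) hqc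
    simp_rw [heq]
    rw [integral_const_mul]
    calc _ ≤ (n : ℝ)⁻¹ ^ 2 * (4 * (11 / 4 * Real.log d) * n * ∫ x, ‖X x‖ ^ 2 ∂P) := by gcongr
      _ = _ := by field_simp

end OperatorMean

end SOPO

namespace SOPO

/-! ### The symmetric part of the Hessian estimate. -/

section SymmetricPart

variable {d : ℕ}

/-- The symmetric part of an operator. -/
noncomputable def symPart : (Param d →L[ℝ] Param d) →L[ℝ] (Param d →L[ℝ] Param d) :=
  LinearMap.mkContinuous
    { toFun := fun B => (1 / 2 : ℝ) • (B + ContinuousLinearMap.adjoint B)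
      map_add' := fun B C => by
        rw [map_add]; module
      map_smul' := fun c B => by
        rw [map_smulₛₗ]; simp only [conj_trivial, RingHom.id_apply]; module } 1 fun B => by
    have h1 : ‖ContinuousLinearMap.adjoint B‖ = ‖B‖ := LinearIsometryEquiv.norm_map _ B
    have h2 := norm_add_le B (ContinuousLinearMap.adjoint B)
    simp only [LinearMap.coe_mk, AddHom.coe_mk, norm_smul]
    norm_num
    linarith

lemma symPart_eq (B : Param d →L[ℝ] Param d) :
    symPart B = (1 / 2 : ℝ) • (B + ContinuousLinearMap.adjoint B) := rfl

lemma norm_symPart_le (B : Param d →L[ℝ] Param d) : ‖symPart B‖ ≤ ‖B‖ := by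
  have := (symPart (d := d)).le_of_opNorm_le (LinearMap.mkContinuous_norm_le _ zero_le_one _) B
  simpa using this

lemma isSymm_symPart (B : Param d →L[ℝ] Param d) : IsSymm (symPart B) := fun x y => by
  simp only [symPart_eq, smul_apply, add_apply, inner_smul_left, inner_smul_right, inner_add_left,
    inner_add_right, ContinuousLinearMap.adjoint_inner_left,
    ContinuousLinearMap.adjoint_inner_right]
  simp [add_comm]

lemma inner_symPart_self (B : Param d →L[ℝ] Param d) (v : Param d) :
    inner ℝ v (symPart B v) = inner ℝ v (B v) := by
  simp only [symPart_eq, smul_apply, add_apply, inner_smul_right, inner_add_right,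
    ContinuousLinearMap.adjoint_inner_right, real_inner_comm v (B v)]
  ring

lemma IsSymm.symPart_eq_self {B : Param d →L[ℝ] Param d} (hB : IsSymm B) : symPart B = B := by
  have : ContinuousLinearMap.adjoint B = B :=
    ((ContinuousLinearMap.eq_adjoint_iff B B).2 hB).symm
  rw [symPart_eq, this, ← two_smul ℝ B, smul_smul]
  norm_num

end SymmetricPart

variable {S A : Type*} [MeasurableSpace S] [MeasurableSpace A] {d : ℕ}
variable {m : MDP S A} {π : Policy S A d} {H k : ℕ} {R G L : ℝ}

/-! ### Mean square errors of the two batches. -/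

section BatchVariance

lemma isSymm_hess_J (hR : 0 ≤ R) (hG : 0 < G) (hcost : BoundedCost m R)
    (hLS : ExpectedLS m π H G L) (θ : Param d) : IsSymm (hess (J m π H) θ) :=
  inner_hess_J_comm hR hG hcost hLS θ

lemma integral_sq_batchGrad_sub_le (hR : 0 ≤ R) (hG : 0 < G) (hcost : BoundedCost m R)
    (hLS : ExpectedLS m π H G L) (hk : k ≠ 0) (θ : Param d) :
    Integrable (fun b : Fin k → Traj S A H => ‖batchGrad m π b θ - gradient (J m π H) θ‖ ^ 2)
      (Measure.pi fun _ => trajLaw m π H θ) ∧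
    ∫ b, ‖batchGrad m π b θ - gradient (J m π H) θ‖ ^ 2
        ∂(Measure.pi fun _ : Fin k => trajLaw m π H θ) ≤ varGrad m.discount R G / k := by
  have h1 := integral_sq_gradEst_le hcost (hLS.scoreL2 hG) θ
  have h2 := integral_sq_mean_sub_le hk (stronglyMeasurable_gradEst m π θ) h1.1
  rw [gradient_J hR hG hcost hLS θ]
  refine ⟨h2.1, h2.2.trans ?_⟩
  rw [div_eq_inv_mul]
  exact mul_le_mul_of_nonneg_left h1.2 (by positivity)

/-- The quadratic model sees only the symmetric part of the estimate. Taking it does not increase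
norms and leaves the mean unchanged, while it provides the symmetry that the matrix bound requires.
-/
lemma integral_sq_batchHess_sub_le (hd : 2 ≤ d) (hR : 0 ≤ R) (hG : 0 < G) (hcost : BoundedCost m R)
    (hLS : ExpectedLS m π H G L) (hk : k ≠ 0) (θ : Param d) :
    Integrable (fun b : Fin k → Traj S A H =>
        ‖symPart (batchHess m π b θ) - hess (J m π H) θ‖ ^ 2)
      (Measure.pi fun _ => trajLaw m π H θ) ∧
    ∫ b, ‖symPart (batchHess m π b θ) - hess (J m π H) θ‖ ^ 2
        ∂(Measure.pi fun _ : Fin k => trajLaw m π H θ) ≤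
      22 * Real.log d * varHess m.discount R G L H / k := by
  have h1 := integral_sq_hessEst_le hR hG hcost hLS θ
  have hSM : StronglyMeasurable fun τ : Traj S A H => symPart (hessEst m π τ θ) :=
    symPart.continuous.comp_stronglyMeasurable (stronglyMeasurable_hessEst m π θ)
  have hle : ∀ τ : Traj S A H, ‖symPart (hessEst m π τ θ)‖ ^ 2 ≤ ‖hessEst m π τ θ‖ ^ 2 := fun τ => by
    gcongr; exact norm_symPart_le _
  have hi := integrable_sq_of_sq_le hSM h1.1 hle
  have h2 := integral_sq_opMean_sub_le hd hk hSM (fun τ => isSymm_symPart _) hi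
  have hmean : ∫ τ, symPart (hessEst m π τ θ) ∂(trajLaw m π H θ) = hess (J m π H) θ := by
    rw [ContinuousLinearMap.integral_comp_comm _
      (integrable_of_sq (stronglyMeasurable_hessEst m π θ) h1.1), ← hess_J hR hG hcost hLS θ]
    exact (isSymm_hess_J hR hG hcost hLS θ).symPart_eq_self
  have heq : ∀ b : Fin k → Traj S A H, symPart (batchHess m π b θ) =
      (k : ℝ)⁻¹ • ∑ i, symPart (hessEst m π (b i) θ) := fun b => by
    rw [batchHess, map_smul, map_sum]
  rw [hmean] at h2
  simp_rw [heq]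
  refine ⟨h2.1, h2.2.trans ?_⟩
  have hl : 0 ≤ Real.log d := Real.log_natCast_nonneg d
  calc _ ≤ 11 * Real.log d * (k : ℝ)⁻¹ * (2 * varHess m.discount R G L H) :=
        mul_le_mul_of_nonneg_left ((integral_mono hi h1.1 hle).trans h1.2) (by positivity)
    _ = _ := by ring

end BatchVariance

/-! ### From fixed parameters to conditionally sampled batches. -/

section ConditionalSampling

lemma stronglyMeasurable_uncurry_batchGrad (m : MDP S A) (π : Policy S A d) :
    StronglyMeasurable fun p : Param d × (Fin k → Traj S A H) => batchGrad m π p.2 p.1 := by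
  refine stronglyMeasurable_uncurry_of_continuous_of_stronglyMeasurable
    (u := fun θ (b : Fin k → Traj S A H) => batchGrad m π b θ) (fun b => ?_) fun θ => ?_
  · exact (continuous_finsetSum _ fun i _ =>
      (contDiff_gradEst m π (b i)).continuous).const_smul ((k : ℝ)⁻¹)
  · exact (Finset.stronglyMeasurable_fun_sum Finset.univ fun i _ =>
      (stronglyMeasurable_gradEst m π θ).comp_measurable (measurable_pi_apply i)).const_smul ((k : ℝ)⁻¹)

lemma stronglyMeasurable_uncurry_batchHess (m : MDP S A) (π : Policy S A d) :
    StronglyMeasurable fun p : Param d × (Fin k → Traj S A H) => batchHess m π p.2 p.1 := by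
  refine stronglyMeasurable_uncurry_of_continuous_of_stronglyMeasurable
    (u := fun θ (b : Fin k → Traj S A H) => batchHess m π b θ) (fun b => ?_) fun θ => ?_
  · exact (continuous_finsetSum _ fun i _ => continuous_hessEst m π (b i)).const_smul ((k : ℝ)⁻¹)
  · exact (Finset.stronglyMeasurable_fun_sum Finset.univ fun i _ =>
      (stronglyMeasurable_hessEst m π θ).comp_measurable (measurable_pi_apply i)).const_smul ((k : ℝ)⁻¹)

lemma measurable_trajLaw (m : MDP S A) (π : Policy S A d) (H : ℕ) :
    Measurable (trajLaw m π H) := by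
  have hj : Measurable fun p : Param d × Traj S A H => density π p.1 p.2 :=
    measurable_uncurry_of_continuous_of_measurable
      (u := fun θ (τ : Traj S A H) => density π θ τ)
      (fun τ => continuous_finsetProd _ fun h _ => continuous_dens π _ _)
      fun θ => measurable_density π θ H
  refine Measure.measurable_of_measurable_coe _ fun B hB => ?_
  simp_rw [trajLaw, withDensity_apply _ hB]
  exact hj.ennreal_ofReal.lintegral_prod_right'

/-- The law of a batch of independent trajectories as a kernel in the parameter. -/
noncomputable def batchKernel (m : MDP S A) (π : Policy S A d) (H k : ℕ) :
    Kernel (Param d) (Fin k → Traj S A H) where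
  toFun θ := Measure.pi fun _ => trajLaw m π H θ
  measurable' := by
    refine Measurable.measure_of_isPiSystem_of_isProbabilityMeasure generateFrom_pi.symm
      isPiSystem_pi ?_
    rintro _ ⟨s, hs, rfl⟩
    simp_rw [Measure.pi_pi]
    exact Finset.measurable_prod _ fun i _ =>
      (Measure.measurable_coe (show MeasurableSet (s i) from hs i (Set.mem_univ i))).comp (measurable_trajLaw m π H)

instance : IsMarkovKernel (batchKernel m π H k) :=
  ⟨fun θ => by change IsProbabilityMeasure (Measure.pi fun _ => trajLaw m π H θ); infer_instance⟩

variable {Ω : Type*} {𝒢 : MeasurableSpace Ω} [mΩ : MeasurableSpace Ω] {μ : Measure Ω}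
  [IsProbabilityMeasure μ] {θ : Ω → Param d} {b : Ω → Fin k → Traj S A H}

/-- Testing the conditional law on events that depend on the parameter alone identifies the joint
law on rectangles. Error bounds that are uniform in fixed parameters can then be integrated. -/
lemma IsCondIIDBatch.map_eq (h : IsCondIIDBatch m π μ 𝒢 θ b) (h𝒢 : 𝒢 ≤ mΩ)
    (hθ : Measurable[𝒢] θ) (hb : Measurable b) :
    μ.map (fun ω => (θ ω, b ω)) = (μ.map θ) ⊗ₘ batchKernel m π H k := by
  have hθ' : Measurable θ := hθ.mono h𝒢 le_rfl
  have := Measure.isProbabilityMeasure_map (μ := μ) (hθ'.prodMk hb).aemeasurable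
  refine Measure.ext_prod fun {s t} hs ht => ?_
  rw [Measure.map_apply (hθ'.prodMk hb) (hs.prod ht), Measure.compProd_apply_prod hs ht,
    setLIntegral_map hs ((batchKernel m π H k).measurable_coe ht) hθ']
  exact h _ (hθ hs) t ht

/-- Integrating out a conditionally independent batch. -/
lemma IsCondIIDBatch.integrable_norm (h : IsCondIIDBatch m π μ 𝒢 θ b) (h𝒢 : 𝒢 ≤ mΩ)
    (hθ : Measurable[𝒢] θ) (hb : Measurable b) {F : Type*} [NormedAddCommGroup F]
    {f : Param d × (Fin k → Traj S A H) → F} (hf : StronglyMeasurable f) {C : ℝ}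
    (hC : ∀ θ, Integrable (fun b => ‖f (θ, b)‖ ^ 2) (Measure.pi fun _ => trajLaw m π H θ) ∧
      ∫ b, ‖f (θ, b)‖ ^ 2 ∂(Measure.pi fun _ => trajLaw m π H θ) ≤ C) :
    Integrable (fun ω => ‖f (θ ω, b ω)‖) μ ∧ ∫ ω, ‖f (θ ω, b ω)‖ ∂μ ≤ √C := by
  have hθ' : Measurable θ := hθ.mono h𝒢 le_rfl
  have hp : Measurable fun ω => (θ ω, b ω) := hθ'.prodMk hb
  have hC0 : 0 ≤ C := (integral_nonneg fun _ => by positivity).trans (hC 0).2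
  have hfm : StronglyMeasurable fun ω => f (θ ω, b ω) := hf.comp_measurable hp
  have hm : Measurable fun p => ENNReal.ofReal (‖f p‖ ^ 2) :=
    (hf.norm.pow 2).measurable.ennreal_ofReal
  have hlint : ∫⁻ ω, ENNReal.ofReal (‖f (θ ω, b ω)‖ ^ 2) ∂μ ≤ ENNReal.ofReal C := by
    rw [← lintegral_map (μ := μ) (f := fun p => ENNReal.ofReal (‖f p‖ ^ 2)) hm hp,
      h.map_eq h𝒢 hθ hb, Measure.lintegral_compProd hm, lintegral_map hm.lintegral_kernel_prod_right'
        hθ']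
    calc _ ≤ ∫⁻ _, ENNReal.ofReal C ∂μ := lintegral_mono fun ω => by
          change ∫⁻ b', ENNReal.ofReal (‖f (θ ω, b')‖ ^ 2)
            ∂(Measure.pi fun _ => trajLaw m π H (θ ω)) ≤ _
          rw [← ofReal_integral_eq_lintegral_ofReal (hC _).1
            (Eventually.of_forall fun _ => by positivity)]
          exact ENNReal.ofReal_le_ofReal (hC _).2
      _ = _ := by simp
  have hsq : Integrable (fun ω => ‖f (θ ω, b ω)‖ ^ 2) μ := by
    refine ⟨(hfm.norm.pow 2).aestronglyMeasurable, ?_⟩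
    rw [hasFiniteIntegral_iff_ofReal (Eventually.of_forall fun _ => by positivity)]
    exact hlint.trans_lt ENNReal.ofReal_lt_top
  have hle : ∫ ω, ‖f (θ ω, b ω)‖ ^ 2 ∂μ ≤ C := by
    rw [integral_eq_lintegral_of_nonneg_ae (Eventually.of_forall fun _ => by positivity)
      hsq.aestronglyMeasurable]
    exact ENNReal.toReal_le_of_le_ofReal hC0 hlint
  have hi := (integrable_of_sq hfm hsq).norm
  exact ⟨hi, Real.le_sqrt_of_sq_le ((sq_integral_le_integral_sq hi hsq).trans hle)⟩

end ConditionalSampling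

end SOPO

namespace SOPO

/-! ### Taylor bounds from a Lipschitz Hessian, and rescaling. -/

section Taylor

variable {E : Type*} [NormedAddCommGroup E] [InnerProductSpace ℝ E]

/-- Second-order expansions of `f` and first-order expansions of its gradient `g`, with Hessian `h`,
that hold with the remainders of an `M`-Lipschitz Hessian. -/
structure HasCubicTaylor (M : ℝ) (f : E → ℝ) (g : E → E) (h : E → E →L[ℝ] E) : Prop where
  value : ∀ x v, |f (x + v) - (f x + inner ℝ (g x) v + 1 / 2 * inner ℝ v (h x v))| ≤
    M * ‖v‖ ^ 3 / 6
  grad : ∀ x v, ‖g (x + v) - g x - h x v‖ ≤ M * ‖v‖ ^ 2 / 2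

lemma norm_sub_sub_le_of_lipschitz_fderiv {F : Type*} [NormedAddCommGroup F] [NormedSpace ℝ F]
    {M : ℝ} {g : E → F} {h : E → E →L[ℝ] F} (hg : ∀ x, HasFDerivAt g (h x) x)
    (hL : ∀ x y, ‖h x - h y‖ ≤ M * ‖x - y‖) (x v : E) :
    ‖g (x + v) - g x - h x v‖ ≤ M * ‖v‖ ^ 2 / 2 := by
  have hd : ∀ t : ℝ, HasDerivAt (fun t : ℝ => g (x + t • v) - g x - t • h x v)
      (h (x + t • v) v - h x v) t := fun t => by
    have h1 : HasDerivAt (fun t : ℝ => x + t • v) v t := by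
      simpa using ((hasDerivAt_id t).smul_const v).const_add x
    have h2 := (hg (x + t • v)).comp_hasDerivAt t h1
    have h3 : HasDerivAt (fun t : ℝ => t • h x v) (h x v) t := by
      simpa using (hasDerivAt_id t).smul_const (h x v)
    exact (h2.sub_const (g x)).sub h3
  have hB : ∀ t : ℝ, HasDerivAt (fun t : ℝ => M * ‖v‖ ^ 2 * t ^ 2 / 2) (M * ‖v‖ ^ 2 * t) t :=
    fun t => by
      have := ((hasDerivAt_pow 2 t).const_mul (M * ‖v‖ ^ 2)).div_const 2
      refine this.congr_deriv ?_; push_cast; ring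
  have := image_norm_le_of_norm_deriv_right_le_deriv_boundary
    (f := fun t : ℝ => g (x + t • v) - g x - t • h x v) (a := 0) (b := 1)
    (fun t _ => (hd t).continuousAt.continuousWithinAt) (fun t _ => (hd t).hasDerivWithinAt)
    (by simp) hB (fun t ht => by
      rw [← sub_apply]
      refine ((h (x + t • v) - h x).le_opNorm v).trans ?_
      refine (mul_le_mul_of_nonneg_right (hL _ _) (norm_nonneg v)).trans_eq ?_
      rw [add_sub_cancel_left, norm_smul, Real.norm_of_nonneg ht.1]
      ring) (Set.right_mem_Icc.2 zero_le_one)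
  simpa using this

lemma HasCubicTaylor.of_lipschitz [CompleteSpace E] {M : ℝ} {f : E → ℝ} {g : E → E}
    {h : E → E →L[ℝ] E} (hf : ∀ x, HasGradientAt f (g x) x) (hg : ∀ x, HasFDerivAt g (h x) x)
    (hL : ∀ x y, ‖h x - h y‖ ≤ M * ‖x - y‖) : HasCubicTaylor M f g h := by
  have hgrad := norm_sub_sub_le_of_lipschitz_fderiv hg hL
  refine ⟨fun x v => ?_, hgrad⟩
  -- Along the segment the derivative of the second-order remainder is the first-order remainder of
  -- the gradient paired with `v`, so integrating the gradient bound gives the cubic one.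
  have hd : ∀ t : ℝ, HasDerivAt
      (fun t : ℝ => f (x + t • v) - (f x + t * inner ℝ (g x) v + 1 / 2 * t ^ 2 * inner ℝ v (h x v)))
      (inner ℝ (g (x + t • v) - g x - h x (t • v)) v) t := fun t => by
    have h1 : HasDerivAt (fun t : ℝ => x + t • v) v t := by
      simpa using ((hasDerivAt_id t).smul_const v).const_add x
    have h2 := (hf (x + t • v)).hasFDerivAt.comp_hasDerivAt t h1
    have h3 : HasDerivAt (fun t : ℝ => f x + t * inner ℝ (g x) v + 1 / 2 * t ^ 2 * inner ℝ v (h x v))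
        (inner ℝ (g x) v + t * inner ℝ v (h x v)) t := by
      have h4 := ((hasDerivAt_id t).mul_const (inner ℝ (g x) v : ℝ)).const_add (f x)
      have h5 := ((hasDerivAt_pow 2 t).const_mul (1 / 2)).mul_const (inner ℝ v (h x v) : ℝ)
      refine (h4.add h5).congr_deriv ?_
      push_cast; ring
    refine (h2.sub h3).congr_deriv ?_
    simp only [InnerProductSpace.toDual_apply_apply, inner_sub_left, map_smul, inner_smul_left,
      conj_trivial, real_inner_comm v (h x v)]
    ring
  have hB : ∀ t : ℝ, HasDerivAt (fun t : ℝ => M * ‖v‖ ^ 3 * t ^ 3 / 6) (M * ‖v‖ ^ 3 * t ^ 2 / 2) t :=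
    fun t => by
      have := ((hasDerivAt_pow 3 t).const_mul (M * ‖v‖ ^ 3)).div_const 6
      refine this.congr_deriv ?_; push_cast; ring
  have := image_norm_le_of_norm_deriv_right_le_deriv_boundary
    (f := fun t : ℝ => f (x + t • v) -
      (f x + t * inner ℝ (g x) v + 1 / 2 * t ^ 2 * inner ℝ v (h x v))) (a := 0) (b := 1)
    (fun t _ => (hd t).continuousAt.continuousWithinAt) (fun t _ => (hd t).hasDerivWithinAt)
    (by simp) hB (fun t ht => by
      refine (norm_inner_le_norm _ _).trans ?_
      refine (mul_le_mul_of_nonneg_right (hgrad x (t • v)) (norm_nonneg v)).trans_eq ?_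
      rw [norm_smul, Real.norm_of_nonneg ht.1]
      ring) (Set.right_mem_Icc.2 zero_le_one)
  simpa using this

/-- Passage to the units in which the Lipschitz constant and the radius are `1`. -/
lemma HasCubicTaylor.rescale {M : ℝ} {f : E → ℝ} {g : E → E} {h : E → E →L[ℝ] E}
    (hT : HasCubicTaylor M f g h) (hM : 0 < M) {r : ℝ} (hr : 0 < r) :
    HasCubicTaylor 1 (fun x => (M * r ^ 3)⁻¹ * f (r • x)) (fun x => (M * r ^ 2)⁻¹ • g (r • x))
      (fun x => (M * r)⁻¹ • h (r • x)) := by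
  have hn : ∀ v : E, ‖r • v‖ = r * ‖v‖ := fun v => by rw [norm_smul, Real.norm_of_nonneg hr.le]
  constructor
  · intro x v
    have h1 := hT.value (r • x) (r • v)
    rw [hn, ← smul_add] at h1
    simp only [map_smul, inner_smul_right, inner_smul_left, smul_apply, conj_trivial] at h1 ⊢
    have h2 : (M * r ^ 3)⁻¹ * f (r • (x + v)) - ((M * r ^ 3)⁻¹ * f (r • x) +
        (M * r ^ 2)⁻¹ * inner ℝ (g (r • x)) v +
          1 / 2 * ((M * r)⁻¹ * inner ℝ v (h (r • x) v))) =
        (M * r ^ 3)⁻¹ * (f (r • (x + v)) - (f (r • x) + r * inner ℝ (g (r • x)) v +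
          1 / 2 * (r * (r * inner ℝ v (h (r • x) v))))) := by
      field_simp
    rw [h2, abs_mul, abs_of_pos (by positivity : 0 < (M * r ^ 3)⁻¹)]
    calc _ ≤ (M * r ^ 3)⁻¹ * (M * (r * ‖v‖) ^ 3 / 6) := by gcongr
      _ = _ := by field_simp
  · intro x v
    have h1 := hT.grad (r • x) (r • v)
    rw [hn, ← smul_add] at h1
    have h2 : (M * r ^ 2)⁻¹ • g (r • (x + v)) - (M * r ^ 2)⁻¹ • g (r • x) -
        ((M * r)⁻¹ • h (r • x)) v =
        (M * r ^ 2)⁻¹ • (g (r • (x + v)) - g (r • x) - h (r • x) (r • v)) := by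
      rw [map_smul, smul_sub, smul_sub, smul_smul, smul_apply]
      congr 2
      field_simp
    rw [h2, norm_smul, Real.norm_of_nonneg (by positivity)]
    calc _ ≤ (M * r ^ 2)⁻¹ * (M * (r * ‖v‖) ^ 2 / 2) := by gcongr
      _ = _ := by field_simp

end Taylor

/-! ### One trust-region step in normalized units. -/

section TrustRegion

variable {d : ℕ}

lemma IsTRSolution.symPart {c : ℝ} {g : Param d} {B : Param d →L[ℝ] Param d} {Δ : ℝ} {v : Param d}
    (h : IsTRSolution c g B Δ v) : IsTRSolution c g (symPart B) Δ v := by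
  simpa only [IsTRSolution, trModel, inner_symPart_self] using h

lemma IsTRSolution.rescale {c : ℝ} {g : Param d} {B : Param d →L[ℝ] Param d} {M r : ℝ}
    {v : Param d} (hM : 0 < M) (hr : 0 < r) (h : IsTRSolution c g B r v) :
    IsTRSolution ((M * r ^ 3)⁻¹ * c) ((M * r ^ 2)⁻¹ • g) ((M * r)⁻¹ • B) 1 (r⁻¹ • v) := by
  have hmod : ∀ w : Param d, trModel ((M * r ^ 3)⁻¹ * c) ((M * r ^ 2)⁻¹ • g) ((M * r)⁻¹ • B) w =
      (M * r ^ 3)⁻¹ * trModel c g B (r • w) := fun w => by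
    simp only [trModel, map_smul, inner_smul_right, inner_smul_left, smul_apply, conj_trivial]
    field_simp
  constructor
  · rw [norm_smul, norm_inv, Real.norm_of_nonneg hr.le, inv_mul_le_iff₀ hr]
    simpa using h.1
  · intro w hw
    rw [hmod, hmod, smul_inv_smul₀ hr.ne']
    refine mul_le_mul_of_nonneg_left (h.2 _ ?_) (by positivity)
    rw [norm_smul, Real.norm_of_nonneg hr.le]
    nlinarith

/-- First-order optimality in the trust-region subproblem. -/
lemma IsTRSolution.inner_sub_nonneg {c : ℝ} {g : Param d} {B : Param d →L[ℝ] Param d} {Δ : ℝ}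
    {v w : Param d} (h : IsTRSolution c g B Δ v) (hB : IsSymm B) (hw : ‖w‖ ≤ Δ) :
    0 ≤ inner ℝ (g + B v) (w - v) := by
  by_contra! ha
  set a := inner ℝ (g + B v) (w - v) with ha'
  set q := inner ℝ (w - v) (B (w - v)) with hq
  have hs : ∀ s : ℝ, 0 ≤ s → s ≤ 1 → 0 ≤ s * a + 1 / 2 * s ^ 2 * q := fun s h0 h1 => by
    have hf : ‖v + s • (w - v)‖ ≤ Δ := by
      have : v + s • (w - v) = (1 - s) • v + s • w := by module
      rw [this]
      refine (norm_add_le _ _).trans ?_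
      rw [norm_smul, norm_smul, Real.norm_of_nonneg h0, Real.norm_of_nonneg (by linarith)]
      nlinarith [h.1]
    have h2 := h.2 _ hf
    have h3 : inner ℝ v (B (w - v)) = inner ℝ (B v) (w - v) := (hB _ _).symm
    have h4 : inner ℝ (w - v) (B v) = inner ℝ (B v) (w - v) := real_inner_comm _ _
    simp only [trModel, map_add, map_smul, inner_add_left, inner_add_right, inner_smul_left,
      inner_smul_right, conj_trivial, h3, h4] at h2
    rw [ha', inner_add_left, hq]
    nlinarith
  have hq0 : 0 < |q| + 1 := by positivity
  -- If the slope towards `w` were negative, a step this short would stay feasible and its linear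
  -- gain would exceed the quadratic term.
  have hmin : 0 < min 1 (-a / (|q| + 1)) := lt_min one_pos (div_pos (by linarith) hq0)
  set s := min 1 (-a / (|q| + 1)) with hsdef
  have h1 := hs s hmin.le (min_le_left _ _)
  have h2 : s * (|q| + 1) ≤ -a := (le_div_iff₀ hq0).1 (min_le_right _ _)
  have h3 : 0 ≤ a + 1 / 2 * s * q := by
    by_contra! hneg
    nlinarith
  nlinarith [le_abs_self q]

/-- Testing first-order optimality at the unit vector opposite to the model gradient `w` gives
`inner ℝ w v ≤ -‖w‖`. With `‖v‖ ≤ 1` this is the equality case of Cauchy-Schwarz, so the multiplier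
is `‖w‖`. -/
lemma IsTRSolution.exists_multiplier {c : ℝ} {g : Param d} {B : Param d →L[ℝ] Param d}
    {v : Param d} (h : IsTRSolution c g B 1 v) (hB : IsSymm B) :
    ∃ l : ℝ, 0 ≤ l ∧ g + B v = -(l • v) ∧ (l = 0 ∨ ‖v‖ = 1) := by
  set w := g + B v with hw
  have hle : inner ℝ w v ≤ -‖w‖ := by
    rcases eq_or_ne w 0 with h0 | h0
    · simp [h0]
    · have hn : 0 < ‖w‖ := norm_pos_iff.2 h0
      have := h.inner_sub_nonneg hB (w := -(‖w‖⁻¹ • w)) (by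
        rw [norm_neg, norm_smul, norm_inv, norm_norm, inv_mul_cancel₀ hn.ne'])
      rw [← hw, inner_sub_right, inner_neg_right, inner_smul_right, real_inner_self_eq_norm_sq] at this
      have h2 : ‖w‖⁻¹ * ‖w‖ ^ 2 = ‖w‖ := by field_simp
      linarith
  have hv := h.1
  have hv2 : ‖v‖ ^ 2 ≤ 1 := by nlinarith [norm_nonneg v]
  refine ⟨‖w‖, norm_nonneg _, ?_, ?_⟩
  · have h1 : ‖w + ‖w‖ • v‖ ^ 2 ≤ 0 := by
      rw [norm_add_sq_real, inner_smul_right, norm_smul, norm_norm]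
      nlinarith [norm_nonneg w, sq_nonneg ‖w‖]
    have h2 : ‖w + ‖w‖ • v‖ = 0 := by
      have := sq_nonneg ‖w + ‖w‖ • v‖
      exact pow_eq_zero_iff (two_ne_zero) |>.1 (le_antisymm h1 this)
    exact eq_neg_of_add_eq_zero_left (norm_eq_zero.1 h2)
  · by_cases h0 : ‖w‖ = 0
    · exact Or.inl h0
    · right
      have h1 := abs_real_inner_le_norm w v
      have h2 : ‖w‖ ≤ ‖w‖ * ‖v‖ := by
        have := neg_abs_le (inner ℝ w v)
        linarith
      have hpos : 0 < ‖w‖ := lt_of_le_of_ne (norm_nonneg _) (Ne.symm h0)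
      have h3 : 1 ≤ ‖v‖ := by nlinarith
      linarith

lemma abs_model_sub_le (g g' v : Param d) (B B' : Param d →L[ℝ] Param d) :
    |inner ℝ g v + 1 / 2 * inner ℝ v (B v) - (inner ℝ g' v + 1 / 2 * inner ℝ v (B' v))| ≤
      ‖g' - g‖ * ‖v‖ + 1 / 2 * ‖B' - B‖ * ‖v‖ ^ 2 := by
  have h1 : inner ℝ g v + 1 / 2 * inner ℝ v (B v) - (inner ℝ g' v + 1 / 2 * inner ℝ v (B' v)) =
      -(inner ℝ (g' - g) v + 1 / 2 * inner ℝ v ((B' - B) v)) := by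
    simp only [inner_sub_left, inner_sub_right, sub_apply]; ring
  rw [h1, abs_neg]
  have h2 := abs_real_inner_le_norm (g' - g) v
  have h3 : |inner ℝ v ((B' - B) v)| ≤ ‖B' - B‖ * ‖v‖ ^ 2 := by
    refine (abs_real_inner_le_norm _ _).trans ?_
    nlinarith [(B' - B).le_opNorm v, norm_nonneg v]
  refine (abs_add_le _ _).trans ?_
  rw [abs_mul, abs_of_pos (by norm_num : (0 : ℝ) < 1 / 2)]
  linarith

/-- The decrease `D` guaranteed from the point `x`, up to the noise `n`: no feasible direction
improves the second-order model at `x` by more than `D + 1/6 + n`. -/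
def ModelDecrease (g : Param d) (B : Param d →L[ℝ] Param d) (D n : ℝ) : Prop :=
  ∀ v : Param d, ‖v‖ ≤ 1 → -(D + 1 / 6 + n) ≤ inner ℝ g v + 1 / 2 * inner ℝ v (B v)

variable {f : Param d → ℝ} {g : Param d → Param d} {h : Param d → Param d →L[ℝ] Param d}
  {x v gh : Param d} {Bh : Param d →L[ℝ] Param d} {c : ℝ}

lemma HasCubicTaylor.value_le (hT : HasCubicTaylor 1 f g h) (x v : Param d) {r : ℝ}
    (hv : ‖v‖ ^ 3 ≤ r) :
    f (x + v) ≤ f x + inner ℝ (g x) v + 1 / 2 * inner ℝ v (h x v) + r / 6 ∧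
      f x + inner ℝ (g x) v + 1 / 2 * inner ℝ v (h x v) - r / 6 ≤ f (x + v) := by
  have := abs_le.1 (hT.value x v)
  constructor <;> linarith [this.1, this.2]

/-- The step beats every competitor in the noisy model. Changing models at the step and at the
competitor costs the gradient error twice and the Hessian error twice with weight one half; the
cubic remainder at the step costs 1/6. -/
lemma ModelDecrease.of_step (hT : HasCubicTaylor 1 f g h) (hs : IsTRSolution c gh Bh 1 v) :
    ModelDecrease (g x) (h x) (f x - f (x + v)) (2 * ‖gh - g x‖ + ‖Bh - h x‖) := by
  intro w hw
  have h1 := (hT.value_le x v (pow_le_one₀ (norm_nonneg v) hs.1)).1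
  have h2 := (abs_le.1 (abs_model_sub_le (g x) gh v (h x) Bh)).2
  have h3 := (abs_le.1 (abs_model_sub_le (g x) gh w (h x) Bh)).1
  have h4 := hs.2 w hw
  simp only [trModel] at h4
  have e1 := norm_nonneg (gh - g x)
  have e2 := norm_nonneg (Bh - h x)
  have b1 : ‖gh - g x‖ * ‖v‖ ≤ ‖gh - g x‖ := mul_le_of_le_one_right e1 hs.1
  have b2 : ‖gh - g x‖ * ‖w‖ ≤ ‖gh - g x‖ := mul_le_of_le_one_right e1 hw
  have b3 : ‖Bh - h x‖ * ‖v‖ ^ 2 ≤ ‖Bh - h x‖ :=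
    mul_le_of_le_one_right e2 (pow_le_one₀ (norm_nonneg v) hs.1)
  have b4 : ‖Bh - h x‖ * ‖w‖ ^ 2 ≤ ‖Bh - h x‖ :=
    mul_le_of_le_one_right e2 (pow_le_one₀ (norm_nonneg w) hw)
  linarith

/-- Used at the last iterate, which no step follows: any trial point lies above the lower bound, so
that bound serves as a noiseless next value. -/
lemma ModelDecrease.of_lower_bound (hT : HasCubicTaylor 1 f g h) {fmin : ℝ}
    (hmin : ∀ x, fmin ≤ f x) : ModelDecrease (g x) (h x) (f x - fmin) 0 := fun w hw => by
  have h1 := (hT.value_le x w (pow_le_one₀ (norm_nonneg w) hw)).1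
  linarith [hmin (x + w)]

/-- The telescoped gradient bounds contain the value after the first step, which noise may raise
above the initial value; comparison with the zero step limits the rise. -/
lemma value_step_le (hT : HasCubicTaylor 1 f g h) (hs : IsTRSolution c gh Bh 1 v) :
    f (x + v) ≤ f x + 1 / 6 + ‖gh - g x‖ + 1 / 2 * ‖Bh - h x‖ := by
  have h1 := (hT.value_le x v (pow_le_one₀ (norm_nonneg v) hs.1)).1
  have h2 := (abs_le.1 (abs_model_sub_le (g x) gh v (h x) Bh)).2
  have h4 := hs.2 0 (by simp)
  simp only [trModel, inner_zero_right, inner_zero_left] at h4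
  have b1 : ‖gh - g x‖ * ‖v‖ ≤ ‖gh - g x‖ := mul_le_of_le_one_right (norm_nonneg _) hs.1
  have b3 : ‖Bh - h x‖ * ‖v‖ ^ 2 ≤ ‖Bh - h x‖ :=
    mul_le_of_le_one_right (norm_nonneg _) (pow_le_one₀ (norm_nonneg v) hs.1)
  linarith

/-- Averaging the bounds for `v` and `-v` cancels the gradient. -/
lemma ModelDecrease.neg_le_inner {B : Param d →L[ℝ] Param d} {g : Param d} {D n : ℝ}
    (hD : ModelDecrease g B D n) {v : Param d} (hv : ‖v‖ = 1) :
    -(2 * (D + 1 / 6 + n)) ≤ inner ℝ v (B v) := by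
  have h1 := hD v hv.le
  have h2 := hD (-v) (by rw [norm_neg, hv])
  simp only [map_neg, inner_neg_right, inner_neg_left, neg_neg] at h2
  linarith

/-- The new gradient is small up to its component along the step. -/
lemma sq_norm_grad_step_le (hT : HasCubicTaylor 1 f g h) (hs : IsTRSolution c gh Bh 1 v)
    (hB : IsSymm Bh) :
    ‖g (x + v)‖ ^ 2 ≤ (max (-inner ℝ (g (x + v)) v) 0) ^ 2 +
      (1 / 2 + ‖gh - g x‖ + ‖Bh - h x‖) ^ 2 := by
  obtain ⟨l, hl, hw, hlv⟩ := hs.exists_multiplier hB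
  set q := g (x + v) + l • v with hq
  have hgq : g (x + v) = q - l • v := by rw [hq]; abel
  have hqn : ‖q‖ ≤ 1 / 2 + ‖gh - g x‖ + ‖Bh - h x‖ := by
    have h1 : q = (g (x + v) - g x - h x v) - (gh - g x) - (Bh - h x) v := by
      rw [hq, show l • v = -(gh + Bh v) by rw [hw, neg_neg], sub_apply]; abel
    rw [h1]
    refine (norm_sub_le _ _).trans (add_le_add ((norm_sub_le _ _).trans (add_le_add_left ?_ _)) ?_)
    · refine (hT.grad x v).trans ?_
      have := pow_le_one₀ (n := 2) (norm_nonneg v) hs.1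
      linarith
    · exact ((Bh - h x).le_opNorm v).trans (mul_le_of_le_one_right (norm_nonneg _) hs.1)
  have hq2 : ‖q‖ ^ 2 ≤ (1 / 2 + ‖gh - g x‖ + ‖Bh - h x‖) ^ 2 :=
    pow_le_pow_left₀ (norm_nonneg _) hqn 2
  rcases hlv with rfl | hv1
  · rw [hgq]
    simp only [zero_smul, sub_zero]
    nlinarith [sq_nonneg (max (-inner ℝ q v) 0)]
  · have e1 : inner ℝ (g (x + v)) v = inner ℝ q v - l := by
      rw [hgq, inner_sub_left, inner_smul_left, real_inner_self_eq_norm_sq, hv1]; simp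
    have e2 : ‖g (x + v)‖ ^ 2 = ‖q‖ ^ 2 - 2 * (l * inner ℝ q v) + l ^ 2 := by
      rw [hgq, norm_sub_sq_real, inner_smul_right, norm_smul, hv1, mul_one, Real.norm_eq_abs, sq_abs]
    rw [e1, e2]
    -- In the first case the part of `q` along `v` merges with the multiplier into the one-sided
    -- component. In the second that component vanishes and, since `0 ≤ l`, removing `l • v` only
    -- shortens `q`.
    rcases le_total (inner ℝ q v) l with hle | hle
    · rw [max_eq_left (by linarith)]
      nlinarith [sq_nonneg (inner ℝ q v)]
    · rw [max_eq_right (by linarith)]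
      nlinarith

/-- The gradient after a trust-region step is controlled by the decrease in two consecutive steps
and the sampling errors. -/
theorem norm_grad_step_le (hT : HasCubicTaylor 1 f g h) (hs : IsTRSolution c gh Bh 1 v)
    (hB : IsSymm Bh) {D n : ℝ} (hD : ModelDecrease (g (x + v)) (h (x + v)) D n) :
    ‖g (x + v)‖ ≤ 5 / 8 + 1 / 2 * (f x - f (x + v) + D) + 5 / 4 * ‖gh - g x‖ +
        17 / 16 * ‖Bh - h x‖ + 1 / 2 * n ∧
      25 / 48 ≤ 5 / 8 + 1 / 2 * (f x - f (x + v) + D) + 5 / 4 * ‖gh - g x‖ +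
        17 / 16 * ‖Bh - h x‖ + 1 / 2 * n := by
  have hv3 : ‖v‖ ^ 3 ≤ 1 := pow_le_one₀ (norm_nonneg v) hs.1
  have hG := sq_norm_grad_step_le (x := x) hT hs hB
  set y := x + v with hy
  set u := -inner ℝ (g y) v with hu
  set eg := ‖gh - g x‖ with heg
  set eH := ‖Bh - h x‖ with heH
  have heg0 : 0 ≤ eg := norm_nonneg _
  have heH0 : 0 ≤ eH := norm_nonneg _
  -- Continuing from `y` by `v` bounds the curvature along `v` from below; expanding from `y` back
  -- to `x` bounds it from above. Eliminating it leaves a bound on `u`.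
  have hA : 2 * u - 1 / 3 ≤ f x - f y + D + n := by
    have h1 := hD v hs.1
    have h2 := (hT.value_le y (-v) (r := 1) (by rwa [norm_neg])).2
    rw [show y + -v = x by rw [hy]; abel] at h2
    simp only [map_neg, inner_neg_right, inner_neg_left, neg_neg] at h2
    linarith
  -- Comparison at the midpoint of the step. Optimality against 0 and `-v` makes the noisy model
  -- nonpositive at half the step, so the midpoint value is at most `f x` up to errors; the decrease
  -- bound at `y` keeps it from being far below `f y`. This prevents the right-hand side of the main
  -- estimate from being small.
  have hBd : -(5 / 24) - 1 / 2 * eg - 1 / 8 * eH ≤ f x - f y + D + n := by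
    have hn : ‖(1 / 2 : ℝ) • v‖ = ‖v‖ / 2 := by rw [norm_smul]; norm_num; ring
    have hn3 : ‖(1 / 2 : ℝ) • v‖ ^ 3 ≤ 1 / 8 := by rw [hn]; linarith [show (‖v‖ / 2) ^ 3 = ‖v‖ ^ 3 / 8 by ring]
    have h1 := hD (-((1 / 2 : ℝ) • v)) (by rw [norm_neg, hn]; linarith [hs.1])
    have h2 := (hT.value_le y (-((1 / 2 : ℝ) • v)) (r := 1 / 8) (by rwa [norm_neg])).2
    have h3 := (hT.value_le x ((1 / 2 : ℝ) • v) hn3).1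
    rw [show y + -((1 / 2 : ℝ) • v) = x + (1 / 2 : ℝ) • v by rw [hy]; module] at h2
    have h4 := (abs_le.1 (abs_model_sub_le (g x) gh ((1 / 2 : ℝ) • v) (h x) Bh)).2
    rw [hn] at h4
    have h5 := hs.2 0 (by simp)
    have h6 := hs.2 (-v) (by rw [norm_neg]; exact hs.1)
    simp only [trModel, map_neg, map_smul, inner_neg_right, inner_neg_left, neg_neg,
      inner_smul_left, inner_smul_right, inner_zero_right, inner_zero_left,
      conj_trivial] at h1 h2 h3 h4 h5 h6
    have b1 : eg * ‖v‖ ≤ eg := mul_le_of_le_one_right heg0 hs.1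
    have b3 : eH * ‖v‖ ^ 2 ≤ eH := mul_le_of_le_one_right heH0 (pow_le_one₀ (norm_nonneg v) hs.1)
    linarith
  refine ⟨?_, by linarith⟩
  -- For small `u` the inequality (1/8)² + (1/2)² ≤ (25/48)² and the midpoint bound suffice. For
  -- larger `u` the square root is at most `u` + 11/24 + errors, and 11/24 + 1/6 = 5/8.
  rcases le_total u (1 / 8) with h8 | h8
  · have hm : (max u 0) ^ 2 ≤ 1 / 64 := by
      have h1 : max u 0 ≤ 1 / 8 := max_le h8 (by norm_num)
      nlinarith [le_max_right u 0]
    have : ‖g y‖ ≤ 25 / 48 + eg + eH := by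
      refine abs_le_of_sq_le_sq' ?_ (by positivity) |>.2
      nlinarith
    linarith
  · rw [max_eq_left (by linarith)] at hG
    have : ‖g y‖ ≤ u + 11 / 24 + eg + eH := by
      refine abs_le_of_sq_le_sq' ?_ (by positivity) |>.2
      nlinarith [mul_nonneg (sub_nonneg.2 h8) heg0, mul_nonneg (sub_nonneg.2 h8) heH0]
    linarith

end TrustRegion

/-! ### Variational bounds for the smallest eigenvalue. -/

section SmallestEigenvalue

variable {d : ℕ}

lemma le_lambdaMin (hd : 0 < d) {B : Param d →L[ℝ] Param d} (hB : IsSymm B) {c : ℝ}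
    (h : ∀ v : Param d, ‖v‖ = 1 → c ≤ inner ℝ v (B v)) : c ≤ lambdaMin B := by
  have : Nonempty (Fin d) := ⟨⟨0, hd⟩⟩
  refine le_csInf ?_ fun l hl => ?_
  · by_contra hne
    have hs : (B : Param d →ₗ[ℝ] Param d).IsSymmetric := hB
    have := hs.subsingleton_of_no_eigenvalue_finiteDimensional fun l => by
      by_contra hl
      exact hne ⟨l, hl⟩
    exact not_subsingleton (Param d) this
  · obtain ⟨w, hw⟩ := Module.End.HasEigenvalue.exists_hasEigenvector hl
    have hw0 : 0 < ‖w‖ := norm_pos_iff.2 hw.2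
    have h1 := h (‖w‖⁻¹ • w) (by rw [norm_smul, norm_inv, norm_norm, inv_mul_cancel₀ hw0.ne'])
    have h2 : B w = l • w := hw.apply_eq_smul
    rw [map_smul, h2, inner_smul_left, inner_smul_right, inner_smul_right,
      real_inner_self_eq_norm_sq] at h1
    calc c ≤ _ := h1
      _ = l := by simp; field_simp

lemma lambdaMin_le_inner {B : Param d →L[ℝ] Param d} (hB : IsSymm B) {v : Param d}
    (hv : ‖v‖ = 1) : lambdaMin B ≤ inner ℝ v (B v) := by
  obtain ⟨b, l, hl⟩ := hB.exists_eigenbasis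
  have hbd : BddBelow {c : ℝ | Module.End.HasEigenvalue (B : Param d →ₗ[ℝ] Param d) c} := by
    have hfin : {c : ℝ | Module.End.HasEigenvalue (B : Param d →ₗ[ℝ] Param d) c}.Finite :=
      Module.End.finite_hasEigenvalue _
    exact hfin.bddBelow
  have hl' : ∀ i, B (b i) = l i • b i := fun i => by simpa using hl i 1
  have hle : ∀ i, lambdaMin B ≤ l i := fun i => csInf_le hbd
    (Module.End.hasEigenvalue_of_hasEigenvector (x := b i)
      ⟨Module.End.mem_eigenspace_iff.2 (hl' i), fun h0 => by simpa [h0] using b.norm_eq_one i⟩)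
  have h1 : inner ℝ v (B v) = ∑ i, l i * inner ℝ (b i) v ^ 2 := by
    rw [← b.sum_inner_mul_inner v (B v)]
    refine Finset.sum_congr rfl fun i _ => ?_
    rw [← hB (b i) v, hl' i, inner_smul_left, real_inner_comm]
    simp only [conj_trivial]
    ring
  have h2 : ∑ i, inner ℝ (b i) v ^ 2 = 1 := by
    rw [← one_pow (M := ℝ) 2, ← hv, ← b.sum_sq_norm_inner_right v]
    simp
  rw [h1, ← mul_one (lambdaMin B), ← h2, Finset.mul_sum]
  exact Finset.sum_le_sum fun i _ => mul_le_mul_of_nonneg_right (hle i) (sq_nonneg _)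

/-- Weyl's inequality, needed for the continuity, hence measurability, of the smallest eigenvalue
along the iterates. -/
lemma abs_lambdaMin_sub_le (hd : 0 < d) {B C : Param d →L[ℝ] Param d} (hB : IsSymm B)
    (hC : IsSymm C) : |lambdaMin B - lambdaMin C| ≤ ‖B - C‖ := by
  have key : ∀ {B C : Param d →L[ℝ] Param d}, IsSymm B → IsSymm C →
      lambdaMin C - ‖B - C‖ ≤ lambdaMin B := fun {B C} hB hC => by
    refine le_lambdaMin hd hB fun v hv => ?_
    have h1 := lambdaMin_le_inner hC hv
    have h2 : |inner ℝ v ((B - C) v)| ≤ ‖B - C‖ := by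
      refine (abs_real_inner_le_norm _ _).trans ?_
      have := (B - C).le_opNorm v
      rw [hv] at this ⊢
      linarith
    rw [sub_apply, inner_sub_right] at h2
    linarith [(abs_le.1 h2).1]
  have h1 := key hB hC
  have h2 := key hC hB
  rw [norm_sub_rev] at h2
  exact abs_le.2 ⟨by linarith, by linarith⟩

end SmallestEigenvalue

end SOPO

namespace SOPO

/-! ### Summation along a path. -/

section Path

variable {d : ℕ}

/-- The bound on the gradient norm after the `k`-th step in terms of the values `a` of the objective
and the sampling errors `p` and `q`. -/
noncomputable def gradBound (a p q : ℕ → ℝ) (k : ℕ) : ℝ :=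
  5 / 8 + 1 / 2 * (a k - a (k + 2)) + 5 / 4 * p k + 17 / 16 * q k +
    1 / 2 * (2 * p (k + 1) + q (k + 1))

/-- The bound on the negative curvature after the `k`-th step. -/
noncomputable def curvBound (a p q : ℕ → ℝ) (k : ℕ) : ℝ :=
  2 * (a (k + 1) - a (k + 2) + 1 / 6 + (2 * p (k + 1) + q (k + 1)))

lemma sum_bounds_le {a p q : ℕ → ℝ} {T : ℕ} (hT : 1 ≤ T) (hp : ∀ k < T, p k ≤ 1 / 48)
    (hq : ∀ k < T, q k ≤ 1 / 48) (hpT : p T = 0) (hqT : q T = 0)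
    (h0 : a 0 - a (T + 1) ≤ T / 192) (hmin : ∀ k ≤ T, a (T + 1) ≤ a k)
    (h1 : a 1 ≤ a 0 + 1 / 6 + p 0 + 1 / 2 * q 0) :
    ∑ k ∈ Finset.range T, gradBound a p q k ≤ 571 / 768 * T ∧
      ∑ k ∈ Finset.range T, curvBound a p q k ≤ T := by
  obtain ⟨n, rfl⟩ : ∃ n, T = n + 1 := ⟨T - 1, by omega⟩
  have hs1 : ∑ k ∈ Finset.range (n + 1), (a k - a (k + 2)) = a 0 + a 1 - a (n + 1) - a (n + 2) := by
    have := Finset.sum_range_sub' (fun k => a k + a (k + 1)) (n + 1)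
    rw [← sub_sub] at this
    rw [← this]
    refine Finset.sum_congr rfl fun k _ => ?_
    ring
  have hs2 : ∑ k ∈ Finset.range (n + 1), (a (k + 1) - a (k + 2)) = a 1 - a (n + 2) :=
    Finset.sum_range_sub' (fun k => a (k + 1)) (n + 1)
  have hbound : ∀ {p : ℕ → ℝ}, (∀ k < n + 1, p k ≤ 1 / 48) → p (n + 1) = 0 →
      ∑ k ∈ Finset.range (n + 1), p k ≤ (n + 1) / 48 ∧
        ∑ k ∈ Finset.range (n + 1), p (k + 1) ≤ n / 48 := fun {p} hp hpT => by
    constructor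
    · refine (Finset.sum_le_card_nsmul _ _ _ fun k hk => hp k (Finset.mem_range.1 hk)).trans_eq ?_
      simp; ring
    · rw [Finset.sum_range_succ, hpT, add_zero]
      refine (Finset.sum_le_card_nsmul _ _ (1 / 48) fun k hk =>
        hp _ (by have := Finset.mem_range.1 hk; omega)).trans_eq ?_
      simp; ring
  obtain ⟨hp1, hp2⟩ := hbound hp hpT
  obtain ⟨hq1, hq2⟩ := hbound hq hqT
  have hp0 := hp 0 (by omega)
  have hq0 := hq 0 (by omega)
  have hm := hmin (n + 1) le_rfl
  push_cast at h0 ⊢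
  have hG : ∑ k ∈ Finset.range (n + 1), gradBound a p q k = 5 / 8 * (n + 1) +
      1 / 2 * (a 0 + a 1 - a (n + 1) - a (n + 2)) + 5 / 4 * ∑ k ∈ Finset.range (n + 1), p k +
      17 / 16 * ∑ k ∈ Finset.range (n + 1), q k + 1 / 2 * (2 * ∑ k ∈ Finset.range (n + 1), p (k + 1)
        + ∑ k ∈ Finset.range (n + 1), q (k + 1)) := by
    simp only [gradBound, Finset.sum_add_distrib, ← Finset.mul_sum, hs1]
    simp; ring
  have hC : ∑ k ∈ Finset.range (n + 1), curvBound a p q k = 2 * (a 1 - a (n + 2) + 1 / 6 * (n + 1) +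
      (2 * ∑ k ∈ Finset.range (n + 1), p (k + 1) + ∑ k ∈ Finset.range (n + 1), q (k + 1))) := by
    simp only [curvBound, Finset.sum_add_distrib, ← Finset.mul_sum, hs2]
    simp; ring
  rw [hG, hC]
  -- With a single iteration the value after the first step cancels. Otherwise its possible rise, at
  -- most 19/96, is spread over at least two iterations; the constant 571/768 is attained by this
  -- accounting at two iterations.
  rcases Nat.eq_zero_or_pos n with rfl | hn
  · norm_num at *
    constructor <;> linarith
  · have hn1 : (1 : ℝ) ≤ n := by exact_mod_cast hn
    constructor <;> linarith

lemma bounds_of_unit_path {f : Param d → ℝ} {g : Param d → Param d}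
    {h : Param d → Param d →L[ℝ] Param d} (hT : HasCubicTaylor 1 f g h) {fmin : ℝ}
    (hmin : ∀ x, fmin ≤ f x) {T : ℕ} {x : ℕ → Param d} {gh : ℕ → Param d}
    {Bh : ℕ → Param d →L[ℝ] Param d} (hB : ∀ t, IsSymm (Bh t))
    (hs : ∀ t < T, IsTRSolution (f (x t)) (gh t) (Bh t) 1 (x (t + 1) - x t)) {a p q : ℕ → ℝ}
    (ha : ∀ t ≤ T, a t = f (x t)) (haT : a (T + 1) = fmin)
    (hp : ∀ t < T, p t = ‖gh t - g (x t)‖) (hpT : p T = 0)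
    (hq : ∀ t < T, q t = ‖Bh t - h (x t)‖) (hqT : q T = 0) :
    (∀ k < T, ‖g (x (k + 1))‖ ≤ gradBound a p q k ∧ 25 / 48 ≤ gradBound a p q k ∧
      ∀ v : Param d, ‖v‖ = 1 → -curvBound a p q k ≤ inner ℝ v (h (x (k + 1)) v)) ∧
    (1 ≤ T → a 1 ≤ a 0 + 1 / 6 + p 0 + 1 / 2 * q 0) := by
  have hx : ∀ t, x t + (x (t + 1) - x t) = x (t + 1) := fun t => by abel
  have hdec : ∀ t ≤ T, ModelDecrease (g (x t)) (h (x t)) (a t - a (t + 1)) (2 * p t + q t) := by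
    intro t ht
    rcases ht.lt_or_eq with hlt | rfl
    · have := ModelDecrease.of_step (x := x t) hT (hs t hlt)
      rwa [hx, ← ha t ht, ← ha (t + 1) hlt, ← hp t hlt, ← hq t hlt] at this
    · rw [haT, hpT, hqT, ha t le_rfl, mul_zero, add_zero]
      exact ModelDecrease.of_lower_bound hT hmin
  refine ⟨fun k hk => ?_, fun h1 => ?_⟩
  · have hd := hdec (k + 1) hk
    have h1 := norm_grad_step_le (x := x k) hT (hs k hk) (hB k) (by rw [hx]; exact hd)
    rw [hx, ← ha k hk.le, ← ha (k + 1) hk, ← hp k hk, ← hq k hk] at h1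
    have he : gradBound a p q k = 5 / 8 + 1 / 2 * (a k - a (k + 1) + (a (k + 1) - a (k + 1 + 1))) +
        5 / 4 * p k + 17 / 16 * q k + 1 / 2 * (2 * p (k + 1) + q (k + 1)) := by
      rw [gradBound]; ring
    rw [he]
    refine ⟨h1.1, h1.2, fun v hv => ?_⟩
    exact hd.neg_le_inner hv
  · have := value_step_le (x := x 0) hT (hs 0 h1)
    rwa [hx, ← ha 0 (by omega), ← ha (0 + 1) h1, ← hp 0 h1, ← hq 0 h1] at this

/-- The path-wise bounds, in the units of a general Lipschitz constant `M` and radius `r`. -/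
lemma bounds_of_path {M r : ℝ} (hM : 0 < M) (hr : 0 < r) {f : Param d → ℝ}
    {g : Param d → Param d} {h : Param d → Param d →L[ℝ] Param d} (hT : HasCubicTaylor M f g h)
    {fmin : ℝ} (hmin : ∀ x, fmin ≤ f x) {T : ℕ} {x : ℕ → Param d} {gh : ℕ → Param d}
    {Bh : ℕ → Param d →L[ℝ] Param d} (hB : ∀ t, IsSymm (Bh t))
    (hs : ∀ t < T, IsTRSolution (f (x t)) (gh t) (Bh t) r (x (t + 1) - x t)) {a p q : ℕ → ℝ}
    (ha : ∀ t ≤ T, a t = (M * r ^ 3)⁻¹ * f (x t)) (haT : a (T + 1) = (M * r ^ 3)⁻¹ * fmin)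
    (hp : ∀ t < T, p t = (M * r ^ 2)⁻¹ * ‖gh t - g (x t)‖) (hpT : p T = 0)
    (hq : ∀ t < T, q t = (M * r)⁻¹ * ‖Bh t - h (x t)‖) (hqT : q T = 0) :
    (∀ k < T, (M * r ^ 2)⁻¹ * ‖g (x (k + 1))‖ ≤ gradBound a p q k ∧ 25 / 48 ≤ gradBound a p q k ∧
      ∀ v : Param d, ‖v‖ = 1 → -(M * r * curvBound a p q k) ≤ inner ℝ v (h (x (k + 1)) v)) ∧
    (1 ≤ T → a 1 ≤ a 0 + 1 / 6 + p 0 + 1 / 2 * q 0) := by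
  have h1 : 0 < M * r := by positivity
  have h2 : 0 < (M * r ^ 2)⁻¹ := by positivity
  have hx : ∀ t, r • r⁻¹ • x t = x t := fun t => smul_inv_smul₀ hr.ne' _
  have key := bounds_of_unit_path (hT.rescale hM hr) (fmin := (M * r ^ 3)⁻¹ * fmin)
    (fun y => mul_le_mul_of_nonneg_left (hmin _) (by positivity)) (T := T)
    (x := fun t => r⁻¹ • x t) (gh := fun t => (M * r ^ 2)⁻¹ • gh t)
    (Bh := fun t => (M * r)⁻¹ • Bh t) (a := a) (p := p) (q := q) (fun t => (hB t).smul _)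
    (fun t ht => by
      have := (hs t ht).rescale hM hr
      rw [hx, ← smul_sub]
      exact this)
    (fun t ht => by rw [hx, ha t ht]) haT
    (fun t ht => by
      rw [hx, hp t ht, ← smul_sub, norm_smul, Real.norm_of_nonneg h2.le]) hpT
    (fun t ht => by
      have hsub : (M * r)⁻¹ • Bh t - (M * r)⁻¹ • h (x t) = (M * r)⁻¹ • (Bh t - h (x t)) :=
        (smul_sub _ _ _).symm
      rw [hx, hq t ht, hsub, norm_smul, Real.norm_of_nonneg (inv_pos.2 h1).le]) hqT
  refine ⟨fun k hk => ?_, key.2⟩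
  obtain ⟨k1, k2, k3⟩ := key.1 k hk
  simp only [hx, norm_smul, Real.norm_of_nonneg h2.le] at k1 k3
  refine ⟨k1, k2, fun v hv => ?_⟩
  have := k3 v hv
  rw [smul_apply, inner_smul_right, inv_mul_eq_div, le_div_iff₀ h1] at this
  linarith

end Path

/-! ### Evaluation at an independent uniform index. -/

section UniformIndex

variable {Ω : Type*} [MeasurableSpace Ω] {μ : Measure Ω}

lemma measure_preimage_of_uniform {T : ℕ} {tbar : Ω → ℕ} (htbar : Measurable tbar)
    (hunif : μ.map tbar = uniformOn (Set.Icc 1 T)) {k : ℕ} (hk : k < T) :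
    μ.real (tbar ⁻¹' {k + 1}) = (T : ℝ)⁻¹ := by
  have h1 : ((Finset.Icc 1 T : Finset ℕ) : Set ℕ) = Set.Icc 1 T := Finset.coe_Icc 1 T
  have h2 : Finset.Icc 1 T ∩ {k + 1} = {k + 1} :=
    Finset.inter_singleton_of_mem (Finset.mem_Icc.2 ⟨by omega, hk⟩)
  rw [measureReal_def, ← Measure.map_apply htbar (measurableSet_singleton _), hunif, ← h1,
    ← Finset.coe_singleton, uniformOn_apply_finset, h2]
  simp

/-- Evaluating a process at an independent uniform index averages the expectations. -/
lemma integral_comp_uniform_index {X : Type*} [MeasurableSpace X] {T : ℕ} (hT : 1 ≤ T)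
    {θ : ℕ → Ω → X} {tbar : Ω → ℕ} (htbar : Measurable tbar)
    (hunif : μ.map tbar = uniformOn (Set.Icc 1 T))
    (hindep : IndepFun (fun ω (t : Fin (T + 1)) => θ t ω) tbar μ) {φ : X → ℝ} (hφ : Measurable φ)
    (hi : ∀ k < T, Integrable (fun ω => φ (θ (k + 1) ω)) μ) :
    Integrable (fun ω => φ (θ (tbar ω) ω)) μ ∧
      ∫ ω, φ (θ (tbar ω) ω) ∂μ =
        (T : ℝ)⁻¹ * ∑ k ∈ Finset.range T, ∫ ω, φ (θ (k + 1) ω) ∂μ := by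
  have hmem : ∀ᵐ ω ∂μ, tbar ω ∈ Set.Icc 1 T := by
    refine ae_of_ae_map htbar.aemeasurable ?_
    rw [hunif]
    have : IsProbabilityMeasure (uniformOn (Set.Icc 1 T)) :=
      isProbabilityMeasure_uniformOn (Set.finite_Icc 1 T) ⟨1, le_rfl, hT⟩
    exact (prob_compl_eq_zero_iff measurableSet_Icc).2
      (uniformOn_self (Set.finite_Icc 1 T) ⟨1, le_rfl, hT⟩)
  -- Almost surely exactly one of the events `tbar = k + 1` occurs; on each of them independence
  -- factors the expectation.
  have heq : (fun ω => φ (θ (tbar ω) ω)) =ᵐ[μ] fun ω => ∑ k ∈ Finset.range T,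
      (tbar ⁻¹' {k + 1}).indicator (fun ω => φ (θ (k + 1) ω)) ω := by
    filter_upwards [hmem] with ω hω
    obtain ⟨h1, h2⟩ := hω
    rw [Finset.sum_eq_single (tbar ω - 1)]
    · have : tbar ω - 1 + 1 = tbar ω := by omega
      rw [Set.indicator_of_mem (by simp [this]), this]
    · intro k _ hk
      refine Set.indicator_of_notMem ?_ _
      simp only [Set.mem_preimage, Set.mem_singleton_iff]
      omega
    · intro hn
      exact absurd (Finset.mem_range.2 (by omega)) hn
  have hset : ∀ k, MeasurableSet (tbar ⁻¹' {k + 1}) := fun k => htbar (measurableSet_singleton _)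
  have hind : ∀ k < T, Integrable
      ((tbar ⁻¹' {k + 1}).indicator fun ω => φ (θ (k + 1) ω)) μ :=
    fun k hk => (hi k hk).indicator (hset k)
  have hval : ∀ k < T, ∫ ω, (tbar ⁻¹' {k + 1}).indicator (fun ω => φ (θ (k + 1) ω)) ω ∂μ =
      (T : ℝ)⁻¹ * ∫ ω, φ (θ (k + 1) ω) ∂μ := fun k hk => by
    have hI : IndepFun (fun ω => (({k + 1} : Set ℕ).indicator (fun _ => (1 : ℝ)) (tbar ω)))
        (fun ω => φ (θ (k + 1) ω)) μ := by
      have := hindep.symm.comp (φ := ({k + 1} : Set ℕ).indicator fun _ => (1 : ℝ))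
        (ψ := fun z : Fin (T + 1) → X => φ (z ⟨k + 1, by omega⟩))
        (measurable_of_countable _) (hφ.comp (measurable_pi_apply _))
      exact this
    have h1 := hI.integral_fun_mul_eq_mul_integral
      ((measurable_of_countable (({k + 1} : Set ℕ).indicator fun _ => (1 : ℝ))).comp
        htbar).aestronglyMeasurable (hi k hk).aestronglyMeasurable
    have h2 : ∫ ω, (({k + 1} : Set ℕ).indicator (fun _ => (1 : ℝ)) (tbar ω)) ∂μ = (T : ℝ)⁻¹ := by
      rw [← measure_preimage_of_uniform htbar hunif hk, ← integral_indicator_one (hset k)]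
      rfl
    rw [h2] at h1
    rw [← h1]
    refine integral_congr_ae (Eventually.of_forall fun ω => ?_)
    by_cases hω : tbar ω = k + 1 <;> simp [Set.indicator, hω]
  constructor
  · exact (integrable_finsetSum _ fun k hk => hind k (Finset.mem_range.1 hk)).congr heq.symm
  · rw [integral_congr_ae heq, integral_finsetSum _ fun k hk => hind k (Finset.mem_range.1 hk),
      Finset.mul_sum]
    exact Finset.sum_congr rfl fun k hk => hval k (Finset.mem_range.1 hk)

end UniformIndex

end SOPO

namespace SOPO

variable {S A : Type*} [MeasurableSpace S] [MeasurableSpace A] {d : ℕ}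
variable {m : MDP S A} {π : Policy S A d} {H : ℕ} {R G L M : ℝ}

/-! ### Regularity of the objective. -/

section Objective

lemma hasCubicTaylor_J (hR : 0 ≤ R) (hG : 0 < G) (hcost : BoundedCost m R)
    (hLS : ExpectedLS m π H G L) (hLip : LipschitzHessian m π H M) :
    HasCubicTaylor M (J m π H) (gradient (J m π H)) (hess (J m π H)) := by
  refine HasCubicTaylor.of_lipschitz (fun θ => ?_) (fun θ => ?_) hLip
  · exact (hasGradientAt_J hR hcost (hLS.scoreL2 hG) θ).differentiableAt.hasGradientAt
  · exact (hasFDerivAt_gradient_J hR hG hcost hLS θ).differentiableAt.hasFDerivAt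

lemma continuous_J (hR : 0 ≤ R) (hG : 0 < G) (hcost : BoundedCost m R)
    (hLS : ExpectedLS m π H G L) : Continuous (J m π H) :=
  continuous_iff_continuousAt.2 fun θ =>
    (hasGradientAt_J hR hcost (hLS.scoreL2 hG) θ).differentiableAt.continuousAt

lemma continuous_gradient_J (hR : 0 ≤ R) (hG : 0 < G) (hcost : BoundedCost m R)
    (hLS : ExpectedLS m π H G L) : Continuous (gradient (J m π H)) :=
  continuous_iff_continuousAt.2 fun θ =>
    (hasFDerivAt_gradient_J hR hG hcost hLS θ).differentiableAt.continuousAt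

lemma LipschitzHessian.continuous (hM : 0 < M) (hLip : LipschitzHessian m π H M) :
    Continuous (hess (J m π H)) :=
  (LipschitzWith.of_dist_le_mul (K := ⟨M, hM.le⟩) fun x y => by
    rw [dist_eq_norm, dist_eq_norm]
    exact hLip x y).continuous

lemma continuous_lambdaMin_hess_J (hd : 0 < d) (hR : 0 ≤ R) (hG : 0 < G) (hcost : BoundedCost m R)
    (hLS : ExpectedLS m π H G L) (hM : 0 < M) (hLip : LipschitzHessian m π H M) :
    Continuous fun θ => lambdaMin (hess (J m π H) θ) :=
  (LipschitzWith.of_dist_le_mul (K := ⟨M, hM.le⟩) fun x y => by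
    rw [dist_eq_norm, dist_eq_norm]
    exact (abs_lambdaMin_sub_le hd (isSymm_hess_J hR hG hcost hLS x)
      (isSymm_hess_J hR hG hcost hLS y)).trans (hLip x y)).continuous

lemma norm_hess_J_le (hR : 0 ≤ R) (hG : 0 < G) (hcost : BoundedCost m R)
    (hLS : ExpectedLS m π H G L) (θ : Param d) :
    ‖hess (J m π H) θ‖ ≤ √(2 * varHess m.discount R G L H) := by
  obtain ⟨h1, h2⟩ := integral_sq_hessEst_le hR hG hcost hLS θ
  rw [hess_J hR hG hcost hLS θ]
  exact Real.le_sqrt_of_sq_le ((sq_norm_integral_le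
    (integrable_of_sq (stronglyMeasurable_hessEst m π θ) h1) h1).trans h2)

/-- The trust-region analysis bounds the smallest eigenvalue only from below; this upper bound is
needed for its integrability. -/
lemma lambdaMin_hess_J_le (hd : 0 < d) (hR : 0 ≤ R) (hG : 0 < G) (hcost : BoundedCost m R)
    (hLS : ExpectedLS m π H G L) (θ : Param d) :
    lambdaMin (hess (J m π H) θ) ≤ √(2 * varHess m.discount R G L H) := by
  have hv : ‖(EuclideanSpace.single ⟨0, hd⟩ 1 : Param d)‖ = 1 := by simp
  refine (lambdaMin_le_inner (isSymm_hess_J hR hG hcost hLS θ) hv).trans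
    ((real_inner_le_norm _ _).trans ?_)
  have h1 := (hess (J m π H) θ).le_opNorm (EuclideanSpace.single ⟨0, hd⟩ 1)
  rw [hv] at h1 ⊢
  linarith [norm_hess_J_le hR hG hcost hLS θ]

lemma bddBelow_range_J (hR : 0 ≤ R) (hcost : BoundedCost m R) :
    BddBelow (Set.range (J m π H)) := by
  refine ⟨-(R / (1 - m.discount)), ?_⟩
  rintro _ ⟨θ, rfl⟩
  exact (abs_le.1 (abs_J_le hR hcost H θ)).1

end Objective

/-! ### Expected bounds along a run of the algorithm. -/

section Run

variable {Ω : Type*} [mΩ : MeasurableSpace Ω] {μ : Measure Ω} [IsProbabilityMeasure μ]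

lemma integral_gradBound {a p q : ℕ → Ω → ℝ} (ha : ∀ t, Integrable (a t) μ)
    (hp : ∀ t, Integrable (p t) μ) (hq : ∀ t, Integrable (q t) μ) (k : ℕ) :
    Integrable (fun ω => gradBound (a · ω) (p · ω) (q · ω) k) μ ∧
      ∫ ω, gradBound (a · ω) (p · ω) (q · ω) k ∂μ =
        gradBound (fun t => ∫ ω, a t ω ∂μ) (fun t => ∫ ω, p t ω ∂μ) (fun t => ∫ ω, q t ω ∂μ) k := by
  have i1 : Integrable (fun ω => 1 / 2 * (a k ω - a (k + 2) ω)) μ :=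
    ((ha k).sub (ha (k + 2))).const_mul _
  have i2 : Integrable (fun ω => 5 / 4 * p k ω) μ := (hp k).const_mul _
  have i3 : Integrable (fun ω => 17 / 16 * q k ω) μ := (hq k).const_mul _
  have i4' : Integrable (fun ω => 2 * p (k + 1) ω) μ := (hp (k + 1)).const_mul _
  have i4 : Integrable (fun ω => 1 / 2 * (2 * p (k + 1) ω + q (k + 1) ω)) μ :=
    (i4'.add (hq (k + 1))).const_mul _
  have i0 : Integrable (fun _ : Ω => (5 / 8 : ℝ)) μ := integrable_const _
  have j1 : Integrable (fun ω => 5 / 8 + 1 / 2 * (a k ω - a (k + 2) ω)) μ := i0.add i1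
  have j2 : Integrable (fun ω => 5 / 8 + 1 / 2 * (a k ω - a (k + 2) ω) + 5 / 4 * p k ω) μ :=
    j1.add i2
  have j3 : Integrable (fun ω => 5 / 8 + 1 / 2 * (a k ω - a (k + 2) ω) + 5 / 4 * p k ω +
    17 / 16 * q k ω) μ := j2.add i3
  refine ⟨j3.add i4, ?_⟩
  simp only [gradBound]
  rw [integral_add j3 i4, integral_add j2 i3, integral_add j1 i2, integral_add i0 i1,
    integral_const_mul, integral_const_mul, integral_const_mul, integral_const_mul,
    integral_sub (ha k) (ha (k + 2)), integral_add i4' (hq (k + 1)), integral_const_mul]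
  simp

lemma integral_curvBound {a p q : ℕ → Ω → ℝ} (ha : ∀ t, Integrable (a t) μ)
    (hp : ∀ t, Integrable (p t) μ) (hq : ∀ t, Integrable (q t) μ) (k : ℕ) :
    Integrable (fun ω => curvBound (a · ω) (p · ω) (q · ω) k) μ ∧
      ∫ ω, curvBound (a · ω) (p · ω) (q · ω) k ∂μ =
        curvBound (fun t => ∫ ω, a t ω ∂μ) (fun t => ∫ ω, p t ω ∂μ) (fun t => ∫ ω, q t ω ∂μ) k := by
  have i1 : Integrable (fun ω => a (k + 1) ω - a (k + 2) ω) μ := (ha (k + 1)).sub (ha (k + 2))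
  have i4' : Integrable (fun ω => 2 * p (k + 1) ω) μ := (hp (k + 1)).const_mul _
  have i4 : Integrable (fun ω => 2 * p (k + 1) ω + q (k + 1) ω) μ := i4'.add (hq (k + 1))
  have i0 : Integrable (fun _ : Ω => (1 / 6 : ℝ)) μ := integrable_const _
  have j1 : Integrable (fun ω => a (k + 1) ω - a (k + 2) ω + 1 / 6) μ := i1.add i0
  refine ⟨(j1.add i4).const_mul 2, ?_⟩
  simp only [curvBound]
  rw [integral_const_mul, integral_add j1 i4, integral_add i1 i0,
    integral_sub (ha (k + 1)) (ha (k + 2)), integral_add i4' (hq (k + 1)), integral_const_mul]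
  simp

/-- Along a run of the algorithm, the gradient norms and the smallest Hessian eigenvalues are
controlled by integrable quantities whose averages are small. -/
theorem IsRun.exists_bounds {Δ fmin : ℝ} {θ₀ : Param d} {T kg kH : ℕ} (hd : 2 ≤ d) (hR : 0 ≤ R)
    (hG : 0 < G) (hcost : BoundedCost m R) (hLS : ExpectedLS m π H G L) (hM : 0 < M)
    (hLip : LipschitzHessian m π H M) (hΔ : 0 < Δ) (hmin : ∀ θ, fmin ≤ J m π H θ) (hT : 1 ≤ T)
    (hkg0 : kg ≠ 0) (hkH0 : kH ≠ 0)
    (hkg : (M * Δ ^ 2)⁻¹ * √(varGrad m.discount R G / kg) ≤ 1 / 48)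
    (hkH : (M * Δ)⁻¹ * √(22 * Real.log d * varHess m.discount R G L H / kH) ≤ 1 / 48)
    (hJ0 : (M * Δ ^ 3)⁻¹ * (J m π H θ₀ - fmin) ≤ T / 192)
    {ℱ : Filtration ℕ mΩ} {θ : ℕ → Ω → Param d}
    {bg : ℕ → Ω → Fin kg → Traj S A H} {bH : ℕ → Ω → Fin kH → Traj S A H}
    (hrun : IsRun m π T Δ θ₀ μ ℱ θ bg bH) :
    ∃ X Y : ℕ → Ω → ℝ, (∀ k, Integrable (X k) μ) ∧ (∀ k, Integrable (Y k) μ) ∧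
      (∀ᵐ ω ∂μ, ∀ k < T, (M * Δ ^ 2)⁻¹ * ‖gradient (J m π H) (θ (k + 1) ω)‖ ≤ X k ω ∧
        25 / 48 ≤ X k ω ∧ -(M * Δ * Y k ω) ≤ lambdaMin (hess (J m π H) (θ (k + 1) ω))) ∧
      ∑ k ∈ Finset.range T, ∫ ω, X k ω ∂μ ≤ 571 / 768 * T ∧
      ∑ k ∈ Finset.range T, ∫ ω, Y k ω ∂μ ≤ T := by
  have hθm : ∀ t ≤ T, Measurable (θ t) := fun t ht =>
    (hrun.measurable_iterate t ht).mono (ℱ.le t) le_rfl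
  set f := J m π H with hf
  set c := (M * Δ ^ 3)⁻¹ with hc
  have hc0 : 0 ≤ c := by positivity
  have hpg : 0 ≤ (M * Δ ^ 2)⁻¹ := by positivity
  have hqg : 0 ≤ (M * Δ)⁻¹ := by positivity
  -- Index `T + 1` carries the lower bound of the objective, and the errors at index `T` are set to
  -- zero, so that the last iterate obeys the same formulas as the others.
  set a : ℕ → Ω → ℝ := fun t ω => if t ≤ T then c * f (θ t ω) else c * fmin with hadef
  set p : ℕ → Ω → ℝ := fun t ω => if t < T then
    (M * Δ ^ 2)⁻¹ * ‖batchGrad m π (bg t ω) (θ t ω) - gradient f (θ t ω)‖ else 0 with hpdef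
  set q : ℕ → Ω → ℝ := fun t ω => if t < T then
    (M * Δ)⁻¹ * ‖symPart (batchHess m π (bH t ω) (θ t ω)) - hess f (θ t ω)‖ else 0 with hqdef
  have ha : ∀ t, Integrable (a t) μ := fun t => by
    by_cases ht : t ≤ T
    · simp only [hadef, ht, if_true]
      refine Integrable.const_mul ?_ c
      refine Integrable.of_bound
        ((continuous_J hR hG hcost hLS).measurable.comp (hθm t ht)).aestronglyMeasurable
        (R / (1 - m.discount)) (Eventually.of_forall fun ω => abs_J_le hR hcost H _)
    · simp only [hadef, ht, if_false]
      exact integrable_const _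
  have hp : ∀ t, Integrable (p t) μ ∧ ∫ ω, p t ω ∂μ ≤ 1 / 48 := fun t => by
    by_cases ht : t < T
    · have := (hrun.sample_grad t ht).integrable_norm (ℱ.le t) (hrun.measurable_iterate t ht.le)
        ((hrun.measurable_batchGrad t ht).mono (ℱ.le _) le_rfl)
        (f := fun z => batchGrad m π z.2 z.1 - gradient f z.1)
        ((stronglyMeasurable_uncurry_batchGrad m π).sub
          ((continuous_gradient_J hR hG hcost hLS).stronglyMeasurable.comp_measurable
            measurable_fst))
        (integral_sq_batchGrad_sub_le hR hG hcost hLS hkg0)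
      simp only [hpdef, ht, if_true]
      refine ⟨this.1.const_mul _, ?_⟩
      rw [integral_const_mul]
      exact (mul_le_mul_of_nonneg_left this.2 hpg).trans hkg
    · simp only [hpdef, ht, if_false]
      exact ⟨integrable_const _, by norm_num⟩
  have hq : ∀ t, Integrable (q t) μ ∧ ∫ ω, q t ω ∂μ ≤ 1 / 48 := fun t => by
    by_cases ht : t < T
    · have := (hrun.sample_hess t ht).integrable_norm (ℱ.le t) (hrun.measurable_iterate t ht.le)
        ((hrun.measurable_batchHess t ht).mono (ℱ.le _) le_rfl)
        (f := fun z => symPart (batchHess m π z.2 z.1) - hess f z.1)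
        ((symPart.continuous.comp_stronglyMeasurable
          (stronglyMeasurable_uncurry_batchHess m π)).sub
          ((hLip.continuous hM).stronglyMeasurable.comp_measurable measurable_fst))
        (integral_sq_batchHess_sub_le hd hR hG hcost hLS hkH0)
      simp only [hqdef, ht, if_true]
      refine ⟨this.1.const_mul _, ?_⟩
      rw [integral_const_mul]
      exact (mul_le_mul_of_nonneg_left this.2 hqg).trans hkH
    · simp only [hqdef, ht, if_false]
      exact ⟨integrable_const _, by norm_num⟩
  have hpath : ∀ᵐ ω ∂μ, (∀ k < T,
      (M * Δ ^ 2)⁻¹ * ‖gradient f (θ (k + 1) ω)‖ ≤ gradBound (a · ω) (p · ω) (q · ω) k ∧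
      25 / 48 ≤ gradBound (a · ω) (p · ω) (q · ω) k ∧
      ∀ v : Param d, ‖v‖ = 1 → -(M * Δ * curvBound (a · ω) (p · ω) (q · ω) k) ≤
        inner ℝ v (hess f (θ (k + 1) ω) v)) ∧
      (1 ≤ T → a 1 ω ≤ a 0 ω + 1 / 6 + p 0 ω + 1 / 2 * q 0 ω) := by
    filter_upwards [ae_all_iff.2 fun t => ae_all_iff.2 fun ht : t < T => hrun.step t ht] with ω hω
    refine bounds_of_path hM hΔ (hasCubicTaylor_J hR hG hcost hLS hLip) hmin (x := fun t => θ t ω)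
      (gh := fun t => batchGrad m π (bg t ω) (θ t ω))
      (Bh := fun t => symPart (batchHess m π (bH t ω) (θ t ω))) (fun t => isSymm_symPart _)
      (fun t ht => (hω t ht).symPart) (fun t ht => ?_) ?_ (fun t ht => ?_) ?_ (fun t ht => ?_) ?_
    · simp [hadef, ht, hc, hf]
    · simp [hadef, hc]
    · simp [hpdef, ht, hf]
    · simp [hpdef]
    · simp [hqdef, ht, hf]
    · simp [hqdef]
  have hX := integral_gradBound ha (fun t => (hp t).1) (fun t => (hq t).1)
  have hY := integral_curvBound ha (fun t => (hp t).1) (fun t => (hq t).1)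
  have hfinal := sum_bounds_le (a := fun t => ∫ ω, a t ω ∂μ) (p := fun t => ∫ ω, p t ω ∂μ)
    (q := fun t => ∫ ω, q t ω ∂μ) hT (fun k _ => (hp k).2) (fun k _ => (hq k).2)
    (by simp [hpdef]) (by simp [hqdef]) (by
      simp only [hadef, hrun.start]
      simp only [zero_le, if_true, Nat.not_succ_le_self, if_false, integral_const, probReal_univ,
        one_smul]
      rw [← mul_sub]
      exact hJ0) (fun k hk => by
      refine integral_mono (ha _) (ha k) fun ω => ?_
      simp only [hadef, hk, if_true, Nat.not_succ_le_self, if_false]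
      exact mul_le_mul_of_nonneg_left (hmin _) hc0) (by
      have i1 : Integrable (fun ω => a 0 ω + 1 / 6) μ := (ha 0).add (integrable_const _)
      have i2 : Integrable (fun ω => a 0 ω + 1 / 6 + p 0 ω) μ := i1.add (hp 0).1
      have i3 : Integrable (fun ω => 1 / 2 * q 0 ω) μ := (hq 0).1.const_mul _
      refine (integral_mono_ae (ha 1) (i2.add i3) ?_).trans_eq ?_
      · filter_upwards [hpath] with ω hω using hω.2 hT
      · simp only [Pi.add_apply]
        rw [integral_add i2 i3, integral_add i1 (hp 0).1, integral_add (ha 0) (integrable_const _),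
          integral_const_mul]
        simp)
  refine ⟨fun k ω => gradBound (a · ω) (p · ω) (q · ω) k,
    fun k ω => curvBound (a · ω) (p · ω) (q · ω) k, fun k => (hX k).1, fun k => (hY k).1, ?_, ?_, ?_⟩
  · filter_upwards [hpath] with ω hω k hk
    obtain ⟨h1, h2, h3⟩ := hω.1 k hk
    exact ⟨h1, h2, le_lambdaMin (by omega) (isSymm_hess_J hR hG hcost hLS _) h3⟩
  · simp_rw [fun k => (hX k).2]
    exact hfinal.1
  · simp_rw [fun k => (hY k).2]
    exact hfinal.2

end Run

end SOPO

namespace SOPO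

/-! ### Batch sizes and horizon in normalized units, with `s` the square root of ε. -/

section Constants

lemma varGrad_pos {γ R G : ℝ} (hγ : γ < 1) (hR : 0 < R) (hG : 0 < G) : 0 < varGrad γ R G := by
  have : 0 < 1 - γ := by linarith
  unfold varGrad
  positivity

lemma varHess_pos {γ R G L : ℝ} (hγ : γ < 1) (hR : 0 < R) (hL : 0 < L) (H : ℕ) :
    0 < varHess γ R G L H := by
  have : 0 < 1 - γ := by linarith
  unfold varHess
  positivity

lemma grad_error_le {M s V k : ℝ} (hM : 0 < M) (hs : 0 < s) (hV : 0 < V)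
    (hk : 144 * M ^ 2 * V / (s ^ 2) ^ 2 ≤ k) :
    0 < k ∧ (M * (2 * s / M) ^ 2)⁻¹ * √(V / k) ≤ 1 / 48 := by
  have hk0 : 0 < k := lt_of_lt_of_le (by positivity) hk
  refine ⟨hk0, ?_⟩
  have h1 : √(V / k) ≤ s ^ 2 / (12 * M) := by
    rw [Real.sqrt_le_left (by positivity), div_le_iff₀ hk0]
    rw [div_le_iff₀ (by positivity)] at hk
    calc V = 144 * M ^ 2 * V / (144 * M ^ 2) := by field_simp
      _ ≤ k * (s ^ 2) ^ 2 / (144 * M ^ 2) := by gcongr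
      _ = _ := by field_simp; ring
  calc _ ≤ (M * (2 * s / M) ^ 2)⁻¹ * (s ^ 2 / (12 * M)) := by gcongr
    _ = 1 / 48 := by field_simp; norm_num

lemma hess_error_le {M s V l k : ℝ} (hM : 0 < M) (hs : 0 < s) (hV : 0 < V) (hl : 0 < l)
    (hk : 22 * 24 ^ 2 * V * l / s ^ 2 ≤ k) :
    0 < k ∧ (M * (2 * s / M))⁻¹ * √(22 * l * V / k) ≤ 1 / 48 := by
  have hk0 : 0 < k := lt_of_lt_of_le (by positivity) hk
  refine ⟨hk0, ?_⟩
  have h1 : √(22 * l * V / k) ≤ s / 24 := by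
    rw [Real.sqrt_le_left (by positivity), div_le_iff₀ hk0]
    rw [div_le_iff₀ (by positivity)] at hk
    linarith [show (s / 24) ^ 2 * k = k * s ^ 2 / 576 by ring]
  calc _ ≤ (M * (2 * s / M))⁻¹ * (s / 24) := by gcongr
    _ = 1 / 48 := by field_simp; norm_num

lemma initial_gap_le {M s D T : ℝ} (hM : 0 < M) (hs : 0 < s)
    (hT : 24 * M ^ 2 * D / s ^ 3 ≤ T) : (M * (2 * s / M) ^ 3)⁻¹ * D ≤ T / 192 := by
  have : (M * (2 * s / M) ^ 3)⁻¹ * D = 24 * M ^ 2 * D / s ^ 3 / 192 := by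
    field_simp; ring
  rw [this]
  gcongr

end Constants

end SOPO

/-! ### Averaging over the uniform index and the tail bound. -/

theorem theoremC1 {S A Ω : Type*} [MeasurableSpace S] [MeasurableSpace A] [mΩ : MeasurableSpace Ω]
    {d : ℕ} (hd : 2 ≤ d)
    -- the Markov decision process, the policy and the horizon
    (m : SOPO.MDP S A) (π : SOPO.Policy S A d) (H : ℕ)
    -- the standing assumptions
    (R G L M : ℝ) (hR : 0 < R) (hG : 0 < G) (hL : 0 < L) (hM : 0 < M)
    (hcost : SOPO.BoundedCost m R)
    (hLS : SOPO.ExpectedLS m π H G L)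
    (hLip : SOPO.LipschitzHessian m π H M)
    -- the parameters of the algorithm
    (ε : ℝ) (hε : 0 < ε)
    (θ₀ : SOPO.Param d) (ΔJ : ℝ)
    (hΔJ : SOPO.J m π H θ₀ - (⨅ θ, SOPO.J m π H θ) ≤ ΔJ)
    (kg kH T : ℕ)
    (hkg : 144 * M ^ 2 * SOPO.varGrad m.discount R G / ε ^ 2 ≤ kg)
    (hkH : 22 * 24 ^ 2 * SOPO.varHess m.discount R G L H * Real.log d / ε ≤ kH)
    (hT0 : 1 ≤ T)
    (hT : 24 * M ^ 2 * ΔJ / ε ^ (3 / 2 : ℝ) ≤ T)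
    -- a run of the algorithm
    (μ : Measure Ω) [IsProbabilityMeasure μ] (ℱ : Filtration ℕ mΩ)
    (θ : ℕ → Ω → SOPO.Param d)
    (bg : ℕ → Ω → Fin kg → SOPO.Traj S A H) (bH : ℕ → Ω → Fin kH → SOPO.Traj S A H)
    (hrun : SOPO.IsRun m π T (2 * Real.sqrt ε / M) θ₀ μ ℱ θ bg bH)
    -- an independent index, uniform on `{1, …, T}`
    (tbar : Ω → ℕ) (htbar : Measurable tbar)
    (hunif : μ.map tbar = uniformOn (Set.Icc 1 T))
    (hindep : IndepFun (fun ω (t : Fin (T + 1)) => θ t ω) tbar μ) :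
    (Integrable (fun ω => ‖gradient (SOPO.J m π H) (θ (tbar ω) ω)‖) μ ∧
      ∫ ω, ‖gradient (SOPO.J m π H) (θ (tbar ω) ω)‖ ∂μ ≤ 3 / M * ε) ∧
    (Integrable (fun ω => SOPO.lambdaMin (SOPO.hess (SOPO.J m π H) (θ (tbar ω) ω))) μ ∧
      -2 * Real.sqrt ε ≤
        ∫ ω, SOPO.lambdaMin (SOPO.hess (SOPO.J m π H) (θ (tbar ω) ω)) ∂μ) ∧
    7 / 8 ≤ μ.real {ω | ‖gradient (SOPO.J m π H) (θ (tbar ω) ω)‖ ≤ 12 / M * ε} := by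
  have hd0 : 0 < d := by omega
  obtain ⟨s, hs, hsε⟩ : ∃ s, 0 < s ∧ Real.sqrt ε = s := ⟨_, Real.sqrt_pos.2 hε, rfl⟩
  have hε2 : ε = s ^ 2 := by rw [← hsε, Real.sq_sqrt hε.le]
  have hpow : ε ^ (3 / 2 : ℝ) = s ^ 3 := by
    rw [Real.rpow_div_two_eq_sqrt _ hε.le, hsε]
    exact_mod_cast Real.rpow_natCast s 3
  rw [hpow] at hT
  rw [hsε] at hrun ⊢
  rw [hε2] at hkg hkH ⊢
  have hlog : 0 < Real.log d := Real.log_pos (by exact_mod_cast hd)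
  obtain ⟨hkg0, hkg'⟩ := SOPO.grad_error_le hM hs (SOPO.varGrad_pos m.discount_lt_one hR hG) hkg
  obtain ⟨hkH0, hkH'⟩ := SOPO.hess_error_le hM hs
    (SOPO.varHess_pos m.discount_lt_one hR hL H) hlog hkH
  have hT1 : (0 : ℝ) < T := by exact_mod_cast hT0
  have hJ0 : (M * (2 * s / M) ^ 3)⁻¹ * (SOPO.J m π H θ₀ - ⨅ θ, SOPO.J m π H θ) ≤ T / 192 :=
    (mul_le_mul_of_nonneg_left hΔJ (by positivity)).trans (SOPO.initial_gap_le hM hs hT)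
  obtain ⟨X, Y, hX, hY, hXY, hXs, hYs⟩ := hrun.exists_bounds hd hR.le hG hcost hLS hM hLip
    (by positivity) (fun θ => ciInf_le (SOPO.bddBelow_range_J hR.le hcost) θ) hT0
    (by rintro rfl; simp at hkg0) (by rintro rfl; simp at hkH0) hkg' hkH' hJ0
  have hunit2 : M * (2 * s / M) ^ 2 = 4 * s ^ 2 / M := by field_simp; norm_num
  have hunit1 : M * (2 * s / M) = 2 * s := by field_simp
  rw [hunit2, hunit1] at hXY
  have hcg := SOPO.continuous_gradient_J hR.le hG hcost hLS
  have hcl := SOPO.continuous_lambdaMin_hess_J hd0 hR.le hG hcost hLS hM hLip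
  have hθm : ∀ k < T, Measurable (θ (k + 1)) := fun k hk =>
    (hrun.measurable_iterate (k + 1) hk).mono (ℱ.le _) le_rfl
  have hXY' : ∀ k < T, ∀ᵐ ω ∂μ,
      ‖gradient (SOPO.J m π H) (θ (k + 1) ω)‖ ≤ 4 * s ^ 2 / M * X k ω ∧ 25 / 48 ≤ X k ω ∧
        -(2 * s * Y k ω) ≤ SOPO.lambdaMin (SOPO.hess (SOPO.J m π H) (θ (k + 1) ω)) := by
    intro k hk
    filter_upwards [hXY] with ω hω
    obtain ⟨h1, h2, h3⟩ := hω k hk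
    exact ⟨(inv_mul_le_iff₀ (by positivity)).1 h1, h2, h3⟩
  have avg : ∀ {φ : SOPO.Param d → ℝ}, Measurable φ →
      (∀ k < T, Integrable (fun ω => φ (θ (k + 1) ω)) μ) → _ :=
    fun hφ hi => SOPO.integral_comp_uniform_index hT0 htbar hunif hindep hφ hi
  refine ⟨?_, ?_, ?_⟩
  · have hi : ∀ k < T, Integrable (fun ω => ‖gradient (SOPO.J m π H) (θ (k + 1) ω)‖) μ :=
      fun k hk => ((hX k).const_mul (4 * s ^ 2 / M)).mono'
        (hcg.norm.measurable.comp (hθm k hk)).aestronglyMeasurable (by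
          filter_upwards [hXY' k hk] with ω hω
          rw [norm_norm]
          exact hω.1)
    obtain ⟨h1, h2⟩ := avg hcg.norm.measurable hi
    refine ⟨h1, h2.trans_le ?_⟩
    calc _ ≤ (T : ℝ)⁻¹ * ∑ k ∈ Finset.range T, 4 * s ^ 2 / M * ∫ ω, X k ω ∂μ := by
          refine mul_le_mul_of_nonneg_left (Finset.sum_le_sum fun k hk => ?_) (by positivity)
          rw [← integral_const_mul]
          refine integral_mono_ae (hi k (Finset.mem_range.1 hk)) ((hX k).const_mul _) ?_
          filter_upwards [hXY' k (Finset.mem_range.1 hk)] with ω hω using hω.1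
      _ ≤ (T : ℝ)⁻¹ * (4 * s ^ 2 / M * (571 / 768 * T)) := by
          rw [← Finset.mul_sum]
          gcongr
      _ = 571 / 192 * (s ^ 2 / M) := by field_simp; norm_num
      _ ≤ 3 * (s ^ 2 / M) := by gcongr; norm_num
      _ = 3 / M * s ^ 2 := by ring
  · have hi : ∀ k < T, Integrable
        (fun ω => SOPO.lambdaMin (SOPO.hess (SOPO.J m π H) (θ (k + 1) ω))) μ := fun k hk => by
      refine (((hY k).const_mul (2 * s)).abs.add (integrable_const
        (√(2 * SOPO.varHess m.discount R G L H)))).mono'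
        (hcl.measurable.comp (hθm k hk)).aestronglyMeasurable ?_
      filter_upwards [hXY' k hk] with ω hω
      have h1 := SOPO.lambdaMin_hess_J_le hd0 hR.le hG hcost hLS (θ (k + 1) ω)
      have h2 := le_abs_self (2 * s * Y k ω)
      have h3 := abs_nonneg (2 * s * Y k ω)
      have h4 := Real.sqrt_nonneg (2 * SOPO.varHess m.discount R G L H)
      simp only [Pi.add_apply, Real.norm_eq_abs]
      exact abs_le.2 ⟨by linarith [hω.2.2], by linarith⟩
    obtain ⟨h1, h2⟩ := avg hcl.measurable hi
    refine ⟨h1, le_trans ?_ h2.ge⟩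
    calc -2 * s = (T : ℝ)⁻¹ * (-(2 * s) * T) := by field_simp
      _ ≤ (T : ℝ)⁻¹ * (-(2 * s) * ∑ k ∈ Finset.range T, ∫ ω, Y k ω ∂μ) :=
          mul_le_mul_of_nonneg_left (mul_le_mul_of_nonpos_left hYs (by linarith)) (by positivity)
      _ ≤ _ := by
          rw [Finset.mul_sum]
          refine mul_le_mul_of_nonneg_left (Finset.sum_le_sum fun k hk => ?_) (by positivity)
          rw [← integral_const_mul]
          refine integral_mono_ae ((hY k).const_mul _) (hi k (Finset.mem_range.1 hk)) ?_
          filter_upwards [hXY' k (Finset.mem_range.1 hk)] with ω hω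
          linarith [hω.2.2]
  · set B : Set (SOPO.Param d) := {x | 12 / M * s ^ 2 < ‖gradient (SOPO.J m π H) x‖} with hB
    have hBm : MeasurableSet B := measurableSet_lt measurable_const hcg.norm.measurable
    have hφ : Measurable (B.indicator fun _ => (1 : ℝ)) := measurable_const.indicator hBm
    have hi : ∀ k < T, Integrable (fun ω => B.indicator (fun _ => (1 : ℝ)) (θ (k + 1) ω)) μ :=
      fun k hk => Integrable.of_bound (hφ.comp (hθm k hk)).aestronglyMeasurable 1
        (Filter.Eventually.of_forall fun ω => by
          by_cases h : θ (k + 1) ω ∈ B <;> simp [h])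
    obtain ⟨h1, h2⟩ := avg hφ hi
    have hle : ∫ ω, B.indicator (fun _ => (1 : ℝ)) (θ (tbar ω) ω) ∂μ ≤ 1 / 8 := by
      rw [h2]
      -- The threshold 12ε/M is 3 normalized units. As `X k` is at least 25/48, the indicator of
      -- exceeding 3 is at most (`X k` - 25/48) / (3 - 25/48), with 3 - 25/48 = 119/48. On average
      -- this is at most 171/1904 < 1/8, whereas Markov's inequality without the shift would give
      -- only about 1/4.
      calc _ ≤ (T : ℝ)⁻¹ * ∑ k ∈ Finset.range T, 48 / 119 * ((∫ ω, X k ω ∂μ) - 25 / 48) := by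
            refine mul_le_mul_of_nonneg_left (Finset.sum_le_sum fun k hk => ?_) (by positivity)
            have hXi : Integrable (fun ω => X k ω - 25 / 48) μ := (hX k).sub (integrable_const _)
            have : 48 / 119 * ((∫ ω, X k ω ∂μ) - 25 / 48) = ∫ ω, 48 / 119 * (X k ω - 25 / 48) ∂μ := by
              rw [integral_const_mul, integral_sub (hX k) (integrable_const _)]
              simp
            rw [this]
            refine integral_mono_ae (hi k (Finset.mem_range.1 hk)) (hXi.const_mul _) ?_
            filter_upwards [hXY' k (Finset.mem_range.1 hk)] with ω hω
            by_cases h : θ (k + 1) ω ∈ B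
            · rw [Set.indicator_of_mem h]
              have h3 : 4 * s ^ 2 / M * 3 < 4 * s ^ 2 / M * X k ω :=
                lt_of_eq_of_lt (by ring) (lt_of_lt_of_le h hω.1)
              have h4 : 3 < X k ω := lt_of_mul_lt_mul_left h3 (by positivity)
              linarith
            · rw [Set.indicator_of_notMem h]
              linarith [hω.2.1]
        _ = (T : ℝ)⁻¹ * (48 / 119 * (∑ k ∈ Finset.range T, (∫ ω, X k ω ∂μ) - 25 / 48 * T)) := by
            rw [← Finset.mul_sum, Finset.sum_sub_distrib, Finset.sum_const, Finset.card_range,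
              nsmul_eq_mul, mul_comm (T : ℝ)]
        _ ≤ (T : ℝ)⁻¹ * (48 / 119 * (571 / 768 * T - 25 / 48 * T)) := by gcongr
        _ ≤ 1 / 8 := by
            rw [inv_mul_le_iff₀ hT1]
            linarith
    have hmarkov := mul_meas_ge_le_integral_of_nonneg (μ := μ)
      (Filter.Eventually.of_forall fun ω => Set.indicator_nonneg (fun _ _ => zero_le_one) _) h1 1
    have hcover : (Set.univ : Set Ω) ⊆
        {ω | ‖gradient (SOPO.J m π H) (θ (tbar ω) ω)‖ ≤ 12 / M * s ^ 2} ∪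
          {ω | 1 ≤ B.indicator (fun _ => (1 : ℝ)) (θ (tbar ω) ω)} := fun ω _ => by
      by_cases h : θ (tbar ω) ω ∈ B
      · exact Or.inr (by simp [Set.indicator_of_mem h])
      · refine Or.inl ?_
        rw [Set.mem_ofPred_eq]
        exact le_of_not_gt h
    have h3 := (measureReal_mono (μ := μ) hcover).trans (measureReal_union_le _ _)
    rw [probReal_univ] at h3
    linarith
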